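/- Let $X$ be a smooth manifold and let $\pi:Z\to X$, $\hat\pi:\hat Z\to X$ be smooth principal circle bundles. Let $v,\hat v$ be the vector fields generating the circle actions, normalized to have period one, and let $A,\hat A$ be connection one-forms, i.e. real invariant one-forms with $A(v)=1$, $\hat A(\hat v)=1$, with curvatures $dA=\pi^*F$, $d\hat A=\hat\pi^*\hat F$. Suppose $(Z,A,H)$ and $(\hat Z,\hat A,\hat H)$ are T-dual: $H$ is a real closed invariant three-form on $Z$, and for some three-form $\Omega$ on $X$ $$H=A\wedge \pi^*\hat F+\pi^*\Omega,\qquad \hat H=\hat\pi^*F\wedge\hat A+\hat\pi^*\Omega .$$ Let $\Omega^*(Z)$ be the space of smooth complex valued (inhomogeneous) differential forms, and for $n\in\mathbb Z$ let $$\Omega^*_{-n}(Z)=\{\omega\in\Omega^*(Z)\mid L_v\omega=-2\pi i n\,\omega\},$$ and similarly for $\hat Z$. Let $\xi=Z\times_{U(1)}\mathbb C$ be the line bundle associated to $Z$ and $\rho$ the tautological section of its pullback to $Z\times_X\hat Z$. Let $\int^{\mathbb T,n}$ be the twisted integration along the fibres of $Z\times_X\hat Z\to\hat Z$: over a local trivialization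 of $Z$ with fibre coordinate $\theta\in\mathbb R/\mathbb Z$ and local frame $s$ of $\xi$ with $\rho=e^{2\pi i\theta}s$, it sends $\beta$ to $\left(\int\beta\, e^{2\pi i n\theta}\right)\otimes s^{\otimes n}$. Let $\int^{\hat{\mathbb T}}$ be the integration along the fibres of $Z\times_X\hat Z\to Z$. In both integrations the fibre direction is contracted in the first slot. Put $$\tau_n(\omega)=\int^{\mathbb T,n}\omega\, e^{-A\wedge\hat A}\in\Omega^*(\hat Z,\hat\pi^*\xi^{\otimes n}),\qquad \hat\sigma_n(\theta)=\int^{\hat{\mathbb T}}\theta\,(\rho^{-1})^{\otimes n} e^{A\wedge\hat A},\qquad \hat\eta_n=\frac{\hat A}{d\hat A-2\pi i n}\quad(n\neq0).$$ 1. For every $n\ne0$ the complexes $(\Omega^*_{-n}(Z),d+H)$ and $(\Omega^*_{-n}(\hat Z),d+\hat H)$ are acyclic: $$H(\Omega^*_{-n}(Z),d+H)=0,\qquad H(\Omega^*_{-n}(\hat Z),d+\hat H)=0 .$$ 2. For every $n\neq 0$, the operator $\omega\mapsto\hat\sigma_n[\hat\eta_n\cdot\tau_n(\omega)]$ maps $\Omega^*_{-n}(Z)$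 to itself, and for all $\omega\in\Omega^*_{-n}(Z)$ $$(d+H)\,\hat\sigma_n[\hat\eta_n\cdot\tau_n(\omega)]+\hat\sigma_n\big(\hat\eta_n\cdot\tau_n[(d+H)\omega]\big)=\omega .$$ 3. The twisted cohomology of all forms is concentrated in the invariant part: the inclusions of complexes $(\Omega^*(Z)^{\mathbb T},d+H)\subset(\Omega^*(Z),d+H)$ and $(\Omega^*(\hat Z)^{\hat{\mathbb T}},d+\hat H)\subset(\Omega^*(\hat Z),d+\hat H)$ induce isomorphisms in cohomology. -/

import Mathlib

open scoped Manifold ContDiff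

noncomputable section

namespace TDuality

/-! ### Exterior algebra of a real topological vector space, with complex coefficients -/

section Alternating

theorem fst_update {T : Type*} {k : ℕ} (p : Fin (k + 1)) (u : Fin k → T)
    (i : Fin k) (hi : (i : ℕ) < p)
    (z : T) : (fun l : Fin (p : ℕ) => Function.update u i z ⟨l, by omega⟩) =
      Function.update (fun l : Fin (p : ℕ) => u ⟨l, by omega⟩) ⟨i, hi⟩ z := by
  ext l
  simp only [Function.update_apply, Fin.ext_iff]

theorem fst_update_of_le {T : Type*} {k : ℕ} (p : Fin (k + 1)) (u : Fin k → T)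
    (i : Fin k) (hi : ¬ (i : ℕ) < p) (z : T) :
    (fun l : Fin (p : ℕ) => Function.update u i z ⟨l, by omega⟩) =
      fun l : Fin (p : ℕ) => u ⟨l, by omega⟩ := by
  ext l
  rw [Function.update_of_ne]
  intro h
  simp only [Fin.ext_iff] at h
  omega

theorem snd_update {T : Type*} {k : ℕ} (p : Fin (k + 1)) (u : Fin k → T)
    (i : Fin k) (hi : ¬ (i : ℕ) < p)
    (z : T) : (fun l : Fin (k - p) => Function.update u i z ⟨p + l, by omega⟩) =
      Function.update (fun l : Fin (k - p) => u ⟨p + l, by omega⟩) ⟨i - p, by omega⟩ z := by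
  ext l
  have h : (p : ℕ) + l = i ↔ (l : ℕ) = i - p := by omega
  simp only [Function.update_apply, Fin.ext_iff, h]

theorem snd_update_of_lt {T : Type*} {k : ℕ} (p : Fin (k + 1)) (u : Fin k → T)
    (i : Fin k) (hi : (i : ℕ) < p) (z : T) :
    (fun l : Fin (k - p) => Function.update u i z ⟨p + l, by omega⟩) =
      fun l : Fin (k - p) => u ⟨p + l, by omega⟩ := by
  ext l
  rw [Function.update_of_ne]
  intro h
  simp only [Fin.ext_iff] at h
  omega

variable {V W : Type*}
  [AddCommGroup V] [Module ℝ V] [TopologicalSpace V]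
  [AddCommGroup W] [Module ℝ W] [TopologicalSpace W]

/-- Inhomogeneous complex valued exterior forms on `V`: one alternating form in each degree.
(On a finite dimensional `V` only finitely many degrees are nonzero.) -/
abbrev Alt (V : Type*) [AddCommGroup V] [Module ℝ V] [TopologicalSpace V] : Type _ :=
  ∀ k : ℕ, V [⋀^Fin k]→L[ℝ] ℂ

/-- The form `u ↦ a (u₀, …, u_{p-1}) * b (u_p, …, u_{k-1})`, before antisymmetrization. -/
def mulForm {k : ℕ} (p : Fin (k + 1)) (a : V [⋀^Fin (p : ℕ)]→L[ℝ] ℂ)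
    (b : V [⋀^Fin (k - p)]→L[ℝ] ℂ) : ContinuousMultilinearMap ℝ (fun _ : Fin k => V) ℂ where
  toFun u := a (fun i => u ⟨i, by omega⟩) * b (fun j => u ⟨p + j, by omega⟩)
  map_update_add' := by
    intro inst u i x y
    obtain rfl := Subsingleton.elim inst (instDecidableEqFin k)
    by_cases hi : (i : ℕ) < p
    · rw [fst_update p u i hi, fst_update p u i hi, fst_update p u i hi,
        snd_update_of_lt p u i hi, snd_update_of_lt p u i hi, snd_update_of_lt p u i hi,
        ContinuousAlternatingMap.map_update_add, add_mul]
    · rw [snd_update p u i hi, snd_update p u i hi, snd_update p u i hi,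
        fst_update_of_le p u i hi, fst_update_of_le p u i hi, fst_update_of_le p u i hi,
        ContinuousAlternatingMap.map_update_add, mul_add]
  map_update_smul' := by
    intro inst u i c x
    obtain rfl := Subsingleton.elim inst (instDecidableEqFin k)
    by_cases hi : (i : ℕ) < p
    · rw [fst_update p u i hi, fst_update p u i hi,
        snd_update_of_lt p u i hi, snd_update_of_lt p u i hi,
        ContinuousAlternatingMap.map_update_smul, smul_mul_assoc]
    · rw [snd_update p u i hi, snd_update p u i hi,
        fst_update_of_le p u i hi, fst_update_of_le p u i hi,
        ContinuousAlternatingMap.map_update_smul, mul_smul_comm]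
  cont := by
    refine Continuous.mul ?_ ?_
    · exact a.coe_continuous.comp (continuous_pi fun i => continuous_apply _)
    · exact b.coe_continuous.comp (continuous_pi fun i => continuous_apply _)

/-- The wedge product: its degree `k` part is
`∑_{p+q=k} 1/(p! q!) ∑_σ sign σ • a_p (u_{σ 0}, …) * b_q (u_{σ p}, …)`. -/
def wedge (a b : Alt V) : Alt V := fun k =>
  ∑ p : Fin (k + 1), (((p : ℕ).factorial : ℂ) * ((k - p : ℕ).factorial : ℂ))⁻¹ •
    ContinuousMultilinearMap.alternatization (mulForm p (a p) (b (k - p)))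

/-- The unit `1` of the exterior algebra. -/
def unit : Alt V
  | 0 => ContinuousAlternatingMap.constOfIsEmpty ℝ V (Fin 0) 1
  | _ + 1 => 0

/-- The powers `a ∧ ⋯ ∧ a`. -/
def wpow (a : Alt V) : ℕ → Alt V
  | 0 => unit
  | j + 1 => wedge a (wpow a j)

/-- The exponential `∑_j a^j / j!` of a form `a` without degree zero part; in degree `k` only
`j ≤ k` can contribute. -/
def wexp (a : Alt V) : Alt V := fun k =>
  ∑ j ∈ Finset.range (k + 1), ((j.factorial : ℂ))⁻¹ • wpow a j k

/-- The inverse `(a - c)⁻¹ = - ∑_j c^{-(j+1)} a^j` for a form `a` without degree zero part and a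
nonzero constant `c`; in degree `k` only `j ≤ k` can contribute. -/
def invSub (a : Alt V) (c : ℂ) : Alt V := fun k =>
  -∑ j ∈ Finset.range (k + 1), (c⁻¹) ^ (j + 1) • wpow a j k

/-- Pullback of exterior forms along a continuous linear map. -/
def altPullback (f : W →L[ℝ] V) (a : Alt V) : Alt W := fun k =>
  (a k).compContinuousLinearMap f

open Classical in
/-- The alternating form with the given values (`0` if the values are not those of an
alternating form). -/
def altOfFun {k : ℕ} (f : (Fin k → V) → ℂ) : V [⋀^Fin k]→L[ℝ] ℂ :=
  if h : ∃ a : V [⋀^Fin k]→L[ℝ] ℂ, ⇑a = f then h.choose else 0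

end Alternating

/-! ### Differential forms on manifolds -/

section Manifolds

variable {E : Type*} [NormedAddCommGroup E] [NormedSpace ℝ E]
  {M : Type*} [TopologicalSpace M] [ChartedSpace E M]
  {E' : Type*} [NormedAddCommGroup E'] [NormedSpace ℝ E']
  {N : Type*} [TopologicalSpace N] [ChartedSpace E' N]

/-- Complex valued, inhomogeneous differential forms on `M`, no regularity required yet. -/
abbrev DForm (E : Type*) [NormedAddCommGroup E] [NormedSpace ℝ E]
    (M : Type*) [TopologicalSpace M] [ChartedSpace E M] : Type _ :=
  ∀ x : M, Alt (TangentSpace 𝓘(ℝ, E) x)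

namespace DForm

/-- The degree `k` part of `ψ` in the preferred chart around `x`. -/
def chartRep (ψ : DForm E M) (x : M) (k : ℕ) : E → E [⋀^Fin k]→L[ℝ] ℂ := fun y =>
  (ψ ((extChartAt 𝓘(ℝ, E) x).symm y) k).compContinuousLinearMap
    (mfderiv 𝓘(ℝ, E) 𝓘(ℝ, E) (extChartAt 𝓘(ℝ, E) x).symm y)

/-- Smooth differential forms: those with smooth coefficients in the charts. -/
def Smooth (ψ : DForm E M) : Prop :=
  ∀ (x : M) (k : ℕ), ContDiffOn ℝ ∞ (ψ.chartRep x k) (extChartAt 𝓘(ℝ, E) x).target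

/-- The form `ψ` is concentrated in degree `k`. -/
def HasDegree (ψ : DForm E M) (k : ℕ) : Prop := ∀ (x : M) (j : ℕ), j ≠ k → ψ x j = 0

/-- The form `ψ` is real valued. -/
def IsReal (ψ : DForm E M) : Prop :=
  ∀ (x : M) (k : ℕ) (u : Fin k → TangentSpace 𝓘(ℝ, E) x), (ψ x k u).im = 0

/-- The exterior derivative, computed at `x` in the preferred chart around `x`. -/
def d (ψ : DForm E M) : DForm E M := fun x k =>
  match k with
  | 0 => 0
  | k + 1 => (extDeriv (ψ.chartRep x k) (extChartAt 𝓘(ℝ, E) x x)).compContinuousLinearMap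
      (mfderiv 𝓘(ℝ, E) 𝓘(ℝ, E) (extChartAt 𝓘(ℝ, E) x) x)

/-- The wedge product of differential forms. -/
def wedge (α β : DForm E M) : DForm E M := fun x => TDuality.wedge (α x) (β x)

/-- The pullback of differential forms along a map. -/
def pullback (f : M → N) (ψ : DForm E' N) : DForm E M := fun x =>
  altPullback (mfderiv 𝓘(ℝ, E) 𝓘(ℝ, E') f x) (ψ (f x))

/-- The twisted de Rham differential `d + H ∧`. -/
def twistedD (H : DForm E M) (ψ : DForm E M) : DForm E M := d ψ + wedge H ψ

end DForm

/-- `(W, D)` is a complex: `D` maps `W` to itself and `D ∘ D = 0` on `W`. -/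
def IsComplexOn (D : DForm E M → DForm E M) (W : Set (DForm E M)) : Prop :=
  ∀ ψ ∈ W, D ψ ∈ W ∧ D (D ψ) = 0

/-- `(W, D)` is a complex with vanishing cohomology. -/
def IsAcyclicOn (D : DForm E M → DForm E M) (W : Set (DForm E M)) : Prop :=
  IsComplexOn D W ∧ ∀ ψ ∈ W, D ψ = 0 → ∃ α ∈ W, D α = ψ

/-- `(W₀, D)` is a subcomplex of the complex `(W, D)`, and the inclusion induces an isomorphism
(a surjection and an injection) in cohomology. -/
def CohomologyConcentratedIn (D : DForm E M → DForm E M) (W₀ W : Set (DForm E M)) : Prop :=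
  W₀ ⊆ W ∧ IsComplexOn D W₀ ∧ IsComplexOn D W ∧
  (∀ ψ ∈ W, D ψ = 0 → ∃ ψ₀ ∈ W₀, D ψ₀ = 0 ∧ ∃ α ∈ W, ψ = ψ₀ + D α) ∧
  (∀ ψ₀ ∈ W₀, (∃ α ∈ W, D α = ψ₀) → ∃ α₀ ∈ W₀, D α₀ = ψ₀)

/-- Smooth forms. -/
def smoothForms (E : Type*) [NormedAddCommGroup E] [NormedSpace ℝ E]
    (M : Type*) [TopologicalSpace M] [ChartedSpace E M] : Set (DForm E M) :=
  {ψ | ψ.Smooth}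

/-! ### Circle actions -/

/-- The circle action, as a flow of period one. -/
def rot [MulAction Circle M] (t : ℝ) (x : M) : M := Circle.exp (2 * Real.pi * t) • x

/-- The vector field generating the circle action, `v(x) = d/dt (e^{2πit} x)` at `t = 0`. -/
def genField (E : Type*) [NormedAddCommGroup E] [NormedSpace ℝ E]
    {M : Type*} [TopologicalSpace M] [ChartedSpace E M] [MulAction Circle M] (x : M) :
    TangentSpace 𝓘(ℝ, E) x :=
  mfderiv 𝓘(ℝ, ℝ) 𝓘(ℝ, E) (fun t : ℝ => rot t x) 0 (1 : ℝ)

/-- `μ` is the Lie derivative of `ψ` along the generator of the circle action: the derivative at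
`t = 0` of the pullbacks of `ψ` along the flow. -/
def HasLieDeriv [MulAction Circle M] (ψ μ : DForm E M) : Prop :=
  ∀ (x : M) (k : ℕ) (u : Fin k → TangentSpace 𝓘(ℝ, E) x),
    HasDerivAt (fun t : ℝ => DForm.pullback (rot t) ψ x k u) (μ x k u) 0

/-- The smooth forms of weight `m`: those with `L_v ψ = 2πi m ψ`. (The factor `2πi` is there since
`v` is the real generator of period one.) -/
def weightForms (E : Type*) [NormedAddCommGroup E] [NormedSpace ℝ E]
    (M : Type*) [TopologicalSpace M] [ChartedSpace E M] [MulAction Circle M] (m : ℤ) :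
    Set (DForm E M) :=
  {ψ | ψ.Smooth ∧ HasLieDeriv ψ ((2 * Real.pi * Complex.I * m : ℂ) • ψ)}

/-- The smooth forms that are invariant under the circle action. -/
def invariantForms (E : Type*) [NormedAddCommGroup E] [NormedSpace ℝ E]
    (M : Type*) [TopologicalSpace M] [ChartedSpace E M] [MulAction Circle M] :
    Set (DForm E M) :=
  {ψ | ψ.Smooth ∧ ∀ g : Circle, DForm.pullback (fun x : M => g • x) ψ = ψ}

/-- A smooth principal circle bundle over `X` with total space `Z`. -/
structure CircleBundle (EX : Type*) [NormedAddCommGroup EX] [NormedSpace ℝ EX]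
    (X : Type*) [TopologicalSpace X] [ChartedSpace EX X]
    (E : Type*) [NormedAddCommGroup E] [NormedSpace ℝ E]
    (Z : Type*) [TopologicalSpace Z] [ChartedSpace E Z] [MulAction Circle Z] where
  /-- The bundle projection. -/
  proj : Z → X
  smooth_proj : ContMDiff 𝓘(ℝ, E) 𝓘(ℝ, EX) ∞ proj
  smooth_smul : ContMDiff ((𝓡 1).prod 𝓘(ℝ, E)) 𝓘(ℝ, E) ∞ (fun p : Circle × Z => p.1 • p.2)
  proj_smul : ∀ (g : Circle) (z : Z), proj (g • z) = proj z
  /-- Local triviality, by equivariant diffeomorphisms over open sets of the base. -/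
  exists_triv : ∀ x : X, ∃ (U : Set X) (e : OpenPartialHomeomorph Z (X × Circle)),
    IsOpen U ∧ x ∈ U ∧ e.source = proj ⁻¹' U ∧ e.target = U ×ˢ Set.univ ∧
    (∀ z ∈ e.source, (e z).1 = proj z) ∧
    (∀ (g : Circle), ∀ z ∈ e.source, (e (g • z)).2 = g * (e z).2) ∧
    ContMDiffOn 𝓘(ℝ, E) (𝓘(ℝ, EX).prod (𝓡 1)) ∞ e e.source ∧
    ContMDiffOn (𝓘(ℝ, EX).prod (𝓡 1)) 𝓘(ℝ, E) ∞ e.symm e.target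

/-- `A` is a connection one-form: real, smooth, invariant, and `A(v) = 1`. -/
structure IsConnection [MulAction Circle M] (A : DForm E M) : Prop where
  degree : A.HasDegree 1
  real : A.IsReal
  smooth : A.Smooth
  invariant : ∀ g : Circle, DForm.pullback (fun x : M => g • x) A = A
  genField_eq_one : ∀ x : M, A x 1 (fun _ => genField E x) = 1

end Manifolds

/-! ### T-dual pairs -/

/-- A T-dual pair: two principal circle bundles over `X` with connections `A`, `A'` and fluxes
`H`, `H'`, where `H` is an invariant closed three-form and, with `F`, `F'` the curvatures
and `Ω` a three-form on the base, `dA = F`, `dA' = F'`, `H = A ∧ F' + Ω` and `H' = F ∧ A' + Ω`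
(pullbacks to the total spaces understood). In particular `F' = ι_v H` is the integral of `H` along
the fibres, and `H' = H + d(A ∧ A')` on the correspondence space. -/
structure TDualPair (EX : Type*) [NormedAddCommGroup EX] [NormedSpace ℝ EX]
    (X : Type*) [TopologicalSpace X] [ChartedSpace EX X]
    (E : Type*) [NormedAddCommGroup E] [NormedSpace ℝ E]
    (Z : Type*) [TopologicalSpace Z] [ChartedSpace E Z] [MulAction Circle Z]
    (E' : Type*) [NormedAddCommGroup E'] [NormedSpace ℝ E']
    (Z' : Type*) [TopologicalSpace Z'] [ChartedSpace E' Z'] [MulAction Circle Z'] where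
  /-- The bundle `Z → X`. -/
  bundle : CircleBundle EX X E Z
  /-- The dual bundle. -/
  bundle' : CircleBundle EX X E' Z'
  /-- The connection on `Z`. -/
  A : DForm E Z
  /-- The connection on the dual bundle. -/
  A' : DForm E' Z'
  isConnection : IsConnection A
  isConnection' : IsConnection A'
  /-- The flux on `Z`. -/
  H : DForm E Z
  /-- The dual flux. -/
  H' : DForm E' Z'
  degree_H : H.HasDegree 3
  real_H : H.IsReal
  smooth_H : H.Smooth
  closed_H : H.d = 0
  invariant_H : ∀ g : Circle, DForm.pullback (fun z : Z => g • z) H = H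
  /-- The curvature of `A`, on the base. -/
  F : DForm EX X
  /-- The curvature of `A'`, on the base. -/
  F' : DForm EX X
  /-- The basic part of the fluxes, on the base. -/
  Ω : DForm EX X
  smooth_F : F.Smooth
  smooth_F' : F'.Smooth
  smooth_Ω : Ω.Smooth
  degree_F : F.HasDegree 2
  degree_F' : F'.HasDegree 2
  degree_Ω : Ω.HasDegree 3
  curvature : A.d = DForm.pullback bundle.proj F
  curvature' : A'.d = DForm.pullback bundle'.proj F'
  flux : H = DForm.wedge A (DForm.pullback bundle.proj F') + DForm.pullback bundle.proj Ω
  flux' : H' = DForm.wedge (DForm.pullback bundle'.proj F) A' + DForm.pullback bundle'.proj Ω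

namespace CircleBundle

variable {EX : Type*} [NormedAddCommGroup EX] [NormedSpace ℝ EX]
  {X : Type*} [TopologicalSpace X] [ChartedSpace EX X]
  {E : Type*} [NormedAddCommGroup E] [NormedSpace ℝ E]
  {Z : Type*} [TopologicalSpace Z] [ChartedSpace E Z] [MulAction Circle Z]
  (P : CircleBundle EX X E Z)

theorem proj_rot (t : ℝ) (z : Z) : P.proj (rot t z) = P.proj z := P.proj_smul _ _

theorem smooth_rot (P : CircleBundle EX X E Z) (t : ℝ) : ContMDiff 𝓘(ℝ, E) 𝓘(ℝ, E) ∞ (rot t : Z → Z) :=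
  P.smooth_smul.comp (contMDiff_const.prodMk contMDiff_id)

theorem mfderiv_proj_rot (t : ℝ) (z : Z) (u : TangentSpace 𝓘(ℝ, E) z) :
    (mfderiv 𝓘(ℝ, E) 𝓘(ℝ, EX) P.proj (rot t z) (mfderiv 𝓘(ℝ, E) 𝓘(ℝ, E) (rot t) z u) : EX) =
      mfderiv 𝓘(ℝ, E) 𝓘(ℝ, EX) P.proj z u := by
  have h : P.proj ∘ (rot t : Z → Z) = P.proj := funext (P.proj_rot t)
  have h1 := mfderiv_comp z ((P.smooth_proj _).mdifferentiableAt (by simp))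
    ((P.smooth_rot t z).mdifferentiableAt (by simp))
  have h2 : (mfderiv 𝓘(ℝ, E) 𝓘(ℝ, EX) (P.proj ∘ rot t) z u : EX) =
      mfderiv 𝓘(ℝ, E) 𝓘(ℝ, EX) P.proj z u := by rw [h]
  rw [← h2, h1]
  rfl

theorem mfderiv_proj_genField (z : Z) :
    (mfderiv 𝓘(ℝ, E) 𝓘(ℝ, EX) P.proj z (genField E z) : EX) = 0 := by
  have hs : MDifferentiableAt 𝓘(ℝ, ℝ) 𝓘(ℝ, E) (fun t : ℝ => rot t z) 0 := by
    refine ContMDiffAt.mdifferentiableAt (n := ∞) ?_ (by simp)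
    refine ContMDiff.contMDiffAt ?_
    refine P.smooth_smul.comp (ContMDiff.prodMk ?_ contMDiff_const)
    have h : ContMDiff 𝓘(ℝ, ℝ) 𝓘(ℝ, ℝ) ∞ (fun t : ℝ => 2 * Real.pi * t) :=
      (contDiff_const.mul contDiff_id).contMDiff
    exact contMDiff_circleExp.comp h
  have h0 : rot (0 : ℝ) z = z := by simp [rot]
  have h : P.proj ∘ (fun t : ℝ => rot t z) = fun _ => P.proj z := funext fun t => P.proj_rot t z
  have h1 := mfderiv_comp (0 : ℝ)
    ((P.smooth_proj (rot (0 : ℝ) z)).mdifferentiableAt (by simp)) hs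
  rw [h, mfderiv_const] at h1
  have h2 := congrArg (fun f => f (1 : ℝ)) h1
  have h3 : (mfderiv 𝓘(ℝ, E) 𝓘(ℝ, EX) P.proj (rot (0 : ℝ) z) (genField E z) : EX) = 0 := h2.symm
  rwa [h0] at h3

end CircleBundle

namespace TDualPair

variable {EX : Type*} [NormedAddCommGroup EX] [NormedSpace ℝ EX]
  {X : Type*} [TopologicalSpace X] [ChartedSpace EX X]
  {E : Type*} [NormedAddCommGroup E] [NormedSpace ℝ E]
  {Z : Type*} [TopologicalSpace Z] [ChartedSpace E Z] [MulAction Circle Z]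
  {E' : Type*} [NormedAddCommGroup E'] [NormedSpace ℝ E']
  {Z' : Type*} [TopologicalSpace Z'] [ChartedSpace E' Z'] [MulAction Circle Z']
  (P : TDualPair EX X E Z E' Z')

/-- The correspondence space `Z ×_X Z'`. -/
def Corr : Type _ := {c : Z × Z' // P.bundle.proj c.1 = P.bundle'.proj c.2}

/-- The tangent space of the correspondence space at `c`, as a subspace of the tangent space
of `Z × Z'`. -/
def tangent (c : P.Corr) :
    Submodule ℝ (TangentSpace 𝓘(ℝ, E) c.1.1 × TangentSpace 𝓘(ℝ, E') c.1.2) where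
  carrier := {u | (mfderiv 𝓘(ℝ, E) 𝓘(ℝ, EX) P.bundle.proj c.1.1 u.1 : EX) =
    mfderiv 𝓘(ℝ, E') 𝓘(ℝ, EX) P.bundle'.proj c.1.2 u.2}
  add_mem' := by
    intro a b ha hb
    have ha' : (mfderiv 𝓘(ℝ, E) 𝓘(ℝ, EX) P.bundle.proj c.1.1 a.1 : EX) =
      mfderiv 𝓘(ℝ, E') 𝓘(ℝ, EX) P.bundle'.proj c.1.2 a.2 := ha
    have hb' : (mfderiv 𝓘(ℝ, E) 𝓘(ℝ, EX) P.bundle.proj c.1.1 b.1 : EX) =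
      mfderiv 𝓘(ℝ, E') 𝓘(ℝ, EX) P.bundle'.proj c.1.2 b.2 := hb
    have h1 : (mfderiv 𝓘(ℝ, E) 𝓘(ℝ, EX) P.bundle.proj c.1.1 (a.1 + b.1) : EX) =
        mfderiv 𝓘(ℝ, E') 𝓘(ℝ, EX) P.bundle'.proj c.1.2 (a.2 + b.2) := by
      rw [map_add, map_add]
      exact congrArg₂ (fun x y : EX => x + y) ha' hb'
    exact h1
  zero_mem' := by
    have h1 : (mfderiv 𝓘(ℝ, E) 𝓘(ℝ, EX) P.bundle.proj c.1.1 0 : EX) =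
        mfderiv 𝓘(ℝ, E') 𝓘(ℝ, EX) P.bundle'.proj c.1.2 0 := by
      rw [map_zero, map_zero]; rfl
    exact h1
  smul_mem' := by
    intro r a ha
    have ha' : (mfderiv 𝓘(ℝ, E) 𝓘(ℝ, EX) P.bundle.proj c.1.1 a.1 : EX) =
      mfderiv 𝓘(ℝ, E') 𝓘(ℝ, EX) P.bundle'.proj c.1.2 a.2 := ha
    have h1 : (mfderiv 𝓘(ℝ, E) 𝓘(ℝ, EX) P.bundle.proj c.1.1 (r • a.1) : EX) =
        mfderiv 𝓘(ℝ, E') 𝓘(ℝ, EX) P.bundle'.proj c.1.2 (r • a.2) := by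
      rw [map_smul, map_smul]
      exact congrArg (fun x : EX => r • x) ha'
    exact h1

/-- Differential forms on the correspondence space, no regularity required.

They also encode the forms on `Z'` with coefficients in the pullback `L_n` of the `n`-th power of
the line bundle `ξ = Z ×_{U(1)} ℂ`: such a form `θ` is given by the complex valued form
`θ · ρ^{-n}`, with `ρ` the tautological section of the pullback of `ξ` (its tensorial form on the
principal bundle `Z ×_X Z' → Z'`). Forms on `Z'` act on these by wedging with their pullbacks. -/
abbrev CForm : Type _ := ∀ c : P.Corr, Alt (P.tangent c)

variable {P}

/-- The wedge product of forms on the correspondence space. -/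
def CForm.wedge (α β : P.CForm) : P.CForm := fun c => TDuality.wedge (α c) (β c)

/-- The exponential of a form on the correspondence space. -/
def CForm.exp (α : P.CForm) : P.CForm := fun c => wexp (α c)

variable (P)

/-- The pullback along the projection of the correspondence space to `Z`. -/
def pull (ψ : DForm E Z) : P.CForm := fun c =>
  altPullback ((ContinuousLinearMap.fst ℝ (TangentSpace 𝓘(ℝ, E) c.1.1)
    (TangentSpace 𝓘(ℝ, E') c.1.2)).comp (P.tangent c).subtypeL) (ψ c.1.1)

/-- The pullback along the projection of the correspondence space to `Z'`. -/
def pull' (ψ : DForm E' Z') : P.CForm := fun c =>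
  altPullback ((ContinuousLinearMap.snd ℝ (TangentSpace 𝓘(ℝ, E) c.1.1)
    (TangentSpace 𝓘(ℝ, E') c.1.2)).comp (P.tangent c).subtypeL) (ψ c.1.2)

/-- The circle action on the first factor of the correspondence space. -/
def rotC (t : ℝ) (c : P.Corr) : P.Corr :=
  ⟨(rot t c.1.1, c.1.2), (P.bundle.proj_rot t c.1.1).trans c.2⟩

/-- The circle action on the second factor of the correspondence space. -/
def rotC' (t : ℝ) (c : P.Corr) : P.Corr :=
  ⟨(c.1.1, rot t c.1.2), c.2.trans (P.bundle'.proj_rot t c.1.2).symm⟩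

/-- The differential of `rotC t`. -/
def rotTangent (t : ℝ) (c : P.Corr) (u : P.tangent c) : P.tangent (P.rotC t c) :=
  ⟨(mfderiv 𝓘(ℝ, E) 𝓘(ℝ, E) (rot t) c.1.1 u.1.1, u.1.2),
    (P.bundle.mfderiv_proj_rot t c.1.1 u.1.1).trans u.2⟩

/-- The differential of `rotC' t`. -/
def rotTangent' (t : ℝ) (c : P.Corr) (u : P.tangent c) : P.tangent (P.rotC' t c) :=
  ⟨(u.1.1, mfderiv 𝓘(ℝ, E') 𝓘(ℝ, E') (rot t) c.1.2 u.1.2),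
    Eq.trans u.2 (P.bundle'.mfderiv_proj_rot t c.1.2 u.1.2).symm⟩

/-- The generator of the circle action on the first factor. -/
def vert (c : P.Corr) : P.tangent c :=
  ⟨(genField E c.1.1, 0),
    (P.bundle.mfderiv_proj_genField c.1.1).trans
      (map_zero (mfderiv 𝓘(ℝ, E') 𝓘(ℝ, EX) P.bundle'.proj c.1.2)).symm⟩

/-- The generator of the circle action on the second factor. -/
def vert' (c : P.Corr) : P.tangent c :=
  ⟨(0, genField E' c.1.2),
    Eq.trans (map_zero (mfderiv 𝓘(ℝ, E) 𝓘(ℝ, EX) P.bundle.proj c.1.1))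
      (P.bundle'.mfderiv_proj_genField c.1.2).symm⟩

/-- The twisted integration `∫^{T,n}` along the fibres of `Z ×_X Z' → Z'`, with values in forms
with coefficients in `L_n`, encoded as explained at `CForm`. In a local trivialization of `Z`
with fibre coordinate `s ∈ ℝ/ℤ` and local frame `f` of `ξ`, so that `ρ = e^{2πis} f`, this is
`(∫ β e^{2πins}) ⊗ f^n`. The fibre direction is put in the first slot, so that
`∫^T A ∧ β = β` for invariant horizontal `β`. -/
def fibInt (n : ℤ) (β : P.CForm) : P.CForm := fun c k =>
  altOfFun fun u : Fin k → P.tangent c => ∫ t in (0 : ℝ)..1,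
    Complex.exp (2 * Real.pi * Complex.I * n * t) *
      β (P.rotC t c) (k + 1) (Matrix.vecCons (P.vert (P.rotC t c)) fun i => P.rotTangent t c (u i))

open Classical in
/-- The integration along the fibres of `Z ×_X Z' → Z`: the form on `Z` whose pullback to the
correspondence space is the average over the fibre circle of the contraction of `β` with the
fibre direction (`0` if there is no such form). -/
def fibInt' (β : P.CForm) : DForm E Z :=
  if h : ∃ γ : DForm E Z, ∀ c k, P.pull γ c k =
      altOfFun fun u : Fin k → P.tangent c => ∫ t in (0 : ℝ)..1,
        β (P.rotC' t c) (k + 1)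
          (Matrix.vecCons (P.vert' (P.rotC' t c)) fun i => P.rotTangent' t c (u i))
  then h.choose else 0

/-- The exotic Hori formula `τ_n(ψ) = ∫^{T,n} ψ ∧ e^{-A ∧ A'}`. -/
def tau (n : ℤ) (ψ : DForm E Z) : P.CForm :=
  P.fibInt n ((P.pull ψ).wedge (CForm.exp (-((P.pull P.A).wedge (P.pull' P.A')))))

/-- The inverse exotic Hori formula `θ ↦ ∫^{T'} θ · ρ^{-n} ∧ e^{A ∧ A'}`, for a form `θ` on `Z'`
with coefficients in `L_n`. The argument is `θ · ρ^{-n}`, so that `n` does not appear. -/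
def sigmaHat (θ : P.CForm) : DForm E Z :=
  P.fibInt' (θ.wedge (CForm.exp ((P.pull P.A).wedge (P.pull' P.A'))))

/-- The form `A' ∧ (dA' - 2πin)⁻¹` on `Z'`. -/
def etaHat (n : ℤ) : DForm E' Z' := fun z =>
  wedge (P.A' z) (invSub (P.A'.d z) (2 * Real.pi * Complex.I * n))

/-- The homotopy `ψ ↦ σ'_n(η'_n ∧ τ_n(ψ))`. -/
def homotopy (n : ℤ) (ψ : DForm E Z) : DForm E Z :=
  P.sigmaHat ((P.pull' (P.etaHat n)).wedge (P.tau n ψ))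

end TDualPair

end TDuality

end

/-! Write D = d + H∧, let v generate the circle action and ι be contraction with v. Cartan's formula
and the oddness of H give Dι + ιD = L_v + Φ∧ with Φ = ι_v H (`twisted_cartan`). On forms of weight
-n the Lie derivative is the scalar -2πin, so the right side is multiplication by Φ - 2πin. The form
Φ is closed (H is closed and invariant), even and without degree zero part, hence nilpotent. For n ≠
0 a finite geometric sum therefore inverts Φ - 2πin, and this inverse commutes with D. So h = (Φ -
2πin)⁻¹ι satisfies Dh + hD = 1 (`weight_homotopy`), which gives acyclicity.

The composite of the Hori transforms is this same h (`homotopy_eq`). A fibre integral of a form of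
matching weight is just a contraction (`fibInt_eq_contr`, `fibInt'_eq`). T-duality gives ι_v H =
π^*F', which on the correspondence space agrees with dA' (`pull_iota_H`). The factor A' in η then
kills every further term containing A' that the exponentials produce (`wedge_hori`).

For the cohomology of all forms no Fourier series is used. The averages ∫₀¹ f(t) φ_t^*ψ dt along the
flow φ_t commute with D, and integration by parts trades L_v for a boundary term and the average
against f'. The weights f = B_{j+1}/(j+1)!, with B_j the Bernoulli polynomials, are successive
primitives of 1 with equal end values unless j = 0. For D-closed ψ they show inductively that ψ
minus its average is exact up to a multiple of Φ^{j+1} (`exists_twistedD_eq`), and nilpotence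
removes the error.

Everything holds for an arbitrary closed invariant three-form (`InvariantFlux`). For H' closedness
has to be proved, from dF = 0 and F∧F' + dΩ = 0 (`wedge_F_add_d_Ω`).

The supporting calculus rests on two devices. Identities of forms are proved by induction on the
degree, contracting with a vector (`contr_wedge`, `succ_eq_of_contr`). Cartan's formula is obtained
by pulling forms back to time × chart, where v becomes the constant field ∂_t
(`dirD_paramPull_flow`). -/

noncomputable section

namespace TDuality

set_option linter.unusedSectionVars false

/-! ### Insertion into sequences and the splitting of permutation sums -/

section Sequences

variable {T : Type*}

/-- Extension of a finite sequence by zero. -/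
def seqExt {k : ℕ} [Zero T] (u : Fin k → T) (j : ℕ) : T := if h : j < k then u ⟨j, h⟩ else 0

/-- Insertion of a vector in a sequence. -/
def seqIns (i : ℕ) (v : T) (w : ℕ → T) (j : ℕ) : T :=
  if j < i then w j else if j = i then v else w (j - 1)

theorem seqExt_insertNth [Zero T] {k : ℕ} (i : Fin (k + 1)) (v : T) (x : Fin k → T) :
    seqExt (i.insertNth v x) = seqIns i v (seqExt x) := by
  funext j
  unfold seqIns seqExt
  by_cases hj : j < k + 1
  · rw [dif_pos hj]
    rcases lt_trichotomy j (i : ℕ) with h | h | h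
    · have : (⟨j, hj⟩ : Fin (k + 1)) = i.succAbove ⟨j, by omega⟩ := by
        rw [Fin.succAbove_of_castSucc_lt _ _ (by simpa [Fin.lt_def] using h)]; rfl
      rw [this, Fin.insertNth_apply_succAbove, if_pos h, dif_pos]
    · have : (⟨j, hj⟩ : Fin (k + 1)) = i := Fin.ext h
      rw [this, Fin.insertNth_apply_same, if_neg (by omega), if_pos h]
    · have : (⟨j, hj⟩ : Fin (k + 1)) = i.succAbove ⟨j - 1, by omega⟩ := by
        rw [Fin.succAbove_of_le_castSucc _ _ (by simp [Fin.le_def]; omega)]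
        ext; simp; omega
      rw [this, Fin.insertNth_apply_succAbove, if_neg (by omega), if_neg (by omega), dif_pos]
  · rw [dif_neg hj, if_neg (by omega), if_neg (by omega), dif_neg (by omega)]

theorem seqIns_insertNth (m i : ℕ) (hi : i < m + 1) (v : T) (w : ℕ → T) :
    (fun j : Fin (m + 1) => seqIns i v w j) =
      Fin.insertNth (α := fun _ => T) ⟨i, hi⟩ v (fun j : Fin m => w j) := by
  funext j
  obtain h | ⟨l, h⟩ := Fin.eq_self_or_eq_succAbove (⟨i, hi⟩ : Fin (m + 1)) j
  · subst h; simp [seqIns]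
  · subst h
    rw [Fin.insertNth_apply_succAbove]
    by_cases hl : (l : ℕ) < i
    · rw [Fin.succAbove_of_castSucc_lt _ _ (by simpa [Fin.lt_def] using hl)]
      simp [seqIns, hl]
    · rw [Fin.succAbove_of_le_castSucc _ _ (by simp [Fin.le_def]; omega)]
      simp [seqIns, show ¬ ((l : ℕ) + 1 < i) by omega, show ¬ ((l : ℕ) + 1 = i) by omega]

/-- A permutation of k + 1 letters is determined by the slot i that receives the first letter and a
permutation τ of the others. It is τ, extended by fixing 0, composed with the cycle of the first i +
1 slots, and that cycle has sign (-1)^i. -/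
theorem sum_perm_cons {k : ℕ} (v : T) (u : Fin k → T) (f : (Fin (k + 1) → T) → ℂ) :
    ∑ σ : Equiv.Perm (Fin (k + 1)), ((Equiv.Perm.sign σ : ℤ) : ℂ) * f (Matrix.vecCons v u ∘ σ) =
      ∑ τ : Equiv.Perm (Fin k), ((Equiv.Perm.sign τ : ℤ) : ℂ) *
        ∑ i : Fin (k + 1), (-1 : ℂ) ^ (i : ℕ) * f (i.insertNth v (u ∘ τ)) := by
  have hb : Function.Bijective (fun q : Equiv.Perm (Fin k) × Fin (k + 1) =>
      Equiv.Perm.decomposeFin.symm (0, q.1) * q.2.cycleRange) := by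
    rw [Fintype.bijective_iff_injective_and_card]
    constructor
    · rintro ⟨τ, i⟩ ⟨τ', i'⟩ h
      simp only at h
      have hi : i = i' := by
        have h1 := Equiv.congr_fun h i
        rw [Equiv.Perm.mul_apply, Equiv.Perm.mul_apply, Fin.cycleRange_self] at h1
        have h2 : Equiv.Perm.decomposeFin.symm ((0 : Fin (k + 1)), τ) 0 =
            Equiv.Perm.decomposeFin.symm ((0 : Fin (k + 1)), τ') 0 := by simp
        rw [h2] at h1
        have h3 := (Equiv.injective _ h1)
        rw [← Fin.cycleRange_self i'] at h3
        exact ((Equiv.injective _ h3)).symm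
      subst hi
      have h4 := mul_right_cancel h
      have h5 := Equiv.Perm.decomposeFin.symm.injective h4
      simpa using h5
    · simp [Fintype.card_perm, Nat.factorial_succ, mul_comm]
  rw [← Equiv.sum_comp (Equiv.ofBijective _ hb)]
  rw [Fintype.sum_prod_type]
  refine Finset.sum_congr rfl fun τ _ => ?_
  rw [Finset.mul_sum]
  refine Finset.sum_congr rfl fun i _ => ?_
  simp only [Equiv.ofBijective_apply, Equiv.Perm.sign_mul, Equiv.Perm.decomposeFin.symm_sign,
    Fin.sign_cycleRange, if_true, one_mul]
  have : Matrix.vecCons v u ∘ (Equiv.Perm.decomposeFin.symm (0, τ) * i.cycleRange) =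
      i.insertNth v (u ∘ τ) := by
    rw [← Fin.cons_comp_cycleRange, Equiv.Perm.coe_mul, ← Function.comp_assoc]
    congr 1
    funext j
    refine Fin.cases ?_ (fun l => ?_) j <;> simp
  rw [this]
  push_cast
  ring

end Sequences

/-! ### The exterior algebra, governed by contraction -/

section AltAlgebra

variable {V W : Type*}
  [AddCommGroup V] [Module ℝ V] [TopologicalSpace V]
  [AddCommGroup W] [Module ℝ W] [TopologicalSpace W]

/-- Contraction of an exterior form with a vector, in the first slot. -/
def contr (v : V) (a : Alt V) : Alt V := fun k =>
  { ((a (k + 1)).toAlternatingMap.curryLeft v) with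
    cont := (a (k + 1)).coe_continuous.comp
      (Continuous.matrixVecCons continuous_const continuous_id) }

theorem contr_apply (v : V) (a : Alt V) (k : ℕ) (u : Fin k → V) :
    contr v a k u = a (k + 1) (Matrix.vecCons v u) := rfl

/-- The grading involution. -/
def sgn (a : Alt V) : Alt V := fun k => (-1 : ℂ) ^ k • a k

theorem sgn_apply (a : Alt V) (k : ℕ) : sgn a k = (-1 : ℂ) ^ k • a k := rfl

/-- This is the inductive step for identities in the exterior algebra: together with the
antiderivation rule it reduces degree k + 1 to degree k without manipulating shuffles. -/
theorem succ_eq_of_contr {a b : Alt V} {k : ℕ} (h : ∀ v, contr v a k = contr v b k) :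
    a (k + 1) = b (k + 1) := by
  ext u
  have := congrArg (fun f => f (Matrix.vecTail u)) (h (u 0))
  simp only [contr_apply] at this
  have h2 : Matrix.vecCons (u 0) (Matrix.vecTail u) = u := by
    ext i; refine Fin.cases ?_ (fun j => ?_) i <;> simp [Matrix.vecTail]
  rwa [h2] at this

theorem neg_one_smul_alt (a : Alt V) : (-1 : ℂ) • a = -a := neg_one_smul ℂ a
theorem zero_smul_alt (a : Alt V) : (0 : ℂ) • a = 0 := zero_smul ℂ a
theorem smul_zero_alt (c : ℂ) : c • (0 : Alt V) = 0 := by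
  funext k; ext u; exact mul_zero c
theorem smul_zero_form (c : ℂ) {k : ℕ} : c • (0 : V [⋀^Fin k]→L[ℝ] ℂ) = 0 := by
  ext u; exact mul_zero c

theorem contr_add (v : V) (a b : Alt V) : contr v (a + b) = contr v a + contr v b := rfl
theorem contr_neg (v : V) (a : Alt V) : contr v (-a) = -contr v a := rfl
theorem contr_smul (v : V) (c : ℂ) (a : Alt V) : contr v (c • a) = c • contr v a := rfl

theorem contr_vec_zero (a : Alt V) : contr (0 : V) a = 0 := by
  funext k
  ext u
  rw [contr_apply]
  exact (a (k + 1)).map_coord_zero 0 rfl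

theorem sgn_sgn (a : Alt V) : sgn (sgn a) = a := by
  funext k; simp [sgn_apply, smul_smul, ← mul_pow]

theorem sgn_contr (v : V) (a : Alt V) : sgn (contr v a) = -contr v (sgn a) := by
  funext k
  ext u
  simp [sgn_apply, contr_apply, pow_succ]

/-! #### The wedge product in terms of shuffles of sequences -/

/-- The product of `a m` and `b n`, evaluated on consecutive blocks of a sequence. -/
def blockMul (a b : Alt V) (m n : ℕ) (w : ℕ → V) : ℂ :=
  a m (fun i => w i) * b n (fun j => w (m + j))

theorem apply_insertNth {m : ℕ} (a : Alt V) (p : Fin (m + 1)) (v : V) (x : Fin m → V) :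
    a (m + 1) (p.insertNth v x) = (-1 : ℂ) ^ (p : ℕ) * contr v a m x := by
  have := (a (m + 1)).toAlternatingMap.map_insertNth p v x
  simpa [contr_apply] using this

theorem blockMul_ins_lt (a b : Alt V) {m n i : ℕ} (hi : i < m + 1) (v : V) (w : ℕ → V) :
    (-1 : ℂ) ^ i * blockMul a b (m + 1) n (seqIns i v w) = blockMul (contr v a) b m n w := by
  unfold blockMul
  rw [seqIns_insertNth m i hi, apply_insertNth]
  have : (fun j : Fin n => seqIns i v w (m + 1 + j)) = fun j : Fin n => w (m + j) := by
    funext j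
    simp only [seqIns]
    rw [if_neg (by omega), if_neg (by omega)]
    congr 1; omega
  rw [this, ← mul_assoc, ← mul_assoc, ← mul_pow]
  simp

theorem blockMul_ins_ge (a b : Alt V) {m n i : ℕ} (hi : i < n + 1) (v : V) (w : ℕ → V) :
    (-1 : ℂ) ^ (m + i) * blockMul a b m (n + 1) (seqIns (m + i) v w) =
      blockMul (sgn a) (contr v b) m n w := by
  unfold blockMul
  have h1 : (fun j : Fin (n + 1) => seqIns (m + i) v w (m + j)) =
      fun j : Fin (n + 1) => seqIns i v (fun l => w (m + l)) j := by
    funext j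
    simp only [seqIns, add_lt_add_iff_left, add_right_inj]
    split_ifs with h h' <;> try rfl
    congr 1; omega
  have h2 : (fun j : Fin m => seqIns (m + i) v w j) = fun j : Fin m => w j := by
    funext j
    simp only [seqIns]
    rw [if_pos (by omega)]
  rw [h1, h2, seqIns_insertNth n i hi, apply_insertNth]
  simp only [sgn_apply, ContinuousAlternatingMap.smul_apply, smul_eq_mul, pow_add]
  have : (-1 : ℂ) ^ i * (-1 : ℂ) ^ i = 1 := by rw [← mul_pow]; simp
  linear_combination (-1 : ℂ) ^ m * (a m fun j => w j) *
    (contr v b n fun j => w (m + j)) * this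

/-- Inside one block the sign of the insertion cancels against the alternation, so all m slots of
the first block contribute equally, as do all n slots of the second. Passing the first block costs
(-1)^m, which is the source of `sgn a`. -/
theorem sum_blockMul_ins (a b : Alt V) {m n k : ℕ} (h : m + n = k + 1) (v : V) (x : Fin k → V) :
    ∑ i : Fin (k + 1), (-1 : ℂ) ^ (i : ℕ) * blockMul a b m n (seqExt (i.insertNth v x)) =
      m * blockMul (contr v a) b (m - 1) n (seqExt x) +
        n * blockMul (sgn a) (contr v b) m (n - 1) (seqExt x) := by
  simp only [seqExt_insertNth]
  rw [Fin.sum_univ_eq_sum_range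
    (fun i => (-1 : ℂ) ^ i * blockMul a b m n (seqIns i v (seqExt x))) (k + 1), ← h,
    Finset.sum_range_add]
  congr 1
  · rcases m with _ | m
    · simp
    · rw [Finset.sum_congr rfl fun i hi => blockMul_ins_lt a b (Finset.mem_range.1 hi) v _]
      simp
  · rcases n with _ | n
    · simp
    · rw [Finset.sum_congr rfl fun i hi => blockMul_ins_ge a b (Finset.mem_range.1 hi) v _]
      simp

theorem wedge_apply (a b : Alt V) (k : ℕ) (u : Fin k → V) :
    wedge a b k u = ∑ p ∈ Finset.HasAntidiagonal.antidiagonal k,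
      ((p.1.factorial : ℂ) * (p.2.factorial : ℂ))⁻¹ *
        ∑ σ : Equiv.Perm (Fin k), ((Equiv.Perm.sign σ : ℤ) : ℂ) *
          blockMul a b p.1 p.2 (seqExt (u ∘ σ)) := by
  rw [Finset.Nat.sum_antidiagonal_eq_sum_range_succ (fun m n =>
    ((m.factorial : ℂ) * (n.factorial : ℂ))⁻¹ *
        ∑ σ : Equiv.Perm (Fin k), ((Equiv.Perm.sign σ : ℤ) : ℂ) *
          blockMul a b m n (seqExt (u ∘ σ))), ← Fin.sum_univ_eq_sum_range
            (fun m => ((m.factorial : ℂ) * ((k - m).factorial : ℂ))⁻¹ *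
        ∑ σ : Equiv.Perm (Fin k), ((Equiv.Perm.sign σ : ℤ) : ℂ) *
          blockMul a b m (k - m) (seqExt (u ∘ σ)))]
  unfold wedge
  rw [ContinuousAlternatingMap.sum_apply]
  refine Finset.sum_congr rfl fun p _ => ?_
  rw [ContinuousAlternatingMap.smul_apply,
    ContinuousMultilinearMap.alternatization_apply_apply, smul_eq_mul]
  congr 1
  refine Finset.sum_congr rfl fun σ _ => ?_
  rw [Units.smul_def, zsmul_eq_mul]
  congr 1
  change a p _ * b (k - p) _ = _
  unfold blockMul
  congr 2
  · funext i
    simp only [seqExt, Function.comp]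
    rw [dif_pos (show (i : ℕ) < k by omega)]
  · funext i
    simp only [seqExt, Function.comp]
    rw [dif_pos (show (p : ℕ) + i < k by omega)]

/-- Contraction is an antiderivation of the wedge product. -/
theorem contr_wedge (v : V) (a b : Alt V) :
    contr v (wedge a b) = wedge (contr v a) b + wedge (sgn a) (contr v b) := by
  funext k
  ext u
  rw [contr_apply, wedge_apply]
  simp only [Pi.add_apply, ContinuousAlternatingMap.add_apply, wedge_apply]
  have h1 : ∀ p ∈ Finset.HasAntidiagonal.antidiagonal (k + 1),
      ((p.1.factorial : ℂ) * (p.2.factorial : ℂ))⁻¹ *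
        ∑ σ : Equiv.Perm (Fin (k + 1)), ((Equiv.Perm.sign σ : ℤ) : ℂ) *
          blockMul a b p.1 p.2 (seqExt (Matrix.vecCons v u ∘ σ)) =
      ((p.1.factorial : ℂ) * (p.2.factorial : ℂ))⁻¹ * p.1 *
        ∑ τ : Equiv.Perm (Fin k), ((Equiv.Perm.sign τ : ℤ) : ℂ) *
          blockMul (contr v a) b (p.1 - 1) p.2 (seqExt (u ∘ τ)) +
      ((p.1.factorial : ℂ) * (p.2.factorial : ℂ))⁻¹ * p.2 *
        ∑ τ : Equiv.Perm (Fin k), ((Equiv.Perm.sign τ : ℤ) : ℂ) *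
          blockMul (sgn a) (contr v b) p.1 (p.2 - 1) (seqExt (u ∘ τ)) := by
    intro p hp
    rw [Finset.HasAntidiagonal.mem_antidiagonal] at hp
    rw [sum_perm_cons v u (fun w => blockMul a b p.1 p.2 (seqExt w))]
    simp only [sum_blockMul_ins a b hp, mul_add, Finset.sum_add_distrib, Finset.mul_sum]
    congr 1 <;> refine Finset.sum_congr rfl fun τ _ => by ring
  rw [Finset.sum_congr rfl h1, Finset.sum_add_distrib]
  congr 1
  -- The summand with p = 0 carries the factor p and vanishes; in the others p/p! = 1/(p-1)!
  -- restores the normalization of the wedge product one degree lower.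
  · rw [Finset.Nat.sum_antidiagonal_succ]
    simp only [Nat.cast_zero, mul_zero, zero_mul, zero_add, Nat.add_sub_cancel]
    refine Finset.sum_congr rfl fun p _ => ?_
    congr 1
    have : (p.1.factorial : ℂ) ≠ 0 := by exact_mod_cast p.1.factorial_ne_zero
    have : (p.2.factorial : ℂ) ≠ 0 := by exact_mod_cast p.2.factorial_ne_zero
    have : (p.1 : ℂ) + 1 ≠ 0 := by exact_mod_cast p.1.succ_ne_zero
    rw [Nat.factorial_succ]
    push_cast
    field_simp
  · rw [Finset.Nat.sum_antidiagonal_succ']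
    simp only [Nat.cast_zero, mul_zero, zero_mul, zero_add, Nat.add_sub_cancel]
    refine Finset.sum_congr rfl fun p _ => ?_
    congr 1
    have : (p.1.factorial : ℂ) ≠ 0 := by exact_mod_cast p.1.factorial_ne_zero
    have : (p.2.factorial : ℂ) ≠ 0 := by exact_mod_cast p.2.factorial_ne_zero
    have : (p.2 : ℂ) + 1 ≠ 0 := by exact_mod_cast p.2.succ_ne_zero
    rw [Nat.factorial_succ]
    push_cast
    field_simp

theorem wedge_zero_apply (a b : Alt V) (u : Fin 0 → V) :
    wedge a b 0 u = a 0 u * b 0 u := by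
  rw [wedge_apply]
  simp [blockMul]
  congr 2 <;> exact Subsingleton.elim _ _

theorem add_wedge (a b c : Alt V) : wedge (a + b) c = wedge a c + wedge b c := by
  funext k; ext u
  simp only [wedge_apply, blockMul, Pi.add_apply, ContinuousAlternatingMap.add_apply, add_mul,
    mul_add, Finset.sum_add_distrib]

theorem wedge_add (a b c : Alt V) : wedge a (b + c) = wedge a b + wedge a c := by
  funext k; ext u
  simp only [wedge_apply, blockMul, Pi.add_apply, ContinuousAlternatingMap.add_apply,
    mul_add, Finset.sum_add_distrib]

theorem smul_wedge (c : ℂ) (a b : Alt V) : wedge (c • a) b = c • wedge a b := by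
  funext k; ext u
  simp only [wedge_apply, blockMul, Pi.smul_apply, ContinuousAlternatingMap.smul_apply,
    smul_eq_mul, Finset.mul_sum]
  refine Finset.sum_congr rfl fun p _ => Finset.sum_congr rfl fun σ _ => by ring

theorem wedge_smul (c : ℂ) (a b : Alt V) : wedge a (c • b) = c • wedge a b := by
  funext k; ext u
  simp only [wedge_apply, blockMul, Pi.smul_apply, ContinuousAlternatingMap.smul_apply,
    smul_eq_mul, Finset.mul_sum]
  refine Finset.sum_congr rfl fun p _ => Finset.sum_congr rfl fun σ _ => by ring

theorem neg_wedge (a b : Alt V) : wedge (-a) b = -wedge a b := by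
  rw [← neg_one_smul_alt a, smul_wedge, neg_one_smul_alt]

theorem wedge_neg (a b : Alt V) : wedge a (-b) = -wedge a b := by
  rw [← neg_one_smul_alt b, wedge_smul, neg_one_smul_alt]

theorem zero_wedge (b : Alt V) : wedge (0 : Alt V) b = 0 := by
  have := smul_wedge 0 (0 : Alt V) b
  rwa [zero_smul_alt, zero_smul_alt] at this

theorem wedge_zero (a : Alt V) : wedge a (0 : Alt V) = 0 := by
  have := wedge_smul 0 a (0 : Alt V)
  rwa [zero_smul_alt, zero_smul_alt] at this

theorem wedge_sub (a b c : Alt V) : wedge a (b - c) = wedge a b - wedge a c := by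
  rw [sub_eq_add_neg, wedge_add, wedge_neg, sub_eq_add_neg]

theorem sub_wedge (a b c : Alt V) : wedge (a - b) c = wedge a c - wedge b c := by
  rw [sub_eq_add_neg, add_wedge, neg_wedge, sub_eq_add_neg]

theorem wedge_sum {ι : Type*} (s : Finset ι) (a : Alt V) (f : ι → Alt V) :
    wedge a (∑ i ∈ s, f i) = ∑ i ∈ s, wedge a (f i) :=
  map_sum (AddMonoidHom.mk' (wedge a) (wedge_add a)) f s

theorem sgn_wedge (a b : Alt V) : sgn (wedge a b) = wedge (sgn a) (sgn b) := by
  funext k; ext u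
  simp only [sgn_apply, ContinuousAlternatingMap.smul_apply, wedge_apply, blockMul, smul_eq_mul,
    Finset.mul_sum]
  refine Finset.sum_congr rfl fun p hp => Finset.sum_congr rfl fun σ _ => ?_
  have hk : (-1 : ℂ) ^ k = (-1) ^ p.1 * (-1) ^ p.2 := by
    rw [← pow_add, Finset.HasAntidiagonal.mem_antidiagonal.1 hp]
  rw [hk]
  ring

/-- Contracting either side gives the same three terms, one for each contracted factor, because the
grading involution is multiplicative. -/
theorem wedge_assoc (a b c : Alt V) : wedge (wedge a b) c = wedge a (wedge b c) := by
  have h0 : ∀ a b c : Alt V, wedge (wedge a b) c 0 = wedge a (wedge b c) 0 := by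
    intro a b c; ext u; simp only [wedge_zero_apply]; ring
  funext k
  induction k generalizing a b c with
  | zero => exact h0 a b c
  | succ k ih =>
    refine succ_eq_of_contr fun v => ?_
    simp only [contr_wedge, add_wedge, wedge_add, sgn_wedge, Pi.add_apply, ih, add_assoc]

/-- Contraction exchanges even and odd forms, so the two parities have to share a single induction
on the degree. -/
theorem wedge_comm_aux (a b : Alt V) (k : ℕ) :
    (sgn a = a → wedge a b k = wedge b a k) ∧
      (sgn a = -a → wedge a b k = wedge (sgn b) a k) := by
  induction k generalizing a b with
  | zero =>
    constructor
    · intro _; ext u; simp only [wedge_zero_apply, mul_comm]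
    · intro _; ext u; simp [wedge_zero_apply, mul_comm, sgn_apply]
  | succ k ih =>
    constructor
    · intro h
      refine succ_eq_of_contr fun v => ?_
      have h1 : sgn (contr v a) = -contr v a := by rw [sgn_contr, h]
      simp only [contr_wedge, Pi.add_apply, (ih _ _).2 h1, h, (ih _ _).1 h]
      exact add_comm _ _
    · intro h
      refine succ_eq_of_contr fun v => ?_
      have h1 : sgn (contr v a) = contr v a := by rw [sgn_contr, h, contr_neg, neg_neg]
      have h2 : contr v (sgn b) = -sgn (contr v b) := by rw [sgn_contr, neg_neg]
      simp only [contr_wedge, Pi.add_apply, (ih _ _).1 h1, h, sgn_sgn, neg_wedge, h2,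
        Pi.neg_apply, (ih _ _).2 h]
      exact add_comm _ _

theorem wedge_comm_of_even {a : Alt V} (h : sgn a = a) (b : Alt V) : wedge a b = wedge b a :=
  funext fun k => (wedge_comm_aux a b k).1 h

theorem wedge_comm_of_odd {a : Alt V} (h : sgn a = -a) (b : Alt V) :
    wedge a b = wedge (sgn b) a :=
  funext fun k => (wedge_comm_aux a b k).2 h

theorem wedge_self_of_odd {a : Alt V} (h : sgn a = -a) : wedge a a = 0 := by
  have h1 : wedge a a = -wedge a a := by
    rw [← neg_wedge, ← h]; exact wedge_comm_of_odd h a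
  funext k; ext u
  have h2 := congrArg (fun f => f k u) h1
  exact self_eq_neg.1 h2

theorem contr_unit (v : V) : contr v (unit : Alt V) = 0 := rfl

theorem sgn_unit : sgn (unit : Alt V) = unit := by
  funext k
  cases k with
  | zero => simp [sgn_apply]
  | succ k =>
    exact smul_zero_form _

theorem unit_wedge (a : Alt V) : wedge unit a = a := by
  funext k
  induction k generalizing a with
  | zero =>
    ext u
    rw [wedge_zero_apply]
    change 1 * _ = _
    rw [one_mul]
  | succ k ih =>
    refine succ_eq_of_contr fun v => ?_
    rw [contr_wedge, contr_unit, zero_wedge, zero_add, sgn_unit, ih]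

theorem wedge_unit (a : Alt V) : wedge a unit = a := by
  rw [← wedge_comm_of_even sgn_unit, unit_wedge]

/-! #### Pullbacks -/

theorem altPullback_apply (f : W →L[ℝ] V) (a : Alt V) (k : ℕ) (u : Fin k → W) :
    altPullback f a k u = a k (fun i => f (u i)) := rfl

theorem altPullback_add (f : W →L[ℝ] V) (a b : Alt V) :
    altPullback f (a + b) = altPullback f a + altPullback f b := rfl
theorem altPullback_neg (f : W →L[ℝ] V) (a : Alt V) :
    altPullback f (-a) = -altPullback f a := rfl
theorem altPullback_smul (f : W →L[ℝ] V) (c : ℂ) (a : Alt V) :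
    altPullback f (c • a) = c • altPullback f a := rfl
theorem altPullback_zero (f : W →L[ℝ] V) : altPullback f (0 : Alt V) = 0 := rfl

theorem altPullback_comp {U : Type*} [AddCommGroup U] [Module ℝ U] [TopologicalSpace U]
    (f : W →L[ℝ] V) (g : U →L[ℝ] W) (a : Alt V) :
    altPullback g (altPullback f a) = altPullback (f.comp g) a := rfl

theorem altPullback_id (a : Alt V) : altPullback (ContinuousLinearMap.id ℝ V) a = a := rfl

theorem contr_altPullback (f : W →L[ℝ] V) (w : W) (a : Alt V) :
    contr w (altPullback f a) = altPullback f (contr (f w) a) := by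
  funext k; ext u
  simp only [contr_apply, altPullback_apply]
  congr 1
  funext i
  refine Fin.cases ?_ (fun j => ?_) i <;> simp

theorem sgn_altPullback (f : W →L[ℝ] V) (a : Alt V) :
    sgn (altPullback f a) = altPullback f (sgn a) := rfl

theorem altPullback_unit (f : W →L[ℝ] V) : altPullback f (unit : Alt V) = unit := by
  funext k; cases k <;> rfl

theorem altPullback_wedge (f : W →L[ℝ] V) (a b : Alt V) :
    altPullback f (wedge a b) = wedge (altPullback f a) (altPullback f b) := by
  funext k
  induction k generalizing a b with
  | zero => ext u; simp only [altPullback_apply, wedge_zero_apply]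
  | succ k ih =>
    refine succ_eq_of_contr fun w => ?_
    simp only [contr_wedge, contr_altPullback, altPullback_add, Pi.add_apply, ih, sgn_altPullback]

theorem altPullback_injective {f : W →L[ℝ] V} (hf : Function.Surjective f) :
    Function.Injective (altPullback f : Alt V → Alt W) := by
  intro a b h
  funext k; ext u
  choose g hg using hf
  have := congrArg (fun c => c k (fun i => g (u i))) h
  simpa [altPullback_apply, hg] using this

theorem altPullback_wpow (f : W →L[ℝ] V) (a : Alt V) (j : ℕ) :
    altPullback f (wpow a j) = wpow (altPullback f a) j := by
  induction j with
  | zero => exact altPullback_unit f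
  | succ j ih => simp only [wpow, altPullback_wedge, ih]

theorem altPullback_wexp (f : W →L[ℝ] V) (a : Alt V) :
    altPullback f (wexp a) = wexp (altPullback f a) := by
  funext k; ext u
  simp [wexp, altPullback_apply, ContinuousAlternatingMap.sum_apply, ← altPullback_wpow]

theorem altPullback_invSub (f : W →L[ℝ] V) (a : Alt V) (c : ℂ) :
    altPullback f (invSub a c) = invSub (altPullback f a) c := by
  funext k; ext u
  simp [invSub, altPullback_apply, ContinuousAlternatingMap.sum_apply, ← altPullback_wpow]

/-! #### Exponentials and inverses -/

theorem wexp_of_wedge_self {a : Alt V} (h0 : a 0 = 0) (h : wedge a a = 0) :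
    wexp a = unit + a := by
  have hp : ∀ j, wpow a (j + 2) = 0 := by
    intro j
    induction j with
    | zero => simp only [wpow, wedge_unit, h]
    | succ j ih => rw [wpow, ih, wedge_zero]
  funext k
  cases k with
  | zero => simp [wexp, wpow, h0]
  | succ k =>
    rw [wexp, Finset.sum_range_succ', Finset.sum_range_succ']
    have h2 : ∀ j ∈ Finset.range k, ((j + 1 + 1).factorial : ℂ)⁻¹ • wpow a (j + 1 + 1) (k + 1) = 0 :=
      fun j _ => by rw [show wpow a (j + 1 + 1) = 0 from hp j]; exact smul_zero_form _
    rw [Finset.sum_congr rfl h2]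
    simp [wpow, wedge_unit, add_comm]

theorem wedge_apply_eq_zero_of_lt {a b : Alt V} {m n : ℕ} (ha : ∀ i < m, a i = 0)
    (hb : ∀ i < n, b i = 0) {k : ℕ} (hk : k < m + n) : wedge a b k = 0 := by
  ext u
  rw [wedge_apply]
  refine Finset.sum_eq_zero fun p hp => ?_
  have := Finset.HasAntidiagonal.mem_antidiagonal.1 hp
  rw [Finset.sum_eq_zero, mul_zero]
  intro σ _
  by_cases h : p.1 < m
  · simp [blockMul, ha _ h]
  · simp [blockMul, hb p.2 (by omega)]

theorem wpow_eq_zero_of_lt {a : Alt V} (h0 : a 0 = 0) (j k : ℕ) (hk : k < j) :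
    wpow a j k = 0 := by
  induction j generalizing k with
  | zero => omega
  | succ j ih =>
    exact wedge_apply_eq_zero_of_lt (m := 1) (n := j) (by simpa using h0) ih (by omega)

theorem eq_zero_of_finrank_lt [FiniteDimensional ℝ V] (a : Alt V) {k : ℕ}
    (hk : Module.finrank ℝ V < k) : a k = 0 := by
  ext u
  refine (a k).toAlternatingMap.map_linearDependent u fun h => ?_
  have := h.fintype_card_le_finrank
  simp at this
  omega

theorem invSub_eq_sum [FiniteDimensional ℝ V] {a : Alt V} (h0 : a 0 = 0) (c : ℂ) {J : ℕ}
    (hJ : Module.finrank ℝ V < J) :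
    invSub a c = -∑ j ∈ Finset.range J, (c⁻¹) ^ (j + 1) • wpow a j := by
  funext k
  by_cases hk : Module.finrank ℝ V < k
  -- The cut-off k + 1 depends on the degree and J does not. Above the dimension both sides vanish;
  -- below it the additional terms have j > k, where a^j has no degree k part.
  · rw [eq_zero_of_finrank_lt (invSub a c) hk, eq_zero_of_finrank_lt (-∑ j ∈ _, _) hk]
  · simp only [invSub, Pi.neg_apply, Finset.sum_apply, Pi.smul_apply]
    congr 1
    refine Finset.sum_subset (by simp; omega) fun j _ hj => ?_
    rw [wpow_eq_zero_of_lt h0 _ _ (by simp at hj; omega), smul_zero_form]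

/-- The power a^J lives in degrees at least J, where every form vanishes once J exceeds the
dimension. This nilpotence is behind both the inverse of a - c and the end of the averaging
argument. -/
theorem wpow_eq_zero [FiniteDimensional ℝ V] {a : Alt V} (h0 : a 0 = 0) {J : ℕ}
    (hJ : Module.finrank ℝ V < J) : wpow a J = 0 := by
  funext k
  by_cases hk : Module.finrank ℝ V < k
  · exact eq_zero_of_finrank_lt _ hk
  · exact wpow_eq_zero_of_lt h0 _ _ (by omega)

/-- With a cut-off beyond the dimension the geometric series telescopes to 1 minus a multiple of a
power of a that is zero. -/
theorem wedge_invSub [FiniteDimensional ℝ V] {a : Alt V} (h0 : a 0 = 0) {c : ℂ} (hc : c ≠ 0) :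
    wedge a (invSub a c) - c • invSub a c = unit := by
  set J := Module.finrank ℝ V + 1 with hJ
  have hlt : Module.finrank ℝ V < J := Nat.lt_succ_self _
  rw [invSub_eq_sum h0 c hlt, wedge_neg, wedge_sum, smul_neg, Finset.smul_sum, sub_neg_eq_add,
    neg_add_eq_sub, ← Finset.sum_sub_distrib]
  have h1 : ∀ j ∈ Finset.range J, c • (c⁻¹) ^ (j + 1) • wpow a j - wedge a ((c⁻¹) ^ (j + 1) • wpow a j)
      = (c⁻¹) ^ j • wpow a j - (c⁻¹) ^ (j + 1) • wpow a (j + 1) := by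
    intro j _
    rw [wedge_smul, smul_smul, pow_succ', ← mul_assoc, mul_inv_cancel₀ hc, one_mul]
    rfl
  rw [Finset.sum_congr rfl h1, Finset.sum_range_sub', wpow_eq_zero h0 hlt, smul_zero_alt]
  simp [wpow]

theorem sgn_wpow {a : Alt V} (h : sgn a = a) (j : ℕ) : sgn (wpow a j) = wpow a j := by
  induction j with
  | zero => exact sgn_unit
  | succ j ih => rw [wpow, sgn_wedge, h, ih]

theorem sgn_invSub {a : Alt V} (h : sgn a = a) (c : ℂ) : sgn (invSub a c) = invSub a c := by
  funext k
  have hk : ∀ j, (-1 : ℂ) ^ k • wpow a j k = wpow a j k := fun j => congrFun (sgn_wpow h j) k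
  simp only [sgn_apply, invSub, smul_neg, Finset.smul_sum, smul_comm ((-1 : ℂ) ^ k), hk]

theorem sgn_of_degree {a : Alt V} {p : ℕ} (h : ∀ j, j ≠ p → a j = 0) :
    sgn a = (-1 : ℂ) ^ p • a := by
  funext j
  by_cases hj : j = p
  · subst hj; rfl
  · rw [sgn_apply, Pi.smul_apply, h j hj, smul_zero_form, smul_zero_form]

end AltAlgebra

/-! ### Differential calculus of forms on a vector space -/

section NormedForms

section FiniteDimensionalBilinear

variable {T F G K : Type*} [NormedAddCommGroup T] [NormedSpace ℝ T]
  [NormedAddCommGroup F] [NormedSpace ℝ F] [FiniteDimensional ℝ F]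
  [NormedAddCommGroup G] [NormedSpace ℝ G] [FiniteDimensional ℝ G]
  [NormedAddCommGroup K] [NormedSpace ℝ K]

/-- A bilinear map on finite dimensional spaces, as a continuous bilinear map. -/
def bilinToCLM (B : F →ₗ[ℝ] G →ₗ[ℝ] K) : F →L[ℝ] G →L[ℝ] K :=
  LinearMap.toContinuousLinearMap
    ((LinearMap.toContinuousLinearMap : (G →ₗ[ℝ] K) ≃ₗ[ℝ] (G →L[ℝ] K)).toLinearMap.comp B)

theorem bilinToCLM_apply (B : F →ₗ[ℝ] G →ₗ[ℝ] K) (a : F) (b : G) : bilinToCLM B a b = B a b := rfl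

theorem hasFDerivAt_bilin (B : F →ₗ[ℝ] G →ₗ[ℝ] K) {a : T → F} {b : T → G} {a' : T →L[ℝ] F}
    {b' : T →L[ℝ] G} {x : T} (ha : HasFDerivAt a a' x) (hb : HasFDerivAt b b' x) :
    HasFDerivAt (fun y => B (a y) (b y))
      (((bilinToCLM B).flip (b x)).comp a' + (bilinToCLM B (a x)).comp b') x := by
  have h1 : HasFDerivAt (fun y => bilinToCLM B (a y)) ((bilinToCLM B).comp a') x :=
    (bilinToCLM B).hasFDerivAt.comp x ha
  have h2 := h1.clm_apply hb
  rw [add_comm]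
  exact h2

theorem contDiffOn_bilin (B : F →ₗ[ℝ] G →ₗ[ℝ] K) {a : T → F} {b : T → G} {s : Set T}
    {n : WithTop ℕ∞} (ha : ContDiffOn ℝ n a s) (hb : ContDiffOn ℝ n b s) :
    ContDiffOn ℝ n (fun y => B (a y) (b y)) s :=
  ((bilinToCLM B).contDiff.comp_contDiffOn ha).clm_apply hb

end FiniteDimensionalBilinear

variable {W : Type*} [NormedAddCommGroup W] [NormedSpace ℝ W]
  {U : Type*} [NormedAddCommGroup U] [NormedSpace ℝ U]
  {T : Type*} [NormedAddCommGroup T] [NormedSpace ℝ T]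

theorem mulForm_apply {k : ℕ} (p : Fin (k + 1)) (a : W [⋀^Fin (p : ℕ)]→L[ℝ] ℂ)
    (b : W [⋀^Fin (k - p)]→L[ℝ] ℂ) (u : Fin k → W) :
    mulForm p a b u = a (fun i => u ⟨i, by omega⟩) * b (fun j => u ⟨p + j, by omega⟩) := rfl

variable [FiniteDimensional ℝ W]

instance finiteDimensional_form (k : ℕ) : FiniteDimensional ℝ (W [⋀^Fin k]→L[ℝ] ℂ) :=
  FiniteDimensional.of_injective
    ({ toFun := fun f => f.toContinuousMultilinearMap.toMultilinearMap
       map_add' := fun _ _ => rfl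
       map_smul' := fun _ _ => rfl } :
      (W [⋀^Fin k]→L[ℝ] ℂ) →ₗ[ℝ] MultilinearMap ℝ (fun _ : Fin k => W) ℂ)
    (fun f g h => by ext u; exact congrArg (fun F => F u) h)

/-- Evaluation of forms at a tuple of vectors, as a continuous linear map. -/
def evalL {k : ℕ} (u : Fin k → W) : (W [⋀^Fin k]→L[ℝ] ℂ) →L[ℝ] ℂ :=
  LinearMap.toContinuousLinearMap
    { toFun := fun f => f u
      map_add' := fun _ _ => rfl
      map_smul' := fun _ _ => rfl }

/-- A map into the space of forms is smooth if all its evaluations are. -/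
theorem contDiffOn_of_eval {k : ℕ} {n : WithTop ℕ∞} {f : T → W [⋀^Fin k]→L[ℝ] ℂ} {s : Set T}
    (h : ∀ u : Fin k → W, ContDiffOn ℝ n (fun y => f y u) s) : ContDiffOn ℝ n f s := by
  let b := Module.finBasis ℝ W
  let ev : (W [⋀^Fin k]→L[ℝ] ℂ) →ₗ[ℝ] ((Fin k → Fin (Module.finrank ℝ W)) → ℂ) :=
    { toFun := fun f i => f (fun j => b (i j))
      map_add' := fun _ _ => rfl
      map_smul' := fun _ _ => rfl }
  have hinj : LinearMap.ker ev = ⊥ := by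
    rw [LinearMap.ker_eq_bot']
    intro f hf
    have h1 : f.toAlternatingMap = 0 := b.ext_alternating fun i _ => congrFun hf i
    ext u
    exact congrArg (fun F => F u) h1
  -- A form is determined by its finitely many values on basis tuples. A linear left inverse of this
  -- evaluation recovers f from scalar functions that are smooth by hypothesis.
  obtain ⟨g, hg⟩ := LinearMap.exists_leftInverse_of_injective ev hinj
  have hfe : f = fun y => (LinearMap.toContinuousLinearMap g) (ev (f y)) := by
    funext y
    exact (congrArg (fun l => l (f y)) hg).symm
  rw [hfe]
  refine (LinearMap.toContinuousLinearMap g).contDiff.comp_contDiffOn ?_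
  exact contDiffOn_pi.2 fun i => h _

/-- Smoothness of pullbacks of forms. -/
theorem contDiffOn_compContinuousLinearMap {k : ℕ} {n : WithTop ℕ∞}
    {f : T → U [⋀^Fin k]→L[ℝ] ℂ} {A : T → W →L[ℝ] U} {s : Set T}
    (hf : ContDiffOn ℝ n f s) (hA : ContDiffOn ℝ n A s) :
    ContDiffOn ℝ n (fun y => (f y).compContinuousLinearMap (A y)) s := by
  refine contDiffOn_of_eval fun u => ?_
  have h1 : ContDiffOn ℝ n (fun y =>
      ContinuousMultilinearMap.compContinuousLinearMapContinuousMultilinear ℝ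
        (fun _ : Fin k => W) (fun _ : Fin k => U) ℂ (fun _ => A y)) s :=
    (ContinuousMultilinearMap.contDiff _).comp_contDiffOn (contDiffOn_pi.2 fun _ => hA)
  have h2 : ContDiffOn ℝ n (fun y => (f y).toContinuousMultilinearMap) s :=
    (ContinuousAlternatingMap.toContinuousMultilinearMapLI (𝕜 := ℝ) (E := U) (F := ℂ)
      (ι := Fin k)).contDiff.comp_contDiffOn hf
  have h3 := (ContinuousMultilinearMap.apply ℝ (fun _ : Fin k => W) ℂ u).contDiff.comp_contDiffOn
    (h1.clm_apply h2)
  exact h3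

/-- The `(p, k - p)` part of the wedge product, as a bilinear map. -/
def wedgeB {k : ℕ} (p : Fin (k + 1)) :
    (W [⋀^Fin (p : ℕ)]→L[ℝ] ℂ) →ₗ[ℝ] (W [⋀^Fin (k - p)]→L[ℝ] ℂ) →ₗ[ℝ] (W [⋀^Fin k]→L[ℝ] ℂ) :=
  LinearMap.mk₂ ℝ (fun a b => (((p : ℕ).factorial : ℂ) * ((k - p : ℕ).factorial : ℂ))⁻¹ •
      ContinuousMultilinearMap.alternatization (mulForm p a b))
    (fun a b c => by
      ext u
      simp [ContinuousMultilinearMap.alternatization_apply_apply, mulForm_apply, mul_add, add_mul,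
        Finset.sum_add_distrib])
    (fun r a b => by
      ext u
      simp [ContinuousMultilinearMap.alternatization_apply_apply, mulForm_apply, Finset.mul_sum,
        Units.smul_def]
      refine Finset.sum_congr rfl fun σ _ => by ring)
    (fun a b c => by
      ext u
      simp [ContinuousMultilinearMap.alternatization_apply_apply, mulForm_apply, mul_add,
        Finset.sum_add_distrib])
    (fun r a b => by
      ext u
      simp [ContinuousMultilinearMap.alternatization_apply_apply, mulForm_apply, Finset.mul_sum,
        Units.smul_def]
      refine Finset.sum_congr rfl fun σ _ => by ring)

theorem wedge_eq_sum_wedgeB (a b : Alt W) (k : ℕ) :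
    wedge a b k = ∑ p : Fin (k + 1), wedgeB p (a p) (b (k - p)) := rfl

theorem contDiffOn_wedge {a b : T → Alt W} {s : Set T} {n : WithTop ℕ∞}
    (ha : ∀ k, ContDiffOn ℝ n (fun y => a y k) s) (hb : ∀ k, ContDiffOn ℝ n (fun y => b y k) s)
    (k : ℕ) : ContDiffOn ℝ n (fun y => wedge (a y) (b y) k) s := by
  simp only [wedge_eq_sum_wedgeB]
  exact ContDiffOn.sum fun p _ => contDiffOn_bilin (wedgeB p) (ha p) (hb (k - p))

/-- Contraction with a fixed vector, as a continuous linear map. -/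
def contrL (v : W) (k : ℕ) : (W [⋀^Fin (k + 1)]→L[ℝ] ℂ) →L[ℝ] (W [⋀^Fin k]→L[ℝ] ℂ) :=
  LinearMap.toContinuousLinearMap
    { toFun := fun a => contr v (Function.update (0 : Alt W) (k + 1) a) k
      map_add' := fun a b => by ext u; simp [contr_apply]
      map_smul' := fun r a => by ext u; simp [contr_apply] }

theorem contrL_apply (v : W) (k : ℕ) (a : Alt W) : contrL v k (a (k + 1)) = contr v a k := by
  ext u
  change contr v (Function.update (0 : Alt W) (k + 1) (a (k + 1))) k u = _
  simp [contr_apply]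

/-- The exterior derivative of inhomogeneous forms on a vector space. -/
def extd (φ : W → Alt W) : W → Alt W := fun x k =>
  match k with
  | 0 => 0
  | k + 1 => extDeriv (fun y => φ y k) x

/-- Componentwise differentiability of an inhomogeneous form. -/
def DiffAt (φ : T → Alt W) (x : T) : Prop := ∀ k, DifferentiableAt ℝ (fun y => φ y k) x

/-- The directional derivative of an inhomogeneous form. -/
def dirD (φ : T → Alt W) (x v : T) : Alt W := fun k => fderiv ℝ (fun y => φ y k) x v

theorem DiffAt.wedge_form {a b : T → Alt W} {x : T} (ha : DiffAt a x) (hb : DiffAt b x) :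
    DiffAt (fun y => wedge (a y) (b y)) x := by
  intro k
  simp only [wedge_eq_sum_wedgeB]
  exact DifferentiableAt.fun_sum fun p _ =>
    (hasFDerivAt_bilin (wedgeB p) (ha p).hasFDerivAt (hb (k - p)).hasFDerivAt).differentiableAt

theorem DiffAt.contr_form {a : T → Alt W} {x : T} (ha : DiffAt a x) (v : W) :
    DiffAt (fun y => contr v (a y)) x := by
  intro k
  simp only [← contrL_apply]
  exact (contrL v k).differentiableAt.comp x (ha (k + 1))

theorem DiffAt.sgn_form {a : T → Alt W} {x : T} (ha : DiffAt a x) :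
    DiffAt (fun y => sgn (a y)) x := by
  intro k
  have h : DifferentiableAt ℝ (fun y => a y k) x := ha k
  exact h.const_smul ((-1 : ℂ) ^ k)

theorem dirD_wedge {a b : T → Alt W} {x : T} (ha : DiffAt a x) (hb : DiffAt b x) (v : T) :
    dirD (fun y => wedge (a y) (b y)) x v =
      wedge (dirD a x v) (b x) + wedge (a x) (dirD b x v) := by
  funext k
  have h1 := HasFDerivAt.fun_sum (u := Finset.univ) fun (p : Fin (k + 1)) _ =>
    hasFDerivAt_bilin (wedgeB p) (ha p).hasFDerivAt (hb (k - p)).hasFDerivAt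
  have h2 := h1.fderiv
  simp only [← wedge_eq_sum_wedgeB] at h2
  have h3 : dirD (fun y => wedge (a y) (b y)) x v k = _ := congrArg (fun L => L v) h2
  rw [h3, Pi.add_apply, wedge_eq_sum_wedgeB, wedge_eq_sum_wedgeB, ← Finset.sum_add_distrib]
  simp [sum_apply, bilinToCLM_apply, dirD]

/-- Cartan's formula for a constant vector field, whose Lie derivative is the directional
derivative. The Leibniz rule and the formula for circle actions are both derived from it. -/
theorem contr_extd {φ : W → Alt W} {x : W} (hφ : DiffAt φ x) (v : W) :
    contr v (extd φ x) = dirD φ x v - extd (fun y => contr v (φ y)) x := by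
  funext k
  ext u
  have key : extDeriv (fun y => φ y k) x (Matrix.vecCons v u) =
      (fderiv ℝ (fun y => φ y k) x v) u - extd (fun y => contr v (φ y)) x k u := by
    -- The term of index 0 differentiates along v. All the others keep v in the first slot, and the
    -- shift of their index by one turns them into minus the exterior derivative of the contraction.
    rw [extDeriv, ContinuousAlternatingMap.alternatizeUncurryFin_apply, Fin.sum_univ_succ]
    have h0 : (0 : Fin (k + 1)).removeNth (Matrix.vecCons v u) = u := by
      ext i; simp [Fin.removeNth]
    rw [h0]
    simp only [Fin.val_zero, pow_zero, one_smul, Matrix.cons_val_zero, Matrix.cons_val_succ]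
    cases k with
    | zero => simp [extd]
    | succ k =>
      have h1 : fderiv ℝ (fun y => contr v (φ y) k) x =
          (contrL v k).comp (fderiv ℝ (fun y => φ y (k + 1)) x) := by
        simp only [← contrL_apply]
        exact ((contrL v k).hasFDerivAt.comp x (hφ (k + 1)).hasFDerivAt).fderiv
      have h2 : ∀ (f : W [⋀^Fin (k + 1)]→L[ℝ] ℂ) (w : Fin k → W),
          contrL v k f w = f (Matrix.vecCons v w) := by
        intro f w
        have := contrL_apply v k (Function.update (0 : Alt W) (k + 1) f)
        simp only [Function.update_self] at this
        rw [this, contr_apply, Function.update_self]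
      simp only [extd, extDeriv, ContinuousAlternatingMap.alternatizeUncurryFin_apply, h1,
        ContinuousLinearMap.comp_apply, h2, sub_eq_add_neg, ← Finset.sum_neg_distrib]
      congr 1
      refine Finset.sum_congr rfl fun i _ => ?_
      have h3 : i.succ.removeNth (Matrix.vecCons v u) = Matrix.vecCons v (i.removeNth u) := by
        ext j
        refine Fin.cases ?_ (fun l => ?_) j <;> simp [Fin.removeNth]
      rw [h3, Fin.val_succ, pow_succ]
      simp
  exact key

theorem extd_add {a b : W → Alt W} {x : W} (ha : DiffAt a x) (hb : DiffAt b x) :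
    extd (fun y => a y + b y) x = extd a x + extd b x := by
  funext k
  cases k with
  | zero => simp [extd]
  | succ k => exact extDeriv_add (ha k) (hb k)

theorem extd_smul (c : ℂ) {a : W → Alt W} {x : W} (ha : DiffAt a x) :
    extd (fun y => c • a y) x = c • extd a x := by
  funext k
  cases k with
  | zero => exact (smul_zero_form c).symm
  | succ k =>
    ext u
    have h1 : fderiv ℝ (fun y => c • a y k) x = c • fderiv ℝ (fun y => a y k) x :=
      fderiv_fun_const_smul (ha k) c
    simp only [extd, extDeriv, Pi.smul_apply, ContinuousAlternatingMap.smul_apply,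
      ContinuousAlternatingMap.alternatizeUncurryFin_apply, h1, Finset.smul_sum,
      smul_apply]
    refine Finset.sum_congr rfl fun i _ => ?_
    simp only [smul_comm c, smul_eq_mul]

theorem extd_sgn {a : W → Alt W} {x : W} (ha : DiffAt a x) :
    extd (fun y => sgn (a y)) x = -sgn (extd a x) := by
  funext k
  cases k with
  | zero =>
    have : sgn (extd a x) 0 = 0 := smul_zero_form _
    rw [Pi.neg_apply, this, neg_zero]
    rfl
  | succ k =>
    have := congrFun (extd_smul ((-1 : ℂ) ^ k) ha) (k + 1)
    rw [Pi.neg_apply, sgn_apply, pow_succ, mul_neg_one]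
    ext u
    have h2 : extd (fun y => sgn (a y)) x (k + 1) u = (-1 : ℂ) ^ k * extd a x (k + 1) u :=
      congrArg (fun f => f u) this
    simpa using h2

/-- The graded Leibniz rule. -/
theorem extd_wedge {a b : W → Alt W} {x : W} (ha : DiffAt a x) (hb : DiffAt b x) :
    extd (fun y => wedge (a y) (b y)) x =
      wedge (extd a x) (b x) + wedge (sgn (a x)) (extd b x) := by
  funext k
  induction k generalizing a b with
  | zero =>
    ext u
    simp [wedge_zero_apply, extd]
  | succ k ih =>
    -- Contraction leaves directional derivatives, for which the product rule is known, and exterior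
    -- derivatives of products with one factor contracted, which are covered by the induction
    -- hypothesis.
    refine succ_eq_of_contr fun v => ?_
    rw [contr_extd (ha.wedge_form hb), dirD_wedge ha hb]
    simp only [contr_wedge, contr_add]
    rw [extd_add ((ha.contr_form v).wedge_form hb) (ha.sgn_form.wedge_form (hb.contr_form v))]
    simp only [Pi.add_apply, Pi.sub_apply, ih (ha.contr_form v) hb, ih ha.sgn_form (hb.contr_form v),
      contr_extd ha, contr_extd hb, extd_sgn ha, sgn_sgn, neg_wedge, sub_wedge, wedge_sub,
      Pi.neg_apply]
    have h1 : contr v (sgn (a x)) = -sgn (contr v (a x)) := by rw [sgn_contr, neg_neg]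
    rw [h1, neg_wedge, Pi.neg_apply]
    abel

end NormedForms

theorem extd_congr {W : Type*} [NormedAddCommGroup W] [NormedSpace ℝ W]
    {φ φ' : W → Alt W} {s : Set W} {x : W} (hs : s ∈ nhds x)
    (h : ∀ y ∈ s, φ y = φ' y) : extd φ x = extd φ' x := by
  funext k
  cases k with
  | zero => rfl
  | succ k =>
    refine Filter.EventuallyEq.extDeriv_eq ?_
    filter_upwards [hs] with y hy
    rw [h y hy]

/-! ### Smooth forms and the exterior derivative on manifolds -/

section ManifoldForms

variable {E : Type*} [NormedAddCommGroup E] [NormedSpace ℝ E]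
  {M : Type*} [TopologicalSpace M] [ChartedSpace E M]
  {E' : Type*} [NormedAddCommGroup E'] [NormedSpace ℝ E']
  {N : Type*} [TopologicalSpace N] [ChartedSpace E' N]
  {E'' : Type*} [NormedAddCommGroup E''] [NormedSpace ℝ E'']
  {N' : Type*} [TopologicalSpace N'] [ChartedSpace E'' N']

/-- The differential of a map between manifolds, as a map between the model spaces. -/
def mfd (E : Type*) [NormedAddCommGroup E] [NormedSpace ℝ E]
    {M : Type*} [TopologicalSpace M] [ChartedSpace E M]
    (E' : Type*) [NormedAddCommGroup E'] [NormedSpace ℝ E']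
    {N : Type*} [TopologicalSpace N] [ChartedSpace E' N] (f : M → N) (x : M) : E →L[ℝ] E' :=
  mfderiv 𝓘(ℝ, E) 𝓘(ℝ, E') f x

theorem mfd_comp {g : N → N'} {f : M → N} {x : M}
    (hg : MDifferentiableAt 𝓘(ℝ, E') 𝓘(ℝ, E'') g (f x))
    (hf : MDifferentiableAt 𝓘(ℝ, E) 𝓘(ℝ, E') f x) :
    mfd E E'' (g ∘ f) x = (mfd E' E'' g (f x)).comp (mfd E E' f x) :=
  mfderiv_comp x hg hf

theorem mfd_congr {f g : M → N} {x : M} (h : f =ᶠ[nhds x] g) : mfd E E' f x = mfd E E' g x :=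
  h.mfderiv_eq

theorem mfd_eq_fderiv (f : E → E') (x : E) : mfd E E' f x = fderiv ℝ f x := mfderiv_eq_fderiv

theorem mfd_id (x : M) : mfd E E (id : M → M) x = ContinuousLinearMap.id ℝ E := mfderiv_id

namespace DForm

/-- The value of a differential form, as a form on the model space. -/
def valAt (ψ : DForm E M) (x : M) : Alt E := ψ x

theorem ext_valAt {α β : DForm E M} (h : ∀ x, α.valAt x = β.valAt x) : α = β := funext h

theorem valAt_pullback (f : M → N) (ψ : DForm E' N) (x : M) :
    (pullback f ψ : DForm E M).valAt x = altPullback (mfd E E' f x) (ψ.valAt (f x)) := rfl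

theorem valAt_wedge (α β : DForm E M) (x : M) :
    (wedge α β).valAt x = TDuality.wedge (α.valAt x) (β.valAt x) := rfl

theorem valAt_add (α β : DForm E M) (x : M) : (α + β).valAt x = α.valAt x + β.valAt x := rfl

theorem valAt_smul (c : ℂ) (α : DForm E M) (x : M) : (c • α).valAt x = c • α.valAt x := rfl

/-- The form in the preferred chart around `x`. -/
def inChart (ψ : DForm E M) (x : M) (y : E) : Alt E :=
  altPullback (mfd E E (extChartAt 𝓘(ℝ, E) x).symm y) (ψ.valAt ((extChartAt 𝓘(ℝ, E) x).symm y))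

theorem chartRep_eq (ψ : DForm E M) (x : M) (k : ℕ) :
    ψ.chartRep x k = fun y => ψ.inChart x y k := rfl

theorem valAt_d (ψ : DForm E M) (x : M) :
    ψ.d.valAt x = altPullback (mfd E E (extChartAt 𝓘(ℝ, E) x) x)
      (extd (ψ.inChart x) (extChartAt 𝓘(ℝ, E) x x)) := by
  funext k
  cases k <;> rfl

/-- The grading involution on differential forms. -/
def sgn (ψ : DForm E M) : DForm E M := fun x => TDuality.sgn (ψ x)

theorem valAt_sgn (ψ : DForm E M) (x : M) : ψ.sgn.valAt x = TDuality.sgn (ψ.valAt x) := rfl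

theorem two_le_infty : (2 : WithTop ℕ∞) ≤ ∞ := by
  have : ((2 : ℕ∞) : WithTop ℕ∞) ≤ ((⊤ : ℕ∞) : WithTop ℕ∞) := WithTop.coe_le_coe.2 le_top
  exact this

section Charts

variable [IsManifold 𝓘(ℝ, E) ∞ M]

theorem contMDiffAt_chart_symm (x : M) {y : E} (hy : y ∈ (extChartAt 𝓘(ℝ, E) x).target) :
    ContMDiffAt 𝓘(ℝ, E) 𝓘(ℝ, E) ∞ (extChartAt 𝓘(ℝ, E) x).symm y :=
  (contMDiffOn_extChartAt_symm x).contMDiffAt ((isOpen_extChartAt_target x).mem_nhds hy)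

theorem contMDiffAt_chart (x : M) {z : M} (hz : z ∈ (extChartAt 𝓘(ℝ, E) x).source) :
    ContMDiffAt 𝓘(ℝ, E) 𝓘(ℝ, E) ∞ (extChartAt 𝓘(ℝ, E) x) z :=
  contMDiffAt_extChartAt' (by rwa [extChartAt_source] at hz)

theorem chart_symm_comp_mfd (x : M) :
    (mfd E E (extChartAt 𝓘(ℝ, E) x).symm (extChartAt 𝓘(ℝ, E) x x)).comp
      (mfd E E (extChartAt 𝓘(ℝ, E) x) x) = ContinuousLinearMap.id ℝ E := by
  rw [← mfd_comp, ← mfd_id x]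
  · refine mfd_congr ?_
    filter_upwards [(isOpen_extChartAt_source (I := 𝓘(ℝ, E)) x).mem_nhds
      (mem_extChartAt_source (I := 𝓘(ℝ, E)) x)] with z hz
    exact (extChartAt 𝓘(ℝ, E) x).left_inv hz
  · exact (contMDiffAt_chart_symm x (mem_extChartAt_target (I := 𝓘(ℝ, E)) x)).mdifferentiableAt
      (by simp)
  · exact (contMDiffAt_chart x (mem_extChartAt_source (I := 𝓘(ℝ, E)) x)).mdifferentiableAt
      (by simp)

theorem altPullback_inChart (ψ : DForm E M) (x : M) :
    altPullback (mfd E E (extChartAt 𝓘(ℝ, E) x) x)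
      (ψ.inChart x (extChartAt 𝓘(ℝ, E) x x)) = ψ.valAt x := by
  rw [inChart, altPullback_comp, chart_symm_comp_mfd, altPullback_id, extChartAt_to_inv x]

variable {W : Type*} [NormedAddCommGroup W] [NormedSpace ℝ W]

/-- The pullback of a form along a parametrization by an open subset of a vector space. -/
def paramPull (φ : W → M) (ψ : DForm E M) (y : W) : Alt W :=
  altPullback (mfd W E φ y) (ψ.valAt (φ y))

/-- Where φ lands in the chart at x it factors as the inverse chart after g = chart ∘ φ, a map of
vector spaces. Pulling back along φ thus becomes pulling back the coordinate expression along g, and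
smoothness and naturality of d reduce to the case of vector spaces. -/
theorem eventually_paramPull_eq {O : Set W} (hO : IsOpen O) {φ : W → M}
    (hφ : ContMDiffOn 𝓘(ℝ, W) 𝓘(ℝ, E) ∞ φ O) (ψ : DForm E M) (x : M) :
    ∃ O' : Set W, O' = O ∩ φ ⁻¹' (extChartAt 𝓘(ℝ, E) x).source ∧ IsOpen O' ∧
      ContDiffOn ℝ ∞ (extChartAt 𝓘(ℝ, E) x ∘ φ) O' ∧
      ∀ y ∈ O', paramPull φ ψ y = altPullback (fderiv ℝ (extChartAt 𝓘(ℝ, E) x ∘ φ) y)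
        (ψ.inChart x (extChartAt 𝓘(ℝ, E) x (φ y))) := by
  have hO' : IsOpen (O ∩ φ ⁻¹' (extChartAt 𝓘(ℝ, E) x).source) :=
    hφ.continuousOn.isOpen_inter_preimage hO (isOpen_extChartAt_source x)
  have hφ' : ∀ y ∈ O, ContMDiffAt 𝓘(ℝ, W) 𝓘(ℝ, E) ∞ φ y := fun y hy =>
    hφ.contMDiffAt (hO.mem_nhds hy)
  have hg : ∀ y ∈ O ∩ φ ⁻¹' (extChartAt 𝓘(ℝ, E) x).source,
      ContMDiffAt 𝓘(ℝ, W) 𝓘(ℝ, E) ∞ (extChartAt 𝓘(ℝ, E) x ∘ φ) y := fun y hy =>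
    (contMDiffAt_chart x hy.2).comp y (hφ' y hy.1)
  refine ⟨_, rfl, hO', fun y hy => (contMDiffAt_iff_contDiffAt.1 (hg y hy)).contDiffWithinAt,
    fun y hy => ?_⟩
  have hyt : extChartAt 𝓘(ℝ, E) x (φ y) ∈ (extChartAt 𝓘(ℝ, E) x).target :=
    (extChartAt 𝓘(ℝ, E) x).map_source hy.2
  have h1 : mfd W E φ y = (mfd E E (extChartAt 𝓘(ℝ, E) x).symm (extChartAt 𝓘(ℝ, E) x (φ y))).comp
      (fderiv ℝ (extChartAt 𝓘(ℝ, E) x ∘ φ) y) := by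
    rw [← mfd_eq_fderiv]
    refine Eq.trans ?_ (mfd_comp (f := extChartAt 𝓘(ℝ, E) x ∘ φ)
      ((contMDiffAt_chart_symm x hyt).mdifferentiableAt (by simp))
      ((hg y hy).mdifferentiableAt (by simp)))
    refine mfd_congr ?_
    filter_upwards [hO'.mem_nhds hy] with z hz
    exact ((extChartAt 𝓘(ℝ, E) x).left_inv hz.2).symm
  rw [paramPull, h1, inChart, altPullback_comp, (extChartAt 𝓘(ℝ, E) x).left_inv hy.2]

/-- The components of a smooth form are smooth in every parametrization. -/
theorem Smooth.contDiffOn_paramPull [FiniteDimensional ℝ W] {ψ : DForm E M} (hψ : ψ.Smooth)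
    {O : Set W} (hO : IsOpen O) {φ : W → M} (hφ : ContMDiffOn 𝓘(ℝ, W) 𝓘(ℝ, E) ∞ φ O) (k : ℕ) :
    ContDiffOn ℝ ∞ (fun y => paramPull φ ψ y k) O := by
  intro y hy
  obtain ⟨O', hO'eq, hO', hg, heq⟩ := eventually_paramPull_eq hO hφ ψ (φ y)
  have hyO' : y ∈ O' := by
    rw [hO'eq]; exact ⟨hy, mem_extChartAt_source (I := 𝓘(ℝ, E)) (φ y)⟩
  have hmaps : Set.MapsTo (extChartAt 𝓘(ℝ, E) (φ y) ∘ φ) O'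
      (extChartAt 𝓘(ℝ, E) (φ y)).target := fun z hz => by
    rw [hO'eq] at hz
    exact (extChartAt 𝓘(ℝ, E) (φ y)).map_source hz.2
  have h1 : ContDiffOn ℝ ∞ (fun z => ψ.inChart (φ y) (extChartAt 𝓘(ℝ, E) (φ y) (φ z)) k) O' :=
    (hψ (φ y) k).comp hg hmaps
  have h2 : ContDiffOn ℝ ∞ (fderiv ℝ (extChartAt 𝓘(ℝ, E) (φ y) ∘ φ)) O' :=
    hg.fderiv_of_isOpen hO' (by simp)
  have h3 := contDiffOn_compContinuousLinearMap h1 h2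
  have h4 : ContDiffOn ℝ ∞ (fun y => paramPull φ ψ y k) O' :=
    h3.congr fun z hz => congrFun (heq z hz) k
  exact (h4.contDiffAt (hO'.mem_nhds hyO')).contDiffWithinAt

theorem Smooth.diffAt_paramPull [FiniteDimensional ℝ W] {ψ : DForm E M} (hψ : ψ.Smooth)
    {O : Set W} (hO : IsOpen O) {φ : W → M} (hφ : ContMDiffOn 𝓘(ℝ, W) 𝓘(ℝ, E) ∞ φ O)
    {y : W} (hy : y ∈ O) : DiffAt (paramPull φ ψ) y := fun k =>
  ((hψ.contDiffOn_paramPull hO hφ k).contDiffAt (hO.mem_nhds hy)).differentiableAt (by simp)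

/-- The exterior derivative can be computed in every parametrization. -/
theorem Smooth.extd_paramPull {ψ : DForm E M} (hψ : ψ.Smooth) {O : Set W} (hO : IsOpen O)
    {φ : W → M} (hφ : ContMDiffOn 𝓘(ℝ, W) 𝓘(ℝ, E) ∞ φ O) {y : W} (hy : y ∈ O) :
    extd (paramPull φ ψ) y = paramPull φ ψ.d y := by
  obtain ⟨O', hO'eq, hO', hg, heq⟩ := eventually_paramPull_eq hO hφ ψ (φ y)
  have hys := mem_extChartAt_source (I := 𝓘(ℝ, E)) (φ y)
  have hyO' : y ∈ O' := by rw [hO'eq]; exact ⟨hy, hys⟩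
  have hgy : ContDiffAt ℝ ∞ (extChartAt 𝓘(ℝ, E) (φ y) ∘ φ) y :=
    hg.contDiffAt (hO'.mem_nhds hyO')
  have hcomp : (mfd E E (extChartAt 𝓘(ℝ, E) (φ y)) (φ y)).comp (mfd W E φ y) =
      fderiv ℝ (extChartAt 𝓘(ℝ, E) (φ y) ∘ φ) y := by
    rw [← mfd_eq_fderiv]
    exact (mfd_comp ((contMDiffAt_chart (φ y) hys).mdifferentiableAt (by simp))
      ((hφ.contMDiffAt (hO.mem_nhds hy)).mdifferentiableAt (by simp))).symm
  rw [paramPull, valAt_d, altPullback_comp, hcomp]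
  funext k
  cases k with
  | zero => rfl
  | succ k =>
    have h1 : (fun z => paramPull φ ψ z k) =ᶠ[nhds y] fun z =>
        (ψ.inChart (φ y) ((extChartAt 𝓘(ℝ, E) (φ y) ∘ φ) z) k).compContinuousLinearMap
          (fderiv ℝ (extChartAt 𝓘(ℝ, E) (φ y) ∘ φ) z) := by
      filter_upwards [hO'.mem_nhds hyO'] with z hz
      exact congrFun (heq z hz) k
    have h2 : DifferentiableAt ℝ (fun z => ψ.inChart (φ y) z k)
        ((extChartAt 𝓘(ℝ, E) (φ y) ∘ φ) y) :=
      ((hψ (φ y) k).contDiffAt (extChartAt_target_mem_nhds (φ y))).differentiableAt (by simp)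
    refine (h1.extDeriv_eq).trans ?_
    exact extDeriv_pullback h2 hgy (by
      rw [minSmoothness_of_isRCLikeNormedField]; exact two_le_infty)

end Charts

section Calculus

variable [IsManifold 𝓘(ℝ, E) ∞ M]

theorem Smooth.diffAt_inChart {ψ : DForm E M} (hψ : ψ.Smooth) (x : M) :
    DiffAt (ψ.inChart x) (extChartAt 𝓘(ℝ, E) x x) := fun k =>
  ((hψ x k).contDiffAt (extChartAt_target_mem_nhds x)).differentiableAt (by simp)

theorem Smooth.inChart_d {ψ : DForm E M} (hψ : ψ.Smooth) (x : M) {y : E}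
    (hy : y ∈ (extChartAt 𝓘(ℝ, E) x).target) : ψ.d.inChart x y = extd (ψ.inChart x) y :=
  (hψ.extd_paramPull (isOpen_extChartAt_target x) (contMDiffOn_extChartAt_symm x) hy).symm

theorem contDiffOn_extd {φ : E → Alt E} {s : Set E} (hs : IsOpen s)
    (h : ∀ k, ContDiffOn ℝ ∞ (fun y => φ y k) s) (k : ℕ) :
    ContDiffOn ℝ ∞ (fun y => extd φ y k) s := by
  cases k with
  | zero => exact contDiffOn_const
  | succ k =>
    have h1 : ContDiffOn ℝ ∞ (fderiv ℝ (fun y => φ y k)) s := (h k).fderiv_of_isOpen hs (by simp)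
    exact (ContinuousAlternatingMap.alternatizeUncurryFinCLM ℝ E ℂ).contDiff.comp_contDiffOn h1

theorem Smooth.d {ψ : DForm E M} (hψ : ψ.Smooth) : ψ.d.Smooth := fun x k =>
  (contDiffOn_extd (isOpen_extChartAt_target x) (hψ x) k).congr fun _ hy =>
    congrFun (hψ.inChart_d x hy) k

theorem Smooth.d_d {ψ : DForm E M} (hψ : ψ.Smooth) : ψ.d.d = 0 := by
  refine ext_valAt fun x => ?_
  rw [valAt_d]
  have h : extd (ψ.d.inChart x) (extChartAt 𝓘(ℝ, E) x x) = 0 := by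
    funext k
    cases k with
    | zero => rfl
    | succ k =>
      have h1 : (fun y => ψ.d.inChart x y k) =ᶠ[nhds (extChartAt 𝓘(ℝ, E) x x)]
          fun y => extd (ψ.inChart x) y k := by
        filter_upwards [extChartAt_target_mem_nhds (I := 𝓘(ℝ, E)) x] with y hy
        rw [hψ.inChart_d x hy]
      refine h1.extDeriv_eq.trans ?_
      cases k with
      | zero =>
        have h2 : (fun y => extd (ψ.inChart x) y 0) = fun _ => 0 := rfl
        rw [h2, extDeriv, fderiv_fun_const]
        ext u
        simp [ContinuousAlternatingMap.alternatizeUncurryFin_apply]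
      | succ k =>
        exact extDeriv_extDeriv_apply ((hψ x k).contDiffAt (extChartAt_target_mem_nhds x))
          (by rw [minSmoothness_of_isRCLikeNormedField]; exact two_le_infty)
  rw [h]
  rfl

theorem valAt_eq_of_inChart {α β : DForm E M} {x : M}
    (h : α.inChart x (extChartAt 𝓘(ℝ, E) x x) = β.inChart x (extChartAt 𝓘(ℝ, E) x x)) :
    α.valAt x = β.valAt x := by
  rw [← altPullback_inChart, h, altPullback_inChart]

section Pullback

variable [IsManifold 𝓘(ℝ, E') ∞ N]

theorem inChart_pullback {f : M → N} (hf : ContMDiff 𝓘(ℝ, E) 𝓘(ℝ, E') ∞ f) (ψ : DForm E' N)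
    (x : M) {y : E} (hy : y ∈ (extChartAt 𝓘(ℝ, E) x).target) :
    (pullback f ψ : DForm E M).inChart x y =
      paramPull (f ∘ (extChartAt 𝓘(ℝ, E) x).symm) ψ y := by
  rw [paramPull, mfd_comp ((hf _).mdifferentiableAt (by simp))
    ((contMDiffAt_chart_symm x hy).mdifferentiableAt (by simp)), ← altPullback_comp]
  rfl

theorem contMDiffOn_comp_chart_symm {f : M → N} (hf : ContMDiff 𝓘(ℝ, E) 𝓘(ℝ, E') ∞ f) (x : M) :
    ContMDiffOn 𝓘(ℝ, E) 𝓘(ℝ, E') ∞ (f ∘ (extChartAt 𝓘(ℝ, E) x).symm)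
      (extChartAt 𝓘(ℝ, E) x).target :=
  hf.comp_contMDiffOn (contMDiffOn_extChartAt_symm x)

theorem Smooth.pullback [FiniteDimensional ℝ E] {f : M → N}
    (hf : ContMDiff 𝓘(ℝ, E) 𝓘(ℝ, E') ∞ f) {ψ : DForm E' N} (hψ : ψ.Smooth) :
    (pullback f ψ : DForm E M).Smooth := fun x k =>
  (hψ.contDiffOn_paramPull (isOpen_extChartAt_target x)
    (contMDiffOn_comp_chart_symm hf x) k).congr fun _ hy => congrFun (inChart_pullback hf ψ x hy) k

theorem Smooth.d_pullback {f : M → N}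
    (hf : ContMDiff 𝓘(ℝ, E) 𝓘(ℝ, E') ∞ f) {ψ : DForm E' N} (hψ : ψ.Smooth) :
    (DForm.pullback f ψ : DForm E M).d = DForm.pullback f ψ.d := by
  refine ext_valAt fun x => ?_
  rw [← altPullback_inChart (DForm.pullback f ψ.d), inChart_pullback hf _ x
    (mem_extChartAt_target (I := 𝓘(ℝ, E)) x), valAt_d,
    ← hψ.extd_paramPull (isOpen_extChartAt_target x) (contMDiffOn_comp_chart_symm hf x)
      (mem_extChartAt_target (I := 𝓘(ℝ, E)) x),
    extd_congr (extChartAt_target_mem_nhds x) fun y hy => inChart_pullback hf ψ x hy]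

end Pullback

theorem inChart_wedge (α β : DForm E M) (x : M) (y : E) :
    (wedge α β).inChart x y = TDuality.wedge (α.inChart x y) (β.inChart x y) :=
  altPullback_wedge _ _ _

theorem Smooth.add {α β : DForm E M} (hα : α.Smooth) (hβ : β.Smooth) : (α + β).Smooth :=
  fun x k => (hα x k).add (hβ x k)

theorem Smooth.smul {α : DForm E M} (c : ℂ) (hα : α.Smooth) : (c • α).Smooth := fun x k => by
  have h : ContDiffOn ℝ ∞ (fun y => c • α.inChart x y k) (extChartAt 𝓘(ℝ, E) x).target :=
    ContDiffOn.const_smul c (hα x k)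
  exact h

theorem Smooth.neg {α : DForm E M} (hα : α.Smooth) : (-α).Smooth :=
  fun x k => (hα x k).neg

theorem Smooth.zero : (0 : DForm E M).Smooth := fun x k => by
  have h : (0 : DForm E M).chartRep x k = fun _ => 0 := rfl
  rw [h]
  exact contDiffOn_const

theorem Smooth.sum {ι : Type*} (s : Finset ι) {f : ι → DForm E M} (h : ∀ i ∈ s, (f i).Smooth) :
    (∑ i ∈ s, f i).Smooth := by
  classical
  induction s using Finset.induction_on with
  | empty => exact Smooth.zero
  | insert i s hi ih =>
    rw [Finset.sum_insert hi]
    exact (h i (Finset.mem_insert_self i s)).add (ih fun j hj => h j (Finset.mem_insert_of_mem hj))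

variable [FiniteDimensional ℝ E]

theorem Smooth.wedge {α β : DForm E M} (hα : α.Smooth) (hβ : β.Smooth) :
    (wedge α β).Smooth := fun x k =>
  (contDiffOn_wedge (hα x) (hβ x) k).congr fun y _ => congrFun (inChart_wedge α β x y) k

theorem Smooth.d_add {α β : DForm E M} (hα : α.Smooth) (hβ : β.Smooth) :
    (α + β).d = α.d + β.d := by
  refine ext_valAt fun x => ?_
  rw [valAt_add, valAt_d, valAt_d, valAt_d, ← altPullback_add,
    ← extd_add (hα.diffAt_inChart x) (hβ.diffAt_inChart x)]
  rfl

theorem Smooth.d_smul (c : ℂ) {α : DForm E M} (hα : α.Smooth) : (c • α).d = c • α.d := by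
  refine ext_valAt fun x => ?_
  rw [valAt_smul, valAt_d, valAt_d, ← altPullback_smul, ← extd_smul c (hα.diffAt_inChart x)]
  rfl

theorem Smooth.d_neg {α : DForm E M} (hα : α.Smooth) : (-α).d = -α.d := by
  have h := hα.d_smul (-1)
  have h1 : ∀ β : DForm E M, (-1 : ℂ) • β = -β := fun β => by
    refine ext_valAt fun x => neg_one_smul_alt _
  rwa [h1, h1] at h

/-- The graded Leibniz rule on manifolds. -/
theorem Smooth.d_wedge {α β : DForm E M} (hα : α.Smooth) (hβ : β.Smooth) :
    (DForm.wedge α β).d = DForm.wedge α.d β + DForm.wedge α.sgn β.d := by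
  refine ext_valAt fun x => ?_
  have h : (DForm.wedge α β).inChart x =
      fun y => TDuality.wedge (α.inChart x y) (β.inChart x y) := funext fun y => inChart_wedge α β x y
  rw [valAt_add, valAt_wedge, valAt_wedge, valAt_d, h,
    extd_wedge (hα.diffAt_inChart x) (hβ.diffAt_inChart x), altPullback_add, altPullback_wedge,
    altPullback_wedge, ← valAt_d, ← valAt_d, altPullback_inChart, ← sgn_altPullback,
    altPullback_inChart, valAt_sgn]

end Calculus

end DForm

end ManifoldForms

universe u

/-! ### Smooth dependence of integrals on parameters -/

section ParametricIntegrals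

open MeasureTheory

/-- Differentiation under the integral sign, on an open set. -/
theorem hasFDerivAt_parametric {E F : Type*} [NormedAddCommGroup E] [NormedSpace ℝ E]
    [FiniteDimensional ℝ E] [NormedAddCommGroup F] [NormedSpace ℝ F] {g : ℝ × E → F} {S : Set E}
    (hS : IsOpen S) (hg : ContDiffOn ℝ 1 g (Set.univ ×ˢ S)) {y : E} (hy : y ∈ S) :
    HasFDerivAt (fun y => ∫ t in (0 : ℝ)..1, g (t, y))
      (∫ t in (0 : ℝ)..1, (fderiv ℝ g (t, y)).comp (ContinuousLinearMap.inr ℝ ℝ E)) y := by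
  have : ProperSpace E := FiniteDimensional.proper ℝ E
  have hO : IsOpen (Set.univ ×ˢ S : Set (ℝ × E)) := isOpen_univ.prod hS
  obtain ⟨r, hr, hrS⟩ := Metric.nhds_basis_closedBall.mem_iff.1 (hS.mem_nhds hy)
  have hcont : ContinuousOn g (Set.univ ×ˢ S) := hg.continuousOn
  have hcont' : ContinuousOn (fun p : ℝ × E => (fderiv ℝ g p).comp
      (ContinuousLinearMap.inr ℝ ℝ E)) (Set.univ ×ˢ S) :=
    (hg.continuousOn_fderiv_of_isOpen hO le_rfl).clm_comp continuousOn_const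
  have hslice : ∀ z ∈ S, Continuous fun t : ℝ => g (t, z) := fun z hz =>
    hcont.comp_continuous (by fun_prop) fun t => ⟨trivial, hz⟩
  have hslice' : Continuous fun t : ℝ => (fderiv ℝ g (t, y)).comp
      (ContinuousLinearMap.inr ℝ ℝ E) :=
    hcont'.comp_continuous (f := fun t : ℝ => (t, y)) (by fun_prop) fun t => ⟨trivial, hy⟩
  have hK : IsCompact (Set.Icc (0 : ℝ) 1 ×ˢ Metric.closedBall y r) :=
    isCompact_Icc.prod (isCompact_closedBall y r)
  obtain ⟨C, hC⟩ := hK.exists_bound_of_continuousOn (hcont'.mono fun p hp => ⟨trivial, hrS hp.2⟩)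
  refine intervalIntegral.hasFDerivAt_integral_of_dominated_of_fderiv_le
    (𝕜 := ℝ) (F := fun z t => g (t, z))
    (F' := fun z t => (fderiv ℝ g (t, z)).comp (ContinuousLinearMap.inr ℝ ℝ E))
    (bound := fun _ => C) (Metric.ball_mem_nhds y hr) ?_ ?_ ?_ ?_ ?_ ?_
  · filter_upwards [hS.mem_nhds hy] with z hz
    exact (hslice z hz).aestronglyMeasurable
  · exact (hslice y hy).intervalIntegrable _ _
  · exact hslice'.aestronglyMeasurable
  · refine Filter.Eventually.of_forall fun t ht z hz => hC (t, z) ⟨?_, Metric.ball_subset_closedBall hz⟩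
    rw [Set.uIoc_of_le zero_le_one] at ht
    exact ⟨ht.1.le, ht.2⟩
  · exact intervalIntegrable_const
  · refine Filter.Eventually.of_forall fun t _ z hz => ?_
    have hzS : ((t, z) : ℝ × E) ∈ (Set.univ ×ˢ S : Set (ℝ × E)) :=
      ⟨trivial, hrS (Metric.ball_subset_closedBall hz)⟩
    have h1 : HasFDerivAt g (fderiv ℝ g (t, z)) (t, z) :=
      ((hg.contDiffAt (hO.mem_nhds hzS)).differentiableAt (by simp)).hasFDerivAt
    have h2 : HasFDerivAt (fun z : E => (t, z)) (ContinuousLinearMap.inr ℝ ℝ E) z :=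
      hasFDerivAt_prodMk_right t z
    exact h1.comp z h2

/-- The derivative of the integral is again an integral of this kind, with values in E →L[ℝ] F. The
induction therefore has to range over all targets F, and E and F share a universe so that it does
not leave that range. -/
theorem contDiffOn_nat_parametric {E : Type u} [NormedAddCommGroup E] [NormedSpace ℝ E]
    [FiniteDimensional ℝ E] {S : Set E} (hS : IsOpen S) (n : ℕ) :
    ∀ {F : Type u} [NormedAddCommGroup F] [NormedSpace ℝ F] {g : ℝ × E → F},
    ContDiffOn ℝ ∞ g (Set.univ ×ˢ S) →
      ContDiffOn ℝ n (fun y => ∫ t in (0 : ℝ)..1, g (t, y)) S := by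
  have hO : IsOpen (Set.univ ×ˢ S : Set (ℝ × E)) := isOpen_univ.prod hS
  induction n with
  | zero =>
    intro F _ _ g hg
    rw [Nat.cast_zero, contDiffOn_zero]
    exact fun y hy => (hasFDerivAt_parametric hS (hg.of_le (by simp)) hy).continuousAt.continuousWithinAt
  | succ n ih =>
    intro F _ _ g hg
    have hfd := fun y (hy : y ∈ S) => hasFDerivAt_parametric hS (hg.of_le (by simp)) hy
    rw [Nat.cast_succ, contDiffOn_succ_iff_fderiv_of_isOpen hS]
    refine ⟨fun y hy => (hfd y hy).differentiableAt.differentiableWithinAt, by simp, ?_⟩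
    have h1 : ContDiffOn ℝ ∞ (fun p : ℝ × E => (fderiv ℝ g p).comp
        (ContinuousLinearMap.inr ℝ ℝ E)) (Set.univ ×ˢ S) :=
      (hg.fderiv_of_isOpen hO (by simp)).clm_comp contDiffOn_const
    exact (ih h1).congr fun y hy => (hfd y hy).fderiv

theorem contDiffOn_parametric {E : Type u} [NormedAddCommGroup E] [NormedSpace ℝ E]
    [FiniteDimensional ℝ E] {S : Set E} (hS : IsOpen S)
    {F : Type u} [NormedAddCommGroup F] [NormedSpace ℝ F] {g : ℝ × E → F}
    (hg : ContDiffOn ℝ ∞ g (Set.univ ×ˢ S)) :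
    ContDiffOn ℝ ∞ (fun y => ∫ t in (0 : ℝ)..1, g (t, y)) S :=
  contDiffOn_infty.2 fun n => contDiffOn_nat_parametric hS n hg

end ParametricIntegrals

/-! ### Circle actions and Cartan's formula -/

section CircleActions

variable {E : Type*} [NormedAddCommGroup E] [NormedSpace ℝ E]
  {M : Type*} [TopologicalSpace M] [ChartedSpace E M] [MulAction Circle M]

theorem rot_zero (x : M) : rot (0 : ℝ) x = x := by simp [rot]

theorem rot_add (s t : ℝ) (x : M) : rot (s + t) x = rot s (rot t x) := by
  simp [rot, mul_add, Circle.exp_add, mul_smul]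

theorem rot_one (x : M) : rot (1 : ℝ) x = x := by
  simp [rot, Circle.exp_two_pi]

theorem exists_rot_eq (g : Circle) : ∃ t : ℝ, ∀ x : M, rot t x = g • x := by
  obtain ⟨s, rfl⟩ := Circle.exp_surjective g
  refine ⟨s / (2 * Real.pi), fun x => ?_⟩
  rw [rot, mul_div_cancel₀ s (by positivity)]

/-- Smoothness of a circle action. -/
def SmoothAction (E : Type*) [NormedAddCommGroup E] [NormedSpace ℝ E]
    (M : Type*) [TopologicalSpace M] [ChartedSpace E M] [MulAction Circle M] : Prop :=
  ContMDiff ((𝓡 1).prod 𝓘(ℝ, E)) 𝓘(ℝ, E) ∞ (fun p : Circle × M => p.1 • p.2)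

theorem contMDiff_circle_param :
    ContMDiff 𝓘(ℝ, ℝ) (𝓡 1) ∞ (fun t : ℝ => Circle.exp (2 * Real.pi * t)) :=
  contMDiff_circleExp.comp (contDiff_const.mul contDiff_id).contMDiff

theorem SmoothAction.rot (h : SmoothAction E M) (t : ℝ) :
    ContMDiff 𝓘(ℝ, E) 𝓘(ℝ, E) ∞ (rot t : M → M) :=
  have h' : ContMDiff ((𝓡 1).prod 𝓘(ℝ, E)) 𝓘(ℝ, E) ∞ (fun p : Circle × M => p.1 • p.2) := h
  h'.comp (contMDiff_const.prodMk contMDiff_id)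

theorem SmoothAction.orbit (h : SmoothAction E M) (x : M) :
    ContMDiff 𝓘(ℝ, ℝ) 𝓘(ℝ, E) ∞ (fun t : ℝ => TDuality.rot t x) :=
  have h' : ContMDiff ((𝓡 1).prod 𝓘(ℝ, E)) 𝓘(ℝ, E) ∞ (fun p : Circle × M => p.1 • p.2) := h
  h'.comp (contMDiff_circle_param.prodMk contMDiff_const)

/-- The generator of the action, as a vector of the model space. -/
def gen (E : Type*) [NormedAddCommGroup E] [NormedSpace ℝ E]
    {M : Type*} [TopologicalSpace M] [ChartedSpace E M] [MulAction Circle M] (x : M) : E :=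
  mfd ℝ E (fun t : ℝ => rot t x) 0 1

theorem SmoothAction.mfd_rot_gen (h : SmoothAction E M) (t : ℝ) (x : M) :
    mfd E E (TDuality.rot t) x (gen E x) = gen E (TDuality.rot t x) := by
  have h1 : TDuality.rot t ∘ (fun s : ℝ => TDuality.rot s x) =
      fun s => TDuality.rot s (TDuality.rot t x) := by
    funext s; simp only [Function.comp, ← rot_add, add_comm]
  have h2 := mfd_comp (E := ℝ) (x := (0 : ℝ)) (((h.rot t) (TDuality.rot 0 x)).mdifferentiableAt
    (by simp)) ((h.orbit x 0).mdifferentiableAt (by simp))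
  rw [h1, rot_zero] at h2
  rw [gen, gen, h2]
  rfl

/-- By the group law the orbit of x is the orbit of its point at time t with the clock shifted, so
its velocity there is the generator. -/
theorem SmoothAction.mfd_orbit (h : SmoothAction E M) (t : ℝ) (x : M) :
    mfd ℝ E (fun s : ℝ => TDuality.rot s x) t 1 = gen E (TDuality.rot t x) := by
  have h1 : (fun s : ℝ => TDuality.rot s (TDuality.rot t x)) ∘ (fun s : ℝ => s - t) =
      fun s => TDuality.rot s x := by
    funext s; simp only [Function.comp, ← rot_add, sub_add_cancel]
  have h3 : HasFDerivAt (fun s : ℝ => s - t) (ContinuousLinearMap.id ℝ ℝ) t :=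
    (hasFDerivAt_id t).sub_const t
  have h2 := mfd_comp (E := ℝ) (E' := ℝ) (f := fun s : ℝ => s - t) (x := t)
    ((h.orbit (TDuality.rot t x) (t - t)).mdifferentiableAt (by simp))
    h3.differentiableAt.mdifferentiableAt
  rw [h1, sub_self, mfd_eq_fderiv, h3.fderiv] at h2
  rw [gen, h2]
  rfl

namespace DForm

/-- Pullback along the flow. -/
abbrev flow (t : ℝ) (ψ : DForm E M) : DForm E M := pullback (rot t) ψ

/-- Contraction with the generator of the action. -/
def iota (ψ : DForm E M) : DForm E M := fun x => contr (genField E x) (ψ x)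

theorem valAt_iota (ψ : DForm E M) (x : M) :
    ψ.iota.valAt x = contr (gen E x) (ψ.valAt x) := rfl

/-- The Lie derivative along the generator, by Cartan's formula. -/
def lie (ψ : DForm E M) : DForm E M := ψ.iota.d + ψ.d.iota

variable [IsManifold 𝓘(ℝ, E) ∞ M]

theorem flow_zero (ψ : DForm E M) : flow 0 ψ = ψ := by
  refine ext_valAt fun x => ?_
  have h : (rot (0 : ℝ) : M → M) = id := funext rot_zero
  rw [flow, h, valAt_pullback, mfd_id]
  rfl

theorem flow_one (ψ : DForm E M) : flow 1 ψ = ψ := by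
  refine ext_valAt fun x => ?_
  have h : (rot (1 : ℝ) : M → M) = id := funext rot_one
  rw [flow, h, valAt_pullback, mfd_id]
  rfl

variable (hact : SmoothAction E M)
include hact

theorem flow_flow (s t : ℝ) (ψ : DForm E M) : flow s (flow t ψ) = flow (t + s) ψ := by
  refine ext_valAt fun x => ?_
  have h : (rot (t + s) : M → M) = rot t ∘ rot s := funext (rot_add t s)
  rw [flow, flow, flow, h, valAt_pullback, valAt_pullback, valAt_pullback, altPullback_comp,
    mfd_comp ((hact.rot t _).mdifferentiableAt (by simp))
      ((hact.rot s _).mdifferentiableAt (by simp))]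
  rfl

theorem flow_iota (t : ℝ) (ψ : DForm E M) : flow t ψ.iota = (flow t ψ).iota := by
  refine ext_valAt fun x => ?_
  rw [flow, flow, valAt_pullback, valAt_iota, valAt_iota, valAt_pullback, contr_altPullback,
    hact.mfd_rot_gen]

/-- The flow, with time and chart coordinates as parameters. -/
def flowParam (x : M) (p : ℝ × E) : M := rot p.1 ((extChartAt 𝓘(ℝ, E) x).symm p.2)

omit hact in
theorem isOpen_flowDomain (x : M) :
    IsOpen (Set.univ ×ˢ (extChartAt 𝓘(ℝ, E) x).target : Set (ℝ × E)) :=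
  isOpen_univ.prod (isOpen_extChartAt_target x)

theorem contMDiffOn_flowParam (x : M) :
    ContMDiffOn 𝓘(ℝ, ℝ × E) 𝓘(ℝ, E) ∞ (flowParam x)
      (Set.univ ×ˢ (extChartAt 𝓘(ℝ, E) x).target) := by
  have h1 : ContMDiffOn 𝓘(ℝ, ℝ × E) (𝓡 1) ∞
      (fun p : ℝ × E => Circle.exp (2 * Real.pi * p.1))
      (Set.univ ×ˢ (extChartAt 𝓘(ℝ, E) x).target) :=
    (contMDiff_circle_param.comp contDiff_fst.contMDiff).contMDiffOn
  have h2 : ContMDiffOn 𝓘(ℝ, ℝ × E) 𝓘(ℝ, E) ∞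
      (fun p : ℝ × E => (extChartAt 𝓘(ℝ, E) x).symm p.2)
      (Set.univ ×ˢ (extChartAt 𝓘(ℝ, E) x).target) :=
    (contMDiffOn_extChartAt_symm x).comp contDiff_snd.contMDiff.contMDiffOn fun p hp => hp.2
  exact ContMDiff.comp_contMDiffOn hact (h1.prodMk h2)

theorem mdifferentiableAt_flowParam (x : M) (t : ℝ) {y : E}
    (hy : y ∈ (extChartAt 𝓘(ℝ, E) x).target) :
    MDifferentiableAt 𝓘(ℝ, ℝ × E) 𝓘(ℝ, E) (flowParam x) (t, y) :=
  ((contMDiffOn_flowParam hact x).contMDiffAt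
    ((isOpen_flowDomain x).mem_nhds ⟨trivial, hy⟩)).mdifferentiableAt (by simp)

theorem mfd_flowParam_inr (x : M) (t : ℝ) {y : E} (hy : y ∈ (extChartAt 𝓘(ℝ, E) x).target) :
    (mfd (ℝ × E) E (flowParam x) (t, y)).comp (ContinuousLinearMap.inr ℝ ℝ E) =
      (mfd E E (rot t) ((extChartAt 𝓘(ℝ, E) x).symm y)).comp
        (mfd E E (extChartAt 𝓘(ℝ, E) x).symm y) := by
  have h2 : HasFDerivAt (fun z : E => (t, z)) (ContinuousLinearMap.inr ℝ ℝ E) y :=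
    hasFDerivAt_prodMk_right t y
  rw [← mfd_comp ((hact.rot t _).mdifferentiableAt (by simp))
    ((contMDiffAt_chart_symm x hy).mdifferentiableAt (by simp)), ← h2.fderiv, ← mfd_eq_fderiv,
    ← mfd_comp (mdifferentiableAt_flowParam hact x t hy) h2.differentiableAt.mdifferentiableAt]
  rfl

theorem mfd_flowParam_time (x : M) (t : ℝ) {y : E} (hy : y ∈ (extChartAt 𝓘(ℝ, E) x).target) :
    mfd (ℝ × E) E (flowParam x) (t, y) (1, 0) = gen E (flowParam x (t, y)) := by
  have h2 : HasFDerivAt (fun s : ℝ => (s, y)) (ContinuousLinearMap.inl ℝ ℝ E) t :=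
    hasFDerivAt_prodMk_left t y
  rw [flowParam, ← hact.mfd_orbit]
  have h3 := mfd_comp (E := ℝ) (x := t) (f := fun s : ℝ => (s, y))
    (mdifferentiableAt_flowParam hact x t hy) h2.differentiableAt.mdifferentiableAt
  rw [mfd_eq_fderiv (fun s : ℝ => (s, y)), h2.fderiv] at h3
  exact (congrArg (fun L => L 1) h3).symm

theorem inChart_flow (ψ : DForm E M) (x : M) (t : ℝ) {y : E}
    (hy : y ∈ (extChartAt 𝓘(ℝ, E) x).target) :
    (flow t ψ).inChart x y =
      altPullback (ContinuousLinearMap.inr ℝ ℝ E) (paramPull (flowParam x) ψ (t, y)) := by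
  rw [paramPull, altPullback_comp, mfd_flowParam_inr hact x t hy, inChart, flow, valAt_pullback,
    altPullback_comp]
  rfl

/-- The flow map sends ∂_t to the generator. Pulled back to time × chart, the generator becomes a
constant vector field, to which `contr_extd` applies. -/
theorem contr_paramPull_flow (ψ : DForm E M) (x : M) {p : ℝ × E}
    (hp : p ∈ (Set.univ ×ˢ (extChartAt 𝓘(ℝ, E) x).target : Set (ℝ × E))) :
    contr (1, 0) (paramPull (flowParam x) ψ p) = paramPull (flowParam x) ψ.iota p := by
  rw [paramPull, contr_altPullback, mfd_flowParam_time hact x p.1 hp.2]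
  rfl

variable [FiniteDimensional ℝ E]

theorem Smooth.contDiffOn_flow {ψ : DForm E M} (hψ : ψ.Smooth) (x : M) (k : ℕ) :
    ContDiffOn ℝ ∞ (fun p : ℝ × E => (flow p.1 ψ).inChart x p.2 k)
      (Set.univ ×ˢ (extChartAt 𝓘(ℝ, E) x).target) := by
  have h := hψ.contDiffOn_paramPull (isOpen_flowDomain x) (contMDiffOn_flowParam hact x) k
  have h1 : ContDiffOn ℝ ∞ (fun _ : ℝ × E => ContinuousLinearMap.inr ℝ ℝ E)
    (Set.univ ×ˢ (extChartAt 𝓘(ℝ, E) x).target) := contDiffOn_const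
  exact (contDiffOn_compContinuousLinearMap h h1).congr fun p hp =>
    congrFun (inChart_flow hact ψ x p.1 hp.2) k

/-- Smoothness of the generator as a vector field need not be discussed: contraction with the
constant vector ∂_t is smooth on time × chart, and the slice at time 0 is the coordinate expression
of the contracted form. -/
theorem Smooth.iota {ψ : DForm E M} (hψ : ψ.Smooth) : ψ.iota.Smooth := fun x k => by
  have h := hψ.contDiffOn_paramPull (isOpen_flowDomain x) (contMDiffOn_flowParam hact x) (k + 1)
  have h1 : ContDiffOn ℝ ∞ (fun p => paramPull (flowParam x) ψ.iota p k)
      (Set.univ ×ˢ (extChartAt 𝓘(ℝ, E) x).target) :=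
    ((contrL ((1, 0) : ℝ × E) k).contDiff.comp_contDiffOn h).congr fun p hp => by
      rw [← contr_paramPull_flow hact ψ x hp]
      exact (contrL_apply _ _ _).symm
  have h2 : ContDiffOn ℝ ∞ (fun y : E => paramPull (flowParam x) ψ.iota (0, y) k)
      (extChartAt 𝓘(ℝ, E) x).target :=
    h1.comp (contDiff_prodMk_right 0).contDiffOn fun y hy => ⟨trivial, hy⟩
  have h3 : ContDiffOn ℝ ∞ (fun _ : E => ContinuousLinearMap.inr ℝ ℝ E)
    (extChartAt 𝓘(ℝ, E) x).target := contDiffOn_const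
  refine (contDiffOn_compContinuousLinearMap h2 h3).congr fun y hy => ?_
  have h4 := inChart_flow hact ψ.iota x 0 hy
  rw [flow_zero] at h4
  exact congrFun h4 k

theorem Smooth.pullback_rot {ψ : DForm E M} (hψ : ψ.Smooth) (t : ℝ) : (flow t ψ).Smooth :=
  Smooth.pullback (hact.rot t) hψ

theorem Smooth.cartan {ψ : DForm E M} (hψ : ψ.Smooth) : ψ.lie.Smooth :=
  (hψ.iota hact).d.add (hψ.d.iota hact)

/-- Cartan's formula for the constant field ∂_t, transported to M: both d and the contraction
commute with the pullback along the flow map. -/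
theorem dirD_paramPull_flow {ψ : DForm E M} (hψ : ψ.Smooth) (x : M) {p : ℝ × E}
    (hp : p ∈ (Set.univ ×ˢ (extChartAt 𝓘(ℝ, E) x).target : Set (ℝ × E))) :
    dirD (paramPull (flowParam x) ψ) p (1, 0) = paramPull (flowParam x) ψ.lie p := by
  have hO := isOpen_flowDomain (E := E) x
  have hΦ := contMDiffOn_flowParam hact x
  have h1 := contr_extd (hψ.diffAt_paramPull hO hΦ hp) (1, 0)
  rw [hψ.extd_paramPull hO hΦ hp, contr_paramPull_flow hact _ x hp,
    extd_congr (hO.mem_nhds hp) fun q hq => contr_paramPull_flow hact ψ x hq,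
    (hψ.iota hact).extd_paramPull hO hΦ hp] at h1
  rw [eq_sub_iff_add_eq] at h1
  rw [← h1, add_comm]
  rfl

/-- Cartan's formula for the derivative of the pullbacks along the flow, in a chart. -/
theorem Smooth.hasDerivAt_flow_inChart {ψ : DForm E M} (hψ : ψ.Smooth) (x : M) {y : E}
    (hy : y ∈ (extChartAt 𝓘(ℝ, E) x).target) (k : ℕ) (t : ℝ) :
    HasDerivAt (fun s : ℝ => (flow s ψ).inChart x y k) ((flow t ψ.lie).inChart x y k) t := by
  have hp : ((t, y) : ℝ × E) ∈ (Set.univ ×ˢ (extChartAt 𝓘(ℝ, E) x).target : Set (ℝ × E)) :=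
    ⟨trivial, hy⟩
  have h1 := (hψ.diffAt_paramPull (isOpen_flowDomain x) (contMDiffOn_flowParam hact x) hp
    k).hasFDerivAt
  have h2 : HasDerivAt (fun s : ℝ => (s, y)) ((1, 0) : ℝ × E) t :=
    (hasDerivAt_id t).prodMk (hasDerivAt_const t y)
  have h3 := h1.comp_hasDerivAt t h2
  have h4 : HasDerivAt (fun s : ℝ => paramPull (flowParam x) ψ (s, y) k)
      (paramPull (flowParam x) ψ.lie (t, y) k) t := by
    rw [← dirD_paramPull_flow hact hψ x hp]
    exact h3
  have h5 := ((ContinuousAlternatingMap.compContinuousLinearMapCLM (F := ℂ) (ι := Fin k)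
    (ContinuousLinearMap.inr ℝ ℝ E)).hasFDerivAt).comp_hasDerivAt t h4
  rw [inChart_flow hact _ x t hy]
  refine h5.congr_of_eventuallyEq (Filter.Eventually.of_forall fun s => ?_)
  exact congrFun (inChart_flow hact ψ x s hy) k

/-- Cartan's formula. -/
theorem Smooth.hasDerivAt_flow {ψ : DForm E M} (hψ : ψ.Smooth) (x : M) (k : ℕ) (t : ℝ) :
    HasDerivAt (fun s : ℝ => (flow s ψ).valAt x k) ((flow t ψ.lie).valAt x k) t := by
  have h := hψ.hasDerivAt_flow_inChart hact x (mem_extChartAt_target (I := 𝓘(ℝ, E)) x) k t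
  have h5 := ((ContinuousAlternatingMap.compContinuousLinearMapCLM (F := ℂ) (ι := Fin k)
    (mfd E E (extChartAt 𝓘(ℝ, E) x) x)).hasFDerivAt).comp_hasDerivAt t h
  rw [← altPullback_inChart]
  refine h5.congr_of_eventuallyEq (Filter.Eventually.of_forall fun s => ?_)
  exact congrFun (altPullback_inChart (DForm.flow s ψ) x).symm k

end DForm

end CircleActions

/-- Linear maps on finite dimensional spaces commute with integrals. -/
theorem map_intervalIntegral {F G : Type*} [NormedAddCommGroup F] [NormedSpace ℝ F]
    [FiniteDimensional ℝ F] [NormedAddCommGroup G] [NormedSpace ℝ G] [CompleteSpace G] (T : F → G)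
    (hadd : ∀ a b, T (a + b) = T a + T b) (hsmul : ∀ (r : ℝ) (a : F), T (r • a) = r • T a)
    {g : ℝ → F} (hg : Continuous g) : T (∫ t in (0 : ℝ)..1, g t) = ∫ t in (0 : ℝ)..1, T (g t) :=
  have : CompleteSpace F := FiniteDimensional.complete ℝ F
  ((LinearMap.toContinuousLinearMap { toFun := T, map_add' := hadd, map_smul' := hsmul }
    ).intervalIntegral_comp_comm (hg.intervalIntegrable 0 1)).symm

/-! ### Weights of forms and averages over the circle -/

section Averaging

variable {E : Type*} [NormedAddCommGroup E] [NormedSpace ℝ E] [FiniteDimensional ℝ E]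
  {M : Type*} [TopologicalSpace M] [ChartedSpace E M] [IsManifold 𝓘(ℝ, E) ∞ M]
  [MulAction Circle M]

namespace DForm

/-- The weight `m`, as an eigenvalue of the Lie derivative. -/
abbrev eig (m : ℤ) : ℂ := 2 * Real.pi * Complex.I * m

theorem Smooth.hasDerivAt_flow_apply (hact : SmoothAction E M) {ψ : DForm E M} (hψ : ψ.Smooth)
    (x : M) (k : ℕ) (u : Fin k → E) (t : ℝ) :
    HasDerivAt (fun s : ℝ => (flow s ψ).valAt x k u) ((flow t ψ.lie).valAt x k u) t :=
  (evalL u).hasFDerivAt.comp_hasDerivAt t (hψ.hasDerivAt_flow hact x k t)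

/-- By Cartan's formula the derivative along the flow exists and equals dι + ιd; uniqueness of
derivatives does the rest. The analytic condition thereby becomes an algebraic one. -/
theorem Smooth.hasLieDeriv_iff (hact : SmoothAction E M) {ψ μ : DForm E M} (hψ : ψ.Smooth) :
    HasLieDeriv ψ μ ↔ ψ.lie = μ := by
  have h0 : ∀ (x : M) (k : ℕ) (u : Fin k → TangentSpace 𝓘(ℝ, E) x),
      HasDerivAt (fun t : ℝ => DForm.pullback (rot t) ψ x k u) (ψ.lie x k u) 0 := fun x k u => by
    have h := hψ.hasDerivAt_flow_apply hact x k u 0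
    rw [flow_zero] at h
    exact h
  constructor
  · intro h
    funext x k
    ext u
    exact (h0 x k u).unique (h x k u)
  · rintro rfl
    exact h0

theorem flow_smul (t : ℝ) (c : ℂ) (ψ : DForm E M) : flow t (c • ψ) = c • flow t ψ := rfl

theorem flow_add (t : ℝ) (α β : DForm E M) : flow t (α + β) = flow t α + flow t β := rfl

theorem flow_wedge (t : ℝ) (α β : DForm E M) :
    flow t (wedge α β) = wedge (flow t α) (flow t β) :=
  funext fun _ => altPullback_wedge _ _ _

theorem Smooth.flow_d (hact : SmoothAction E M) {ψ : DForm E M} (hψ : ψ.Smooth) (t : ℝ) :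
    flow t ψ.d = (flow t ψ).d :=
  (hψ.d_pullback (hact.rot t)).symm

/-- The eigenvalue equation for L_v is a linear differential equation along each orbit. Multiplying
the pulled back form by e^{-2πimt} gives a function of zero derivative, which integrates the
infinitesimal condition to the whole flow. -/
theorem mem_weightForms_iff (hact : SmoothAction E M) {m : ℤ} {ψ : DForm E M} :
    ψ ∈ weightForms E M m ↔ ψ.Smooth ∧ ∀ t : ℝ, flow t ψ = Complex.exp (eig m * t) • ψ := by
  refine and_congr_right fun hψ => ?_
  constructor
  · intro h t
    rw [hψ.hasLieDeriv_iff hact] at h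
    refine ext_valAt fun x => funext fun k => ?_
    ext u
    have h1 : ∀ s : ℝ, HasDerivAt
        (fun s : ℝ => Complex.exp (-(eig m) * s) * (flow s ψ).valAt x k u) 0 s := fun s => by
      have h2 := hψ.hasDerivAt_flow_apply hact x k u s
      rw [h, flow_smul] at h2
      have h3 : HasDerivAt (fun s : ℝ => Complex.exp (-(eig m) * s))
          (Complex.exp (-(eig m) * s) * (-(eig m) * 1)) s :=
        ((Complex.ofRealCLM.hasDerivAt (x := s)).const_mul (-(eig m))).cexp
      have h4 := h3.mul h2
      refine h4.congr_deriv ?_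
      have h5 : ((eig m • flow s ψ).valAt x k u : ℂ) = eig m * (flow s ψ).valAt x k u := rfl
      have h6 : ((2 * Real.pi * Complex.I * m : ℂ) • flow s ψ).valAt x k u =
        (eig m • flow s ψ).valAt x k u := rfl
      rw [h6, h5]
      ring
    have h2 := is_const_of_deriv_eq_zero (fun s => (h1 s).differentiableAt)
      (fun s => (h1 s).deriv) t 0
    have h3 : Complex.exp (-(eig m) * t) * (flow t ψ).valAt x k u = ψ.valAt x k u := by
      refine h2.trans ?_
      rw [flow_zero]
      simp
    have h4 : ((Complex.exp (eig m * t) • ψ).valAt x k u : ℂ) =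
        Complex.exp (eig m * t) * ψ.valAt x k u := rfl
    rw [h4, ← h3, ← mul_assoc, ← Complex.exp_add]
    simp
  · intro h x k u
    have h3 : HasDerivAt (fun s : ℝ => Complex.exp (eig m * s))
        (Complex.exp (eig m * (0 : ℝ)) * (eig m * 1)) 0 :=
      ((Complex.ofRealCLM.hasDerivAt (x := (0 : ℝ))).const_mul (eig m)).cexp
    have h4 := h3.mul_const (ψ x k u)
    have h5 : (fun t : ℝ => DForm.pullback (rot t) ψ x k u) =
        fun s : ℝ => Complex.exp (eig m * s) * ψ x k u := by
      funext t
      exact congrArg (fun F : DForm E M => F x k u) (h t)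
    rw [h5]
    refine h4.congr_deriv ?_
    have h6 : ((2 * Real.pi * Complex.I * m : ℂ) • ψ) x k u = eig m * ψ x k u := rfl
    rw [h6]
    simp

theorem lie_of_mem_weightForms (hact : SmoothAction E M) {m : ℤ} {ψ : DForm E M}
    (h : ψ ∈ weightForms E M m) : ψ.lie = eig m • ψ :=
  (h.1.hasLieDeriv_iff hact).1 h.2

theorem mem_invariantForms_iff {ψ : DForm E M} :
    ψ ∈ invariantForms E M ↔ ψ.Smooth ∧ ∀ t : ℝ, flow t ψ = ψ := by
  refine and_congr_right fun _ => ⟨fun h t => h _, fun h g => ?_⟩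
  obtain ⟨t, ht⟩ := exists_rot_eq (M := M) g
  have h1 : (fun x : M => g • x) = rot t := funext fun x => (ht x).symm
  rw [h1]
  exact h t

theorem lie_of_flow_eq (hact : SmoothAction E M) {ψ : DForm E M} (hψ : ψ.Smooth)
    (h : ∀ t : ℝ, flow t ψ = ψ) : ψ.lie = 0 := by
  refine (hψ.hasLieDeriv_iff hact).1 fun x k u => ?_
  have h5 : (fun t : ℝ => DForm.pullback (rot t) ψ x k u) = fun _ => ψ x k u := by
    funext t
    exact congrArg (fun F : DForm E M => F x k u) (h t)
  rw [h5]
  exact hasDerivAt_const _ _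

/-- The average of a form over the circle action, with weight function `f`. -/
def avg (f : ℝ → ℝ) (ψ : DForm E M) : DForm E M := fun x k =>
  (∫ t in (0 : ℝ)..1, f t • (flow t ψ).valAt x k : E [⋀^Fin k]→L[ℝ] ℂ)

theorem valAt_avg (f : ℝ → ℝ) (ψ : DForm E M) (x : M) (k : ℕ) :
    (avg f ψ).valAt x k = ∫ t in (0 : ℝ)..1, f t • (flow t ψ).valAt x k := rfl

theorem Smooth.continuous_flow (hact : SmoothAction E M) {ψ : DForm E M} (hψ : ψ.Smooth)
    (x : M) (k : ℕ) : Continuous fun t : ℝ => (flow t ψ).valAt x k :=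
  continuous_iff_continuousAt.2 fun t => (hψ.hasDerivAt_flow hact x k t).continuousAt

theorem Smooth.clm_avg (hact : SmoothAction E M) {f : ℝ → ℝ} (hf : Continuous f) {ψ : DForm E M}
    (hψ : ψ.Smooth) (x : M) (k : ℕ) {F : Type*} [NormedAddCommGroup F] [NormedSpace ℝ F]
    [CompleteSpace F] (T : (E [⋀^Fin k]→L[ℝ] ℂ) →L[ℝ] F) :
    T ((avg f ψ).valAt x k) = ∫ t in (0 : ℝ)..1, f t • T ((flow t ψ).valAt x k) := by
  rw [valAt_avg, ← T.intervalIntegral_comp_comm]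
  · simp only [map_smul]
  · exact (hf.smul (hψ.continuous_flow hact x k)).intervalIntegrable _ _

theorem Smooth.inChart_avg (hact : SmoothAction E M) {f : ℝ → ℝ} (hf : Continuous f)
    {ψ : DForm E M} (hψ : ψ.Smooth) (x : M) (k : ℕ) (y : E) :
    (avg f ψ).inChart x y k = ∫ t in (0 : ℝ)..1, f t • (flow t ψ).inChart x y k :=
  hψ.clm_avg hact hf _ k (ContinuousAlternatingMap.compContinuousLinearMapCLM (F := ℂ)
    (ι := Fin k) (mfd E E (extChartAt 𝓘(ℝ, E) x).symm y))

theorem Smooth.contDiffOn_smul_flow (hact : SmoothAction E M) {f : ℝ → ℝ} (hf : ContDiff ℝ ∞ f)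
    {ψ : DForm E M} (hψ : ψ.Smooth) (x : M) (k : ℕ) :
    ContDiffOn ℝ ∞ (fun p : ℝ × E => f p.1 • (flow p.1 ψ).inChart x p.2 k)
      (Set.univ ×ˢ (extChartAt 𝓘(ℝ, E) x).target) :=
  (hf.comp contDiff_fst).contDiffOn.smul (hψ.contDiffOn_flow hact x k)

theorem Smooth.average (hact : SmoothAction E M) {f : ℝ → ℝ} (hf : ContDiff ℝ ∞ f)
    {ψ : DForm E M} (hψ : ψ.Smooth) : (avg f ψ).Smooth := fun x k =>
  (contDiffOn_parametric (isOpen_extChartAt_target x) (hψ.contDiffOn_smul_flow hact hf x k)).congr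
    fun y _ => hψ.inChart_avg hact hf.continuous x k y

/-- The flow commutes with d, so this is differentiation under the integral sign in a chart,
followed by the antisymmetrization, a linear map that passes through the integral. -/
theorem Smooth.d_avg (hact : SmoothAction E M) {f : ℝ → ℝ} (hf : ContDiff ℝ ∞ f)
    {ψ : DForm E M} (hψ : ψ.Smooth) : (avg f ψ).d = avg f ψ.d := by
  refine ext_valAt fun x => valAt_eq_of_inChart ?_
  have hy := mem_extChartAt_target (I := 𝓘(ℝ, E)) x
  rw [(hψ.average hact hf).inChart_d x hy]
  funext k
  rw [hψ.d.inChart_avg hact hf.continuous x k]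
  have hd : ∀ t : ℝ, (flow t ψ.d).inChart x (extChartAt 𝓘(ℝ, E) x x) k =
      extd ((flow t ψ).inChart x) (extChartAt 𝓘(ℝ, E) x x) k := fun t => by
    rw [hψ.flow_d hact, (hψ.pullback_rot hact t).inChart_d x hy]
  simp only [hd]
  cases k with
  | zero =>
    have h : ∀ t : ℝ, f t • extd ((flow t ψ).inChart x) (extChartAt 𝓘(ℝ, E) x x) 0 = 0 :=
      fun t => by ext u; exact smul_zero (f t)
    simp only [h, intervalIntegral.integral_zero]
    rfl
  | succ k =>
    have hg := hψ.contDiffOn_smul_flow hact hf x k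
    have h1 := hasFDerivAt_parametric (isOpen_extChartAt_target x) (hg.of_le (by simp)) hy
    have h2 : (fun y => (avg f ψ).inChart x y k) =
        fun y => ∫ t in (0 : ℝ)..1, f t • (flow t ψ).inChart x y k :=
      funext fun y => hψ.inChart_avg hact hf.continuous x k y
    have hO := isOpen_flowDomain (E := E) x
    have hmem : ∀ t : ℝ, ((t, extChartAt 𝓘(ℝ, E) x x) : ℝ × E) ∈
        (Set.univ ×ˢ (extChartAt 𝓘(ℝ, E) x).target : Set (ℝ × E)) := fun t => ⟨trivial, hy⟩
    -- The derivative under the integral is that of a function of (t, y), restricted to the y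
    -- directions; at fixed t it is the derivative of the flowed form.
    have h3 : ∀ t : ℝ, (fderiv ℝ (fun p : ℝ × E => f p.1 • (flow p.1 ψ).inChart x p.2 k)
        (t, extChartAt 𝓘(ℝ, E) x x)).comp (ContinuousLinearMap.inr ℝ ℝ E) =
        f t • fderiv ℝ (fun y => (flow t ψ).inChart x y k) (extChartAt 𝓘(ℝ, E) x x) := fun t => by
      have h4 := (((hg.contDiffAt (hO.mem_nhds (hmem t))).differentiableAt
        (by simp)).hasFDerivAt).comp (extChartAt 𝓘(ℝ, E) x x)
        (hasFDerivAt_prodMk_right t (extChartAt 𝓘(ℝ, E) x x))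
      have h5 := ((hψ.pullback_rot hact t).diffAt_inChart x k).hasFDerivAt.const_smul (f t)
      exact h4.unique h5
    have h6 : Continuous fun t : ℝ => (fderiv ℝ (fun p : ℝ × E =>
        f p.1 • (flow p.1 ψ).inChart x p.2 k) (t, extChartAt 𝓘(ℝ, E) x x)).comp
        (ContinuousLinearMap.inr ℝ ℝ E) :=
      ((hg.continuousOn_fderiv_of_isOpen hO (by simp)).clm_comp
        continuousOn_const).comp_continuous (f := fun t : ℝ => (t, extChartAt 𝓘(ℝ, E) x x))
        (by fun_prop) hmem
    have h7 : extd ((avg f ψ).inChart x) (extChartAt 𝓘(ℝ, E) x x) (k + 1) =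
        ContinuousAlternatingMap.alternatizeUncurryFinCLM ℝ E ℂ
          (fderiv ℝ (fun y => (avg f ψ).inChart x y k) (extChartAt 𝓘(ℝ, E) x x)) := rfl
    rw [h7, h2, h1.fderiv]
    refine (map_intervalIntegral (F := E →L[ℝ] E [⋀^Fin k]→L[ℝ] ℂ)
      (G := E [⋀^Fin (k + 1)]→L[ℝ] ℂ)
      (fun T => ContinuousAlternatingMap.alternatizeUncurryFinCLM ℝ E ℂ T)
      (fun a b => map_add _ a b) (fun r a => map_smul _ r a) h6).trans ?_
    simp only [h3, map_smul]
    rfl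

theorem Smooth.avg_wedge (hact : SmoothAction E M) {f : ℝ → ℝ} (hf : Continuous f)
    {ψ Φ : DForm E M} (hψ : ψ.Smooth) (hΦ : ∀ t : ℝ, flow t Φ = Φ) :
    avg f (DForm.wedge Φ ψ) = DForm.wedge Φ (avg f ψ) := by
  refine ext_valAt fun x => funext fun k => ?_
  rw [valAt_wedge, wedge_eq_sum_wedgeB, valAt_avg]
  have h1 : ∀ p : Fin (k + 1), wedgeB p (Φ.valAt x p) ((avg f ψ).valAt x (k - p)) =
      ∫ t in (0 : ℝ)..1, f t • wedgeB p (Φ.valAt x p) ((flow t ψ).valAt x (k - p)) := fun p => by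
    have h := hψ.clm_avg hact hf x (k - p) (bilinToCLM (wedgeB (W := E) p) (Φ.valAt x p))
    simp only [bilinToCLM_apply] at h
    exact h
  have h2 : ∀ p : Fin (k + 1), Continuous fun t : ℝ =>
      f t • wedgeB p (Φ.valAt x p) ((flow t ψ).valAt x (k - p)) := fun p =>
    hf.smul ((bilinToCLM (wedgeB (W := E) p) (Φ.valAt x p)).continuous.comp
      (hψ.continuous_flow hact x (k - p)))
  simp only [h1]
  rw [← intervalIntegral.integral_finsetSum fun p _ => (h2 p).intervalIntegrable _ _]
  simp only [← Finset.smul_sum]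
  refine intervalIntegral.integral_congr fun t _ => ?_
  simp only [flow_wedge, hΦ, valAt_wedge, wedge_eq_sum_wedgeB]

/-- Integration by parts along the circle action. -/
theorem Smooth.avg_lie (hact : SmoothAction E M) {f f' : ℝ → ℝ} (hf : ∀ t, HasDerivAt f (f' t) t)
    (hf' : Continuous f') {ψ : DForm E M} (hψ : ψ.Smooth) :
    ∀ (x : M) (k : ℕ), (avg f ψ.lie).valAt x k =
      (f 1 - f 0) • ψ.valAt x k - (avg f' ψ).valAt x k := fun x k => by
  have h := intervalIntegral.integral_smul_deriv_eq_deriv_smul (a := 0) (b := 1) (u := f)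
    (v := fun t => (flow t ψ).valAt x k) (fun t _ => hf t)
    (fun t _ => hψ.hasDerivAt_flow hact x k t) (hf'.intervalIntegrable _ _)
    (((hψ.cartan hact).continuous_flow hact x k).intervalIntegrable _ _)
  rw [flow_zero, flow_one] at h
  have h1 : (f 1 - f 0) • ψ.valAt x k = f 1 • ψ.valAt x k - f 0 • ψ.valAt x k := by
    ext u
    exact sub_smul _ _ (ψ.valAt x k u)
  rw [valAt_avg, valAt_avg, h, h1]

/-- Flowing by s shifts the interval of integration, which is harmless because the flow has period
one. The argument needs the constant weight function. -/
theorem flow_avg_one (hact : SmoothAction E M) {ψ : DForm E M} (hψ : ψ.Smooth) (s : ℝ) :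
    flow s (avg (fun _ => 1) ψ) = avg (fun _ => 1) ψ := by
  refine ext_valAt fun x => funext fun k => ?_
  have h1 := hψ.clm_avg hact (f := fun _ => 1) continuous_const (rot s x) k
    (ContinuousAlternatingMap.compContinuousLinearMapCLM (F := ℂ) (ι := Fin k)
      (mfd E E (rot s) x))
  have h2 : ∀ t : ℝ, ContinuousAlternatingMap.compContinuousLinearMapCLM (F := ℂ) (ι := Fin k)
      (mfd E E (rot s) x) ((flow t ψ).valAt (rot s x) k) = (flow (t + s) ψ).valAt x k :=
    fun t => by
      rw [← flow_flow hact]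
      rfl
  simp only [h2, one_smul] at h1
  have hper : Function.Periodic (fun t : ℝ => (flow t ψ).valAt x k) 1 := fun t => by
    have h : flow (t + 1) ψ = flow t ψ := by rw [← flow_flow hact, flow_one]
    simp only [h]
  rw [valAt_avg]
  simp only [one_smul]
  refine h1.trans ?_
  rw [intervalIntegral.integral_comp_add_right (fun t => (flow t ψ).valAt x k)]
  have := hper.intervalIntegral_add_eq (0 + s) 0
  rw [zero_add] at this ⊢
  rw [add_comm 1 s, this, zero_add]

theorem avg_one_of_invariant {ψ : DForm E M} (h : ∀ t : ℝ, flow t ψ = ψ) :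
    avg (fun _ => 1) ψ = ψ := by
  refine ext_valAt fun x => funext fun k => ?_
  rw [valAt_avg]
  simp [h]

end DForm

end Averaging

/-! ### Twisted cohomology for a closed invariant three-form -/

section Flux

variable {E : Type*} [NormedAddCommGroup E] [NormedSpace ℝ E] [FiniteDimensional ℝ E]
  {M : Type*} [TopologicalSpace M] [ChartedSpace E M] [IsManifold 𝓘(ℝ, E) ∞ M]

namespace DForm

/-- The powers of a differential form. -/
def pow (Φ : DForm E M) (j : ℕ) : DForm E M := fun x => wpow (Φ x) j

/-- The inverse of `Φ - c`. -/
def inv (Φ : DForm E M) (c : ℂ) : DForm E M := fun x => invSub (Φ x) c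

theorem pow_succ (Φ : DForm E M) (j : ℕ) : pow Φ (j + 1) = wedge Φ (pow Φ j) := rfl

theorem smooth_pow_zero (Φ : DForm E M) : (pow Φ 0).Smooth := fun x k => by
  have h : (fun y => (pow Φ 0).inChart x y k) = fun _ => (unit : Alt E) k := by
    funext y
    exact congrFun (altPullback_unit _) k
  rw [chartRep_eq, h]
  exact contDiffOn_const

theorem Smooth.power {Φ : DForm E M} (h : Φ.Smooth) (j : ℕ) : (pow Φ j).Smooth := by
  induction j with
  | zero => exact smooth_pow_zero Φ
  | succ j ih => exact h.wedge ih

theorem d_pow_zero (Φ : DForm E M) : (pow Φ 0).d = 0 := by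
  refine ext_valAt fun x => ?_
  have h : extd ((pow Φ 0).inChart x) (extChartAt 𝓘(ℝ, E) x x) = 0 := by
    funext k
    cases k with
    | zero => rfl
    | succ k =>
      have h1 : (fun y => (pow Φ 0).inChart x y k) = fun _ => (unit : Alt E) k := by
        funext y
        exact congrFun (altPullback_unit _) k
      change extDeriv (fun y => (pow Φ 0).inChart x y k) _ = 0
      rw [h1, extDeriv, fderiv_fun_const]
      ext u
      simp [ContinuousAlternatingMap.alternatizeUncurryFin_apply]
  rw [valAt_d, h]
  rfl

theorem d_zero : (0 : DForm E M).d = 0 := by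
  have h := Smooth.d_smul 0 (Smooth.zero (E := E) (M := M))
  have h1 : ∀ β : DForm E M, (0 : ℂ) • β = 0 := fun β => funext fun x => zero_smul_alt _
  rwa [h1, h1] at h

theorem wedge_zero (α : DForm E M) : wedge α 0 = 0 := funext fun _ => TDuality.wedge_zero _

theorem zero_wedge (α : DForm E M) : wedge 0 α = 0 := funext fun _ => TDuality.zero_wedge _

theorem wedge_add (α β γ : DForm E M) : wedge α (β + γ) = wedge α β + wedge α γ :=
  funext fun _ => TDuality.wedge_add _ _ _

theorem wedge_assoc (α β γ : DForm E M) : wedge (wedge α β) γ = wedge α (wedge β γ) :=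
  funext fun _ => TDuality.wedge_assoc _ _ _

theorem wedge_smul (c : ℂ) (α β : DForm E M) : wedge α (c • β) = c • wedge α β :=
  funext fun _ => TDuality.wedge_smul _ _ _

theorem Smooth.d_wedge_closed {Φ α : DForm E M} (hΦ : Φ.Smooth) (hd : Φ.d = 0) (hs : Φ.sgn = Φ)
    (hα : α.Smooth) : (DForm.wedge Φ α).d = DForm.wedge Φ α.d := by
  rw [hΦ.d_wedge hα, hd, hs, DForm.zero_wedge, zero_add]

theorem Smooth.d_pow {Φ : DForm E M} (hΦ : Φ.Smooth) (hd : Φ.d = 0) (hs : Φ.sgn = Φ) (j : ℕ) :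
    (pow Φ j).d = 0 := by
  induction j with
  | zero => exact d_pow_zero Φ
  | succ j ih => rw [pow_succ, hΦ.d_wedge_closed hd hs (hΦ.power j), ih, DForm.wedge_zero]

theorem inv_eq_sum {Φ : DForm E M} (h0 : ∀ x, Φ x 0 = 0) (c : ℂ) :
    inv Φ c = -∑ j ∈ Finset.range (Module.finrank ℝ E + 1), c⁻¹ ^ (j + 1) • pow Φ j := by
  refine ext_valAt fun x => ?_
  have h := invSub_eq_sum (a := Φ.valAt x) (h0 x) c (Nat.lt_succ_self _)
  refine h.trans ?_
  have h2 : ∀ s : Finset ℕ, (∑ j ∈ s, c⁻¹ ^ (j + 1) • pow Φ j).valAt x =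
      ∑ j ∈ s, c⁻¹ ^ (j + 1) • wpow (Φ.valAt x) j := fun s => Finset.sum_apply x s _
  rw [← h2]
  rfl

theorem Smooth.inverse {Φ : DForm E M} (hΦ : Φ.Smooth) (h0 : ∀ x, Φ x 0 = 0) (c : ℂ) :
    (inv Φ c).Smooth := by
  rw [inv_eq_sum h0]
  exact (Smooth.sum _ fun j _ => (hΦ.power j).smul _).neg

theorem d_sum {ι : Type*} (s : Finset ι) {f : ι → DForm E M} (h : ∀ i ∈ s, (f i).Smooth) :
    (∑ i ∈ s, f i).d = ∑ i ∈ s, (f i).d := by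
  classical
  induction s using Finset.induction_on with
  | empty => exact d_zero
  | insert i s hi ih =>
    have hs : ∀ j ∈ s, (f j).Smooth := fun j hj => h j (Finset.mem_insert_of_mem hj)
    rw [Finset.sum_insert hi, Finset.sum_insert hi,
      (h i (Finset.mem_insert_self i s)).d_add (Smooth.sum s hs), ih hs]

theorem Smooth.d_inv {Φ : DForm E M} (hΦ : Φ.Smooth) (h0 : ∀ x, Φ x 0 = 0) (hd : Φ.d = 0)
    (hs : Φ.sgn = Φ) (c : ℂ) : (inv Φ c).d = 0 := by
  have h1 : ∀ j ∈ Finset.range (Module.finrank ℝ E + 1), (c⁻¹ ^ (j + 1) • pow Φ j).Smooth :=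
    fun j _ => (hΦ.power j).smul _
  rw [inv_eq_sum h0, (Smooth.sum _ h1).d_neg, d_sum _ h1, neg_eq_zero]
  refine Finset.sum_eq_zero fun j _ => ?_
  rw [(hΦ.power j).d_smul, hΦ.d_pow hd hs]
  exact funext fun x => smul_zero_alt _

/-- The iterated primitives of the constant function `1` given by the Bernoulli polynomials. -/
def bern (j : ℕ) (t : ℝ) : ℝ := bernoulliFun j t / j.factorial

theorem bern_zero : bern 0 = fun _ => 1 := by
  funext t
  simp [bern]

theorem contDiff_bern (j : ℕ) : ContDiff ℝ ∞ (bern j) :=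
  ((contDiff_bernoulliFun j).of_le le_top).div_const _

theorem hasDerivAt_bern (j : ℕ) (t : ℝ) : HasDerivAt (bern (j + 1)) (bern j t) t := by
  refine ((antideriv_bernoulliFun j t).div_const (j.factorial : ℝ)).congr_of_eventuallyEq
    (Filter.Eventually.of_forall fun s => ?_)
  simp only [bern, Nat.factorial_succ]
  push_cast
  rw [div_div]

/-- Among the Bernoulli polynomials only B_1 has different values at 0 and 1. The boundary term of
the integration by parts therefore contributes ψ once, at the first step. -/
theorem bern_jump (j : ℕ) : bern (j + 1) 1 - bern (j + 1) 0 = if j = 0 then 1 else 0 := by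
  rw [bern, bern, ← sub_div, bernoulliFun_eval_one]
  split_ifs with h1 h2 h2
  · simp [h2]
  · omega
  · omega
  · simp

variable [MulAction Circle M]

theorem Smooth.avg_add (hact : SmoothAction E M) {f : ℝ → ℝ} (hf : Continuous f)
    {α β : DForm E M} (hα : α.Smooth) (hβ : β.Smooth) :
    avg f (α + β) = avg f α + avg f β := by
  refine ext_valAt fun x => funext fun k => ?_
  refine Eq.trans ?_ (intervalIntegral.integral_add
    ((hf.smul (hα.continuous_flow hact x k)).intervalIntegrable 0 1)
    ((hf.smul (hβ.continuous_flow hact x k)).intervalIntegrable 0 1))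
  refine intervalIntegral.integral_congr fun t _ => ?_
  ext u
  exact smul_add (f t) ((flow t α).valAt x k u) ((flow t β).valAt x k u)

/-- A closed invariant three-form, for a smooth circle action. -/
structure InvariantFlux (H : DForm E M) : Prop where
  action : SmoothAction E M
  smooth : H.Smooth
  closed : H.d = 0
  invariant : ∀ t : ℝ, flow t H = H
  degree : H.HasDegree 3

namespace InvariantFlux

variable {H : DForm E M} (hH : InvariantFlux H)
include hH

theorem sgn_eq (x : M) : TDuality.sgn (H x) = -H x := by
  rw [sgn_of_degree (hH.degree x)]
  have h : (-1 : ℂ) ^ 3 = -1 := by norm_num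
  rw [h, neg_one_smul_alt]

theorem iota_smooth : H.iota.Smooth := hH.smooth.iota hH.action

theorem iota_sgn (x : M) : TDuality.sgn (H.iota x) = H.iota x := by
  have h : TDuality.sgn (contr (genField E x) (H x)) = contr (genField E x) (H x) := by
    rw [sgn_contr, hH.sgn_eq, contr_neg, neg_neg]
  exact h

/-- Invariance gives L_v H = 0, and closedness of H leaves only the term d ι_v H in Cartan's
formula. -/
theorem iota_closed : H.iota.d = 0 := by
  have h := lie_of_flow_eq hH.action hH.smooth hH.invariant
  have h1 : H.lie = H.iota.d + H.d.iota := rfl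
  rw [h1, hH.closed] at h
  have h2 : (0 : DForm E M).iota = 0 := rfl
  rwa [h2, add_zero] at h

theorem iota_flow (t : ℝ) : flow t H.iota = H.iota := by
  rw [flow_iota hH.action, hH.invariant]

theorem iota_zero (x : M) : H.iota x 0 = 0 := by
  have h : H x 1 = 0 := hH.degree x 1 (by norm_num)
  have h1 : contr (genField E x) (H x) 0 = 0 := by
    ext u
    rw [contr_apply, h]
    rfl
  exact h1

theorem twistedD_smooth {ψ : DForm E M} (hψ : ψ.Smooth) : (twistedD H ψ).Smooth :=
  hψ.d.add (hH.smooth.wedge hψ)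

theorem twistedD_twistedD {ψ : DForm E M} (hψ : ψ.Smooth) : twistedD H (twistedD H ψ) = 0 := by
  have h1 : twistedD H (twistedD H ψ) =
      (ψ.d + wedge H ψ).d + wedge H (ψ.d + wedge H ψ) := rfl
  have h2 : wedge H.sgn ψ.d = -wedge H ψ.d := funext fun x => by
    have h : TDuality.wedge (TDuality.sgn (H x)) (ψ.d x) = -TDuality.wedge (H x) (ψ.d x) := by
      rw [hH.sgn_eq, neg_wedge]
    exact h
  have h3 : wedge H (wedge H ψ) = 0 := funext fun x => by
    have h : TDuality.wedge (H x) (TDuality.wedge (H x) (ψ x)) = 0 := by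
      rw [← TDuality.wedge_assoc, wedge_self_of_odd (hH.sgn_eq x), TDuality.zero_wedge]
    exact h
  rw [h1, hψ.d.d_add (hH.smooth.wedge hψ), hψ.d_d, hH.smooth.d_wedge hψ, hH.closed, wedge_add, h2,
    h3, DForm.zero_wedge]
  abel

theorem twistedD_flow {ψ : DForm E M} (hψ : ψ.Smooth) (t : ℝ) :
    flow t (twistedD H ψ) = twistedD H (flow t ψ) := by
  rw [twistedD, flow_add, flow_wedge, hH.invariant, hψ.flow_d hH.action]
  rfl

theorem twistedD_smul (c : ℂ) {ψ : DForm E M} (hψ : ψ.Smooth) :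
    twistedD H (c • ψ) = c • twistedD H ψ := by
  rw [twistedD, hψ.d_smul, wedge_smul, twistedD]
  exact funext fun x => (smul_add c (ψ.d x) (wedge H ψ x)).symm

theorem twistedD_add {α β : DForm E M} (hα : α.Smooth) (hβ : β.Smooth) :
    twistedD H (α + β) = twistedD H α + twistedD H β := by
  rw [twistedD, hα.d_add hβ, wedge_add, twistedD, twistedD]
  abel

/-- The twisted version of Cartan's formula. -/
theorem twisted_cartan (ψ : DForm E M) :
    twistedD H ψ.iota + (twistedD H ψ).iota = ψ.lie + wedge H.iota ψ := by
  have h1 : (wedge H ψ).iota = wedge H.iota ψ - wedge H ψ.iota := funext fun x => by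
    have h : contr (genField E x) (TDuality.wedge (H x) (ψ x)) =
        TDuality.wedge (contr (genField E x) (H x)) (ψ x) -
          TDuality.wedge (H x) (contr (genField E x) (ψ x)) := by
      rw [contr_wedge, hH.sgn_eq, neg_wedge, sub_eq_add_neg]
    exact h
  have h2 : (twistedD H ψ).iota = ψ.d.iota + (wedge H ψ).iota := rfl
  have h3 : ψ.lie = ψ.iota.d + ψ.d.iota := rfl
  rw [h2, h1, h3, twistedD]
  abel

/-- Closed even forms are scalars for the twisted differential. This is applied to powers of ι_v H
and to the inverse of ι_v H - 2πin. -/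
theorem twistedD_wedge {Φ α : DForm E M} (hΦ : Φ.Smooth) (hd : Φ.d = 0) (hs : Φ.sgn = Φ)
    (hα : α.Smooth) : twistedD H (wedge Φ α) = wedge Φ (twistedD H α) := by
  have h : wedge H (wedge Φ α) = wedge Φ (wedge H α) := funext fun x => by
    have h : TDuality.wedge (H x) (TDuality.wedge (Φ x) (α x)) =
        TDuality.wedge (Φ x) (TDuality.wedge (H x) (α x)) := by
      rw [← TDuality.wedge_assoc, ← TDuality.wedge_assoc,
        wedge_comm_of_even (congrFun hs x) (H x)]
    exact h
  rw [twistedD, hΦ.d_wedge_closed hd hs hα, h, twistedD, wedge_add]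

/-- The contracting homotopy on the forms of weight `-n`. -/
theorem weight_homotopy {n : ℤ} (hn : n ≠ 0) {ψ : DForm E M} (hψ : ψ ∈ weightForms E M (-n)) :
    twistedD H (wedge (inv H.iota (eig n)) ψ.iota) +
      wedge (inv H.iota (eig n)) (twistedD H ψ).iota = ψ := by
  have hs := funext hH.iota_sgn
  rw [hH.twistedD_wedge (hH.iota_smooth.inverse hH.iota_zero _)
      (hH.iota_smooth.d_inv hH.iota_zero hH.iota_closed hs _)
      (funext fun x => sgn_invSub (hH.iota_sgn x) _) (hψ.1.iota hH.action),
    ← wedge_add, hH.twisted_cartan ψ, lie_of_mem_weightForms hH.action hψ]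
  -- This is where n ≠ 0 enters: the constant part -2πin has to be invertible.
  have hc : eig n ≠ 0 := by
    simp [eig, Real.pi_ne_zero, hn]
  have hm : eig (-n) = -eig n := by simp [eig]
  rw [hm]
  refine funext fun x => ?_
  have h1 : TDuality.wedge (invSub (H.iota x) (eig n))
      (-(eig n) • ψ x + TDuality.wedge (H.iota x) (ψ x)) = ψ x := by
    rw [TDuality.wedge_add, ← TDuality.wedge_assoc, TDuality.wedge_smul, ← smul_wedge,
      ← add_wedge, ← wedge_comm_of_even (hH.iota_sgn x), add_comm]
    have h2 := wedge_invSub (V := E) (a := H.iota.valAt x) (hH.iota_zero x) hc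
    have h3 : -(eig n) • invSub (H.iota.valAt x) (eig n) =
        -(eig n • invSub (H.iota.valAt x) (eig n)) := by
      ext k u
      exact neg_mul _ _
    rw [sub_eq_add_neg, ← h3] at h2
    exact (congrArg (fun a => TDuality.wedge a (ψ.valAt x)) h2).trans (unit_wedge _)
  exact h1

theorem inv_flow (c : ℂ) (t : ℝ) : flow t (inv H.iota c) = inv H.iota c := by
  refine funext fun x => (altPullback_invSub _ _ _).trans ?_
  exact congrArg (fun a => invSub a c) (congrFun (hH.iota_flow t) x)

theorem homotopy_mem {n : ℤ} (c : ℂ) {ψ : DForm E M} (hψ : ψ ∈ weightForms E M n) :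
    wedge (inv H.iota c) ψ.iota ∈ weightForms E M n := by
  rw [mem_weightForms_iff hH.action] at hψ ⊢
  refine ⟨(hH.iota_smooth.inverse hH.iota_zero _).wedge (hψ.1.iota hH.action), fun t => ?_⟩
  rw [flow_wedge, hH.inv_flow, flow_iota hH.action, hψ.2 t, ← wedge_smul]
  rfl

theorem twistedD_mem {n : ℤ} {ψ : DForm E M} (hψ : ψ ∈ weightForms E M n) :
    twistedD H ψ ∈ weightForms E M n := by
  rw [mem_weightForms_iff hH.action] at hψ ⊢
  refine ⟨hH.twistedD_smooth hψ.1, fun t => ?_⟩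
  rw [hH.twistedD_flow hψ.1, hψ.2 t, hH.twistedD_smul _ hψ.1]

theorem isAcyclicOn {n : ℤ} (hn : n ≠ 0) : IsAcyclicOn (twistedD H) (weightForms E M (-n)) := by
  refine ⟨fun ψ hψ => ⟨hH.twistedD_mem hψ, hH.twistedD_twistedD hψ.1⟩, fun ψ hψ h0 => ?_⟩
  refine ⟨wedge (inv H.iota (eig n)) ψ.iota, hH.homotopy_mem _ hψ, ?_⟩
  have h := hH.weight_homotopy hn hψ
  have h1 : (0 : DForm E M).iota = 0 := rfl
  rwa [h0, h1, DForm.wedge_zero, add_zero] at h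

theorem twistedD_avg {f : ℝ → ℝ} (hf : ContDiff ℝ ∞ f) {ψ : DForm E M} (hψ : ψ.Smooth) :
    twistedD H (avg f ψ) = avg f (twistedD H ψ) := by
  rw [twistedD, hψ.d_avg hH.action hf, ← hψ.avg_wedge hH.action hf.continuous hH.invariant,
    twistedD, hψ.d.avg_add hH.action hf.continuous (hH.smooth.wedge hψ)]

/-- For closed ψ the twisted Cartan formula reads D ι_v ψ = L_v ψ + ι_v H ∧ ψ. Average it against
`bern (j + 1)`: the Lie derivative is integrated by parts, and the invariant factor ι_v H comes out
of the average. -/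
theorem twistedD_avg_bern {ψ : DForm E M} (hψ : ψ.Smooth) (h0 : twistedD H ψ = 0) (j : ℕ) :
    twistedD H (avg (bern (j + 1)) ψ.iota) =
      (if j = 0 then ψ else 0) - avg (bern j) ψ + wedge H.iota (avg (bern (j + 1)) ψ) := by
  have h1 : (0 : DForm E M).iota = 0 := rfl
  have h2 := hH.twisted_cartan ψ
  rw [h0, h1, add_zero] at h2
  rw [hH.twistedD_avg (contDiff_bern _) (hψ.iota hH.action), h2,
    (hψ.cartan hH.action).avg_add hH.action (contDiff_bern _).continuous (hH.iota_smooth.wedge hψ),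
    hψ.avg_wedge hH.action (contDiff_bern _).continuous hH.iota_flow]
  congr 1
  refine ext_valAt fun x => funext fun k => ?_
  rw [hψ.avg_lie hH.action (hasDerivAt_bern j) (contDiff_bern j).continuous, bern_jump]
  split_ifs
  · ext u
    exact congrArg (fun z => z - (avg (bern j) ψ).valAt x k u) (one_smul ℝ (ψ.valAt x k u))
  · ext u
    exact congrArg (fun z => z - (avg (bern j) ψ).valAt x k u) (zero_smul ℝ (ψ.valAt x k u))

/-- Each step adds (ι_v H)^{j+1} times the average of ι_v ψ against the next Bernoulli weight. Its
differential cancels the current error and leaves one with a higher power of ι_v H. -/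
theorem exists_twistedD_eq {ψ : DForm E M} (hψ : ψ.Smooth) (h0 : twistedD H ψ = 0) (j : ℕ) :
    ∃ α : DForm E M, α.Smooth ∧ twistedD H α = ψ - avg (fun _ => 1) ψ +
      wedge (pow H.iota (j + 1)) (avg (bern (j + 1)) ψ) := by
  have hs := funext hH.iota_sgn
  have hα : ∀ j, (avg (bern (j + 1)) ψ.iota).Smooth := fun j =>
    (hψ.iota hH.action).average hH.action (contDiff_bern _)
  induction j with
  | zero =>
    refine ⟨_, hα 0, ?_⟩
    have h1 : pow H.iota (0 + 1) = H.iota := funext fun x => wedge_unit _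
    rw [hH.twistedD_avg_bern hψ h0 0, if_pos rfl, bern_zero, h1]
  | succ j ih =>
    obtain ⟨α, hsm, h⟩ := ih
    have hp : (pow H.iota (j + 1)).sgn = pow H.iota (j + 1) :=
      funext fun x => sgn_wpow (hH.iota_sgn x) _
    refine ⟨α + wedge (pow H.iota (j + 1)) (avg (bern (j + 1 + 1)) ψ.iota),
      hsm.add ((hH.iota_smooth.power _).wedge (hα (j + 1))), ?_⟩
    rw [hH.twistedD_add hsm ((hH.iota_smooth.power _).wedge (hα (j + 1))), h,
      hH.twistedD_wedge (hH.iota_smooth.power _) (hH.iota_smooth.d_pow hH.iota_closed hs _) hp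
        (hα (j + 1)), hH.twistedD_avg_bern hψ h0 (j + 1), if_neg (Nat.succ_ne_zero j), zero_sub,
      wedge_add, ← wedge_assoc]
    have h1 : wedge (pow H.iota (j + 1)) H.iota = pow H.iota (j + 1 + 1) :=
      funext fun x => (wedge_comm_of_even (hH.iota_sgn x) _).symm
    have h2 : wedge (pow H.iota (j + 1)) (-avg (bern (j + 1)) ψ) =
        -wedge (pow H.iota (j + 1)) (avg (bern (j + 1)) ψ) := funext fun x => wedge_neg _ _
    rw [h1, h2]
    abel

/-- A twisted closed form is cohomologous to its average over the circle action. -/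
theorem exists_twistedD_eq_sub_avg {ψ : DForm E M} (hψ : ψ.Smooth) (h0 : twistedD H ψ = 0) :
    ∃ α : DForm E M, α.Smooth ∧ twistedD H α = ψ - avg (fun _ => 1) ψ := by
  -- With j the dimension, the error contains the power j + 1 of a form without degree zero part,
  -- which is zero.
  obtain ⟨α, hα, h⟩ := hH.exists_twistedD_eq hψ h0 (Module.finrank ℝ E)
  have h1 : pow H.iota (Module.finrank ℝ E + 1) = 0 := funext fun x =>
    wpow_eq_zero (V := E) (a := H.iota.valAt x) (hH.iota_zero x) (Nat.lt_succ_self _)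
  rw [h1, DForm.zero_wedge, add_zero] at h
  exact ⟨α, hα, h⟩

theorem avg_mem {ψ : DForm E M} (hψ : ψ.Smooth) : avg (fun _ => 1) ψ ∈ invariantForms E M :=
  mem_invariantForms_iff.2 ⟨hψ.average hH.action contDiff_const, flow_avg_one hH.action hψ⟩

/-- Averaging inverts the inclusion in cohomology. It represents every class by an invariant form,
and it turns a primitive of an invariant form into an invariant primitive, since the average
commutes with D and fixes invariant forms. -/
theorem cohomologyConcentratedIn :
    CohomologyConcentratedIn (twistedD H) (invariantForms E M) (smoothForms E M) := by
  refine ⟨fun ψ hψ => hψ.1, fun ψ hψ => ⟨?_, hH.twistedD_twistedD hψ.1⟩,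
    fun ψ hψ => ⟨hH.twistedD_smooth hψ, hH.twistedD_twistedD hψ⟩, fun ψ hψ h0 => ?_, ?_⟩
  · rw [mem_invariantForms_iff] at hψ ⊢
    refine ⟨hH.twistedD_smooth hψ.1, fun t => ?_⟩
    rw [hH.twistedD_flow hψ.1, hψ.2]
  · obtain ⟨α, hα, h⟩ := hH.exists_twistedD_eq_sub_avg hψ h0
    refine ⟨_, hH.avg_mem hψ, ?_, α, hα, ?_⟩
    · rw [hH.twistedD_avg contDiff_const hψ, h0]
      -- The zero form is invariant, hence equal to its own average.
      exact avg_one_of_invariant fun t => rfl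
    · rw [h]
      abel
  · rintro ψ₀ hψ₀ ⟨α, hα, rfl⟩
    refine ⟨_, hH.avg_mem hα, ?_⟩
    rw [hH.twistedD_avg contDiff_const hα]
    exact avg_one_of_invariant (mem_invariantForms_iff.1 hψ₀).2

end InvariantFlux

end DForm

end Flux

/-! ### Circle bundles, connections and basic forms -/

section Bundles

variable {EX : Type*} [NormedAddCommGroup EX] [NormedSpace ℝ EX]
  {X : Type*} [TopologicalSpace X] [ChartedSpace EX X]
  {E : Type*} [NormedAddCommGroup E] [NormedSpace ℝ E]
  {Z : Type*} [TopologicalSpace Z] [ChartedSpace E Z] [MulAction Circle Z]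

namespace CircleBundle

variable (P : CircleBundle EX X E Z)

theorem smoothAction (P : CircleBundle EX X E Z) : SmoothAction E Z := P.smooth_smul

theorem mdifferentiableAt_proj (z : Z) : MDifferentiableAt 𝓘(ℝ, E) 𝓘(ℝ, EX) P.proj z :=
  (P.smooth_proj z).mdifferentiableAt (by simp)

theorem proj_surjective : Function.Surjective P.proj := fun x => by
  obtain ⟨U, e, -, hx, -, ht, hp, -⟩ := P.exists_triv x
  have hmem : (x, (1 : Circle)) ∈ e.target := by rw [ht]; exact ⟨hx, trivial⟩
  refine ⟨e.symm (x, 1), ?_⟩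
  rw [← hp _ (e.map_target hmem), e.right_inv hmem]

/-- The projection of a circle bundle is a submersion. -/
theorem mfd_proj_surjective (z : Z) : Function.Surjective (mfd E EX P.proj z) := by
  obtain ⟨U, e, hU, hx, hs, ht, hp, -, -, hsm⟩ := P.exists_triv (P.proj z)
  have hz : z ∈ e.source := by rw [hs]; exact hx
  have hmem : ∀ y ∈ U, (y, (e z).2) ∈ e.target := fun y hy => by rw [ht]; exact ⟨hy, trivial⟩
  -- Freezing the fibre coordinate of z gives a smooth local section through z; its differential is
  -- a right inverse of that of the projection.
  have hs1 : ContMDiffOn 𝓘(ℝ, EX) 𝓘(ℝ, E) ∞ (fun y => e.symm (y, (e z).2)) U :=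
    hsm.comp (contMDiff_id.prodMk contMDiff_const).contMDiffOn hmem
  have hs2 : MDifferentiableAt 𝓘(ℝ, EX) 𝓘(ℝ, E) (fun y => e.symm (y, (e z).2)) (P.proj z) :=
    (hs1.contMDiffAt (hU.mem_nhds hx)).mdifferentiableAt (by simp)
  have hsz : e.symm (P.proj z, (e z).2) = z := by
    rw [← hp z hz]; exact e.left_inv hz
  have h1 := mfd_comp (f := fun y => e.symm (y, (e z).2))
    (P.mdifferentiableAt_proj (e.symm (P.proj z, (e z).2))) hs2
  have h2 : mfd EX EX (P.proj ∘ fun y => e.symm (y, (e z).2)) (P.proj z) =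
      ContinuousLinearMap.id ℝ EX := by
    rw [← mfd_id (P.proj z)]
    refine mfd_congr ?_
    filter_upwards [hU.mem_nhds hx] with y hy
    have h3 := hp _ (e.map_target (hmem y hy))
    rw [e.right_inv (hmem y hy)] at h3
    exact h3.symm
  rw [h2, hsz] at h1
  exact fun w => ⟨_, (congrArg (fun L => L w) h1).symm⟩

theorem mfd_proj_gen (z : Z) : mfd E EX P.proj z (gen E z) = 0 := P.mfderiv_proj_genField z

theorem iota_pullback_proj (ψ : DForm EX X) :
    (DForm.pullback P.proj ψ : DForm E Z).iota = 0 := by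
  refine DForm.ext_valAt fun z => ?_
  rw [DForm.valAt_iota, DForm.valAt_pullback, contr_altPullback, P.mfd_proj_gen, contr_vec_zero]
  rfl

theorem flow_pullback_proj (ψ : DForm EX X) (t : ℝ) :
    DForm.flow t (DForm.pullback P.proj ψ : DForm E Z) = DForm.pullback P.proj ψ := by
  refine DForm.ext_valAt fun z => ?_
  have h : P.proj ∘ (rot t : Z → Z) = P.proj := funext (P.proj_rot t)
  rw [DForm.valAt_pullback, DForm.valAt_pullback, DForm.valAt_pullback, altPullback_comp,
    ← mfd_comp (P.mdifferentiableAt_proj _) ((P.smooth_rot t z).mdifferentiableAt (by simp)), h,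
    P.proj_rot]

/-- The projection is a surjective submersion. Identities on the base can therefore be checked on a
total space, which is how the Bianchi identities are obtained. -/
theorem pullback_proj_injective {α β : DForm EX X}
    (h : (DForm.pullback P.proj α : DForm E Z) = DForm.pullback P.proj β) : α = β := by
  refine DForm.ext_valAt fun x => ?_
  obtain ⟨z, rfl⟩ := P.proj_surjective x
  exact altPullback_injective (P.mfd_proj_surjective z) (congrFun h z)

theorem eq_zero_of_pullback_eq_zero {α : DForm EX X}
    (h : (DForm.pullback P.proj α : DForm E Z) = 0) : α = 0 :=
  P.pullback_proj_injective h

end CircleBundle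

namespace IsConnection

variable {A : DForm E Z} (hA : IsConnection A)
include hA

theorem sgn_eq (z : Z) : sgn (A.valAt z) = -A.valAt z := by
  have h := sgn_of_degree (a := A.valAt z) (p := 1) (hA.degree z)
  rw [h, pow_one, neg_one_smul_alt]

theorem zero_eq (z : Z) : A.valAt z 0 = 0 := hA.degree z 0 (by norm_num)

theorem contr_gen (z : Z) : contr (gen E z) (A.valAt z) = unit := by
  funext k
  ext u
  cases k with
  | zero =>
    rw [contr_apply]
    have h : (Matrix.vecCons (gen E z) u : Fin 1 → E) = fun _ => genField E z := by
      funext i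
      fin_cases i
      rfl
    exact (congrArg (A z 1) h).trans (hA.genField_eq_one z)
  | succ k =>
    rw [contr_apply]
    have h : A.valAt z (k + 1 + 1) = 0 := hA.degree z (k + 1 + 1) (by omega)
    rw [h]
    rfl

theorem flow_eq (t : ℝ) : DForm.flow t A = A := hA.invariant _

end IsConnection

theorem wedge_hasDegree {V : Type*} [AddCommGroup V] [Module ℝ V] [TopologicalSpace V] {a b : Alt V}
    {p q : ℕ} (ha : ∀ j, j ≠ p → a j = 0) (hb : ∀ j, j ≠ q → b j = 0) (k : ℕ) (hk : k ≠ p + q) :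
    wedge a b k = 0 := by
  ext u
  rw [wedge_apply]
  refine Finset.sum_eq_zero fun i hi => ?_
  have := Finset.HasAntidiagonal.mem_antidiagonal.1 hi
  rw [Finset.sum_eq_zero, mul_zero]
  intro σ _
  by_cases h : i.1 = p
  · simp [blockMul, hb i.2 (by omega)]
  · simp [blockMul, ha _ h]

end Bundles

/-- The algebraic identity behind the composition of the two Hori formulas. -/
theorem wedge_hori {V : Type*} [AddCommGroup V] [Module ℝ V] [TopologicalSpace V]
    [IsTopologicalAddGroup V] [ContinuousSMul ℝ V] {a a' : Alt V} {v : V}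
    (ha0 : a 0 = 0) (ha' : sgn a' = -a') (hv : contr v a = unit)
    (hv' : contr v a' = 0) (g p : Alt V) :
    wedge (wedge (wedge a' g) (contr v (wedge p (wexp (-wedge a a'))))) (wexp (wedge a a')) =
      wedge a' (wedge g (contr v p)) := by
  -- Moving one a' past x produces a' ∧ a' = 0. Hence, behind the leading factor a', every further
  -- term containing a' disappears, and these are exactly the corrections coming from the two
  -- exponentials.
  have hK : ∀ x, wedge a' (wedge x a') = 0 := fun x => by
    rw [← wedge_assoc, wedge_comm_of_odd ha', wedge_assoc, wedge_self_of_odd ha', wedge_zero]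
  have h0 : wedge a a' 0 = 0 := by
    ext u
    rw [wedge_zero_apply, ha0]
    exact zero_mul _
  have hw : wedge (wedge a a') (wedge a a') = 0 := by
    rw [wedge_assoc, hK, wedge_zero]
  have h1 : wexp (wedge a a') = unit + wedge a a' := wexp_of_wedge_self h0 hw
  have h2 : wexp (-wedge a a') = unit + -wedge a a' := by
    refine wexp_of_wedge_self ?_ ?_
    · rw [Pi.neg_apply, h0, neg_zero]
    · rw [neg_wedge, wedge_neg, hw, neg_zero, neg_zero]
  have h3 : contr v (wedge a a') = a' := by
    rw [contr_wedge, hv, hv', unit_wedge, wedge_zero, add_zero]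
  have hK2 : ∀ x y, wedge a' (wedge x (wedge y a')) = 0 := fun x y => by
    rw [← wedge_assoc x y a', hK]
  have hK3 : ∀ x y, wedge a' (wedge x (wedge y (wedge a a'))) = 0 := fun x y => by
    rw [← wedge_assoc y a a', hK2]
  have h4 : contr v (wedge p (wexp (-wedge a a'))) =
      contr v p + -(wedge (contr v p) (wedge a a') + wedge (sgn p) a') := by
    rw [h2, wedge_add, wedge_unit, contr_add, wedge_neg, contr_neg, contr_wedge, h3]
  have h5 : wedge (wedge a' g) (contr v (wedge p (wexp (-wedge a a')))) =
      wedge a' (wedge g (contr v p)) := by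
    rw [h4, wedge_assoc, wedge_add g, wedge_neg, wedge_add g, wedge_add a', wedge_neg,
      wedge_add a' (wedge g (wedge (contr v p) (wedge a a'))), hK3, hK2, add_zero, neg_zero,
      add_zero]
  rw [h5, h1, wedge_add, wedge_unit, wedge_assoc, wedge_assoc, hK3, add_zero]

theorem altOfFun_coe {V : Type*} [AddCommGroup V] [Module ℝ V] [TopologicalSpace V] {k : ℕ}
    (a : V [⋀^Fin k]→L[ℝ] ℂ) : altOfFun (⇑a) = a := by
  have h : ∃ b : V [⋀^Fin k]→L[ℝ] ℂ, ⇑b = ⇑a := ⟨a, rfl⟩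
  rw [altOfFun, dif_pos h]
  exact DFunLike.coe_injective h.choose_spec

/-! ### The correspondence space and the Hori transforms -/

namespace TDualPair

variable {EX : Type*} [NormedAddCommGroup EX] [NormedSpace ℝ EX]
  {X : Type*} [TopologicalSpace X] [ChartedSpace EX X]
  {E : Type*} [NormedAddCommGroup E] [NormedSpace ℝ E]
  {Z : Type*} [TopologicalSpace Z] [ChartedSpace E Z] [MulAction Circle Z]
  {E' : Type*} [NormedAddCommGroup E'] [NormedSpace ℝ E']
  {Z' : Type*} [TopologicalSpace Z'] [ChartedSpace E' Z'] [MulAction Circle Z']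
  (P : TDualPair EX X E Z E' Z')

section Correspondence

/-- The differential of the projection of the correspondence space to `Z`. -/
def prL (c : P.Corr) : P.tangent c →L[ℝ] E :=
  (ContinuousLinearMap.fst ℝ (TangentSpace 𝓘(ℝ, E) c.1.1)
    (TangentSpace 𝓘(ℝ, E') c.1.2)).comp (P.tangent c).subtypeL

/-- The differential of the projection of the correspondence space to `Z'`. -/
def prL' (c : P.Corr) : P.tangent c →L[ℝ] E' :=
  (ContinuousLinearMap.snd ℝ (TangentSpace 𝓘(ℝ, E) c.1.1)
    (TangentSpace 𝓘(ℝ, E') c.1.2)).comp (P.tangent c).subtypeL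

theorem pull_apply (ψ : DForm E Z) (c : P.Corr) :
    P.pull ψ c = altPullback (P.prL c) (ψ.valAt c.1.1) := rfl

theorem pull'_apply (ψ : DForm E' Z') (c : P.Corr) :
    P.pull' ψ c = altPullback (P.prL' c) (ψ.valAt c.1.2) := rfl

theorem prL_vert (c : P.Corr) : P.prL c (P.vert c) = gen E c.1.1 := rfl

theorem prL'_vert (c : P.Corr) : P.prL' c (P.vert c) = 0 := rfl

theorem prL_vert' (c : P.Corr) : P.prL c (P.vert' c) = 0 := rfl

theorem prL'_vert' (c : P.Corr) : P.prL' c (P.vert' c) = gen E' c.1.2 := rfl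

theorem mfd_proj_comp_prL (c : P.Corr) :
    (mfd E EX P.bundle.proj c.1.1).comp (P.prL c) =
      (mfd E' EX P.bundle'.proj c.1.2).comp (P.prL' c) := by
  ext u
  exact u.2

theorem contr_vert_pull (ψ : DForm E Z) (c : P.Corr) :
    contr (P.vert c) (P.pull ψ c) = P.pull ψ.iota c := by
  rw [pull_apply, contr_altPullback, prL_vert]
  rfl

theorem contr_vert_pull' (ψ : DForm E' Z') (c : P.Corr) :
    contr (P.vert c) (P.pull' ψ c) = 0 := by
  rw [pull'_apply, contr_altPullback, prL'_vert, contr_vec_zero, altPullback_zero]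

theorem contr_vert'_pull (ψ : DForm E Z) (c : P.Corr) :
    contr (P.vert' c) (P.pull ψ c) = 0 := by
  rw [pull_apply, contr_altPullback, prL_vert', contr_vec_zero, altPullback_zero]

theorem pull_wedge (α β : DForm E Z) (c : P.Corr) :
    P.pull (DForm.wedge α β) c = wedge (P.pull α c) (P.pull β c) := altPullback_wedge _ _ _

/-- Forms on the base have the same pullback to the correspondence space along both sides. -/
theorem pull_pullback_proj (φ : DForm EX X) :
    P.pull (DForm.pullback P.bundle.proj φ) = P.pull' (DForm.pullback P.bundle'.proj φ) := by
  funext c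
  rw [pull_apply, pull'_apply, DForm.valAt_pullback, DForm.valAt_pullback, altPullback_comp,
    altPullback_comp, mfd_proj_comp_prL, c.2]

theorem prL_surjective (c : P.Corr) : Function.Surjective (P.prL c) := fun w => by
  obtain ⟨w', hw'⟩ := P.bundle'.mfd_proj_surjective c.1.2 (mfd E EX P.bundle.proj c.1.1 w)
  exact ⟨⟨(w, w'), hw'.symm⟩, rfl⟩

/-- The projection of the correspondence space to Z is onto, both on points and on tangent vectors.
The form selected in `fibInt'` is therefore unique. -/
theorem pull_injective {α β : DForm E Z} (h : P.pull α = P.pull β) : α = β := by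
  refine DForm.ext_valAt fun z => ?_
  obtain ⟨z', hz'⟩ := P.bundle'.proj_surjective (P.bundle.proj z)
  exact altPullback_injective (P.prL_surjective ⟨(z, z'), hz'.symm⟩) (congrFun h ⟨(z, z'), hz'.symm⟩)

/-- The differential of `rotC`, as a continuous linear map. -/
def rotL (t : ℝ) (c : P.Corr) : P.tangent c →L[ℝ] P.tangent (P.rotC t c) :=
  ContinuousLinearMap.codRestrict
    (((mfderiv 𝓘(ℝ, E) 𝓘(ℝ, E) (rot t) c.1.1).comp (P.prL c)).prod (P.prL' c))
    (P.tangent (P.rotC t c)) fun u => (P.rotTangent t c u).2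

/-- The differential of `rotC'`, as a continuous linear map. -/
def rotL' (t : ℝ) (c : P.Corr) : P.tangent c →L[ℝ] P.tangent (P.rotC' t c) :=
  ContinuousLinearMap.codRestrict
    ((P.prL c).prod ((mfderiv 𝓘(ℝ, E') 𝓘(ℝ, E') (rot t) c.1.2).comp (P.prL' c)))
    (P.tangent (P.rotC' t c)) fun u => (P.rotTangent' t c u).2

theorem rotL_vert (t : ℝ) (c : P.Corr) : P.rotL t c (P.vert c) = P.vert (P.rotC t c) :=
  Subtype.ext (Prod.ext (P.bundle.smoothAction.mfd_rot_gen t c.1.1) rfl)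

theorem rotL'_vert' (t : ℝ) (c : P.Corr) : P.rotL' t c (P.vert' c) = P.vert' (P.rotC' t c) :=
  Subtype.ext (Prod.ext rfl (P.bundle'.smoothAction.mfd_rot_gen t c.1.2))

theorem altPullback_rotL_pull (t : ℝ) (c : P.Corr) (ψ : DForm E Z) :
    altPullback (P.rotL t c) (P.pull ψ (P.rotC t c)) = P.pull (DForm.flow t ψ) c := by
  rw [pull_apply, pull_apply, DForm.valAt_pullback, altPullback_comp, altPullback_comp]
  rfl

theorem altPullback_rotL_pull' (t : ℝ) (c : P.Corr) (ψ : DForm E' Z') :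
    altPullback (P.rotL t c) (P.pull' ψ (P.rotC t c)) = P.pull' ψ c := by
  rw [pull'_apply, pull'_apply, altPullback_comp]
  rfl

theorem altPullback_rotL'_pull (t : ℝ) (c : P.Corr) (ψ : DForm E Z) :
    altPullback (P.rotL' t c) (P.pull ψ (P.rotC' t c)) = P.pull ψ c := by
  rw [pull_apply, pull_apply, altPullback_comp]
  rfl

theorem altPullback_rotL'_pull' (t : ℝ) (c : P.Corr) (ψ : DForm E' Z') :
    altPullback (P.rotL' t c) (P.pull' ψ (P.rotC' t c)) = P.pull' (DForm.flow t ψ) c := by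
  rw [pull'_apply, pull'_apply, DForm.valAt_pullback, altPullback_comp, altPullback_comp]
  rfl

/-- The twisted fibre integral of a form of the opposite weight is a contraction. -/
theorem fibInt_eq_contr (n : ℤ) {β : P.CForm} (h : ∀ (t : ℝ) (c : P.Corr),
    altPullback (P.rotL t c) (β (P.rotC t c)) = Complex.exp (DForm.eig (-n) * t) • β c)
    (c : P.Corr) : P.fibInt n β c = contr (P.vert c) (β c) := by
  funext k
  refine Eq.trans (congrArg altOfFun (funext fun u => ?_)) (altOfFun_coe _)
  have h1 : ∀ t : ℝ, β (P.rotC t c) (k + 1)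
      (Matrix.vecCons (P.vert (P.rotC t c)) fun i => P.rotTangent t c (u i)) =
      Complex.exp (DForm.eig (-n) * t) * contr (P.vert c) (β c) k u := fun t => by
    rw [← rotL_vert]
    have h2 : altPullback (P.rotL t c)
        (contr (P.rotL t c (P.vert c)) (β (P.rotC t c))) k u =
        Complex.exp (DForm.eig (-n) * t) * contr (P.vert c) (β c) k u := by
      rw [← contr_altPullback, h, contr_smul]
      rfl
    exact h2
  have h3 : ∀ t : ℝ, Complex.exp (2 * Real.pi * Complex.I * n * t) *
      β (P.rotC t c) (k + 1)
        (Matrix.vecCons (P.vert (P.rotC t c)) fun i => P.rotTangent t c (u i)) =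
      contr (P.vert c) (β c) k u := fun t => by
    rw [h1, ← mul_assoc, ← Complex.exp_add]
    -- The twist e^{2πint} cancels the weight -n of the form, so the integrand does not depend on t.
    have h4 : 2 * Real.pi * Complex.I * n * t + DForm.eig (-n) * t = 0 := by
      simp [DForm.eig]
    rw [h4, Complex.exp_zero, one_mul]
  simp only [h3]
  simp

/-- The fibre integral of an invariant form is a contraction. -/
theorem fibInt'_eq {β : P.CForm} (h : ∀ (t : ℝ) (c : P.Corr),
    altPullback (P.rotL' t c) (β (P.rotC' t c)) = β c) {γ : DForm E Z}
    (hγ : ∀ c, P.pull γ c = contr (P.vert' c) (β c)) : P.fibInt' β = γ := by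
  have h0 : ∀ c k, altOfFun (fun u : Fin k → P.tangent c => ∫ t in (0 : ℝ)..1,
        β (P.rotC' t c) (k + 1)
          (Matrix.vecCons (P.vert' (P.rotC' t c)) fun i => P.rotTangent' t c (u i))) =
      P.pull γ c k := fun c k => by
    refine Eq.trans (congrArg altOfFun (funext fun u => ?_)) (altOfFun_coe _)
    have h1 : ∀ t : ℝ, β (P.rotC' t c) (k + 1)
        (Matrix.vecCons (P.vert' (P.rotC' t c)) fun i => P.rotTangent' t c (u i)) =
        P.pull γ c k u := fun t => by
      rw [← rotL'_vert']
      have h2 : altPullback (P.rotL' t c)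
          (contr (P.rotL' t c (P.vert' c)) (β (P.rotC' t c))) k u = P.pull γ c k u := by
        rw [← contr_altPullback, h, hγ]
      exact h2
    simp only [h1]
    simp
  have hex : ∃ γ : DForm E Z, ∀ c k, P.pull γ c k =
      altOfFun fun u : Fin k → P.tangent c => ∫ t in (0 : ℝ)..1,
        β (P.rotC' t c) (k + 1)
          (Matrix.vecCons (P.vert' (P.rotC' t c)) fun i => P.rotTangent' t c (u i)) :=
    ⟨γ, fun c k => (h0 c k).symm⟩
  rw [fibInt', dif_pos hex]
  exact P.pull_injective (funext fun c => funext fun k => (hex.choose_spec c k).trans (h0 c k))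

end Correspondence

/-- In H = A ∧ π^*F' + π^*Ω only A has a vertical component, and A(v) = 1. -/
theorem iota_H : P.H.iota = DForm.pullback P.bundle.proj P.F' := by
  refine DForm.ext_valAt fun z => ?_
  have h1 : P.H.valAt z = wedge (P.A.valAt z)
      ((DForm.pullback P.bundle.proj P.F' : DForm E Z).valAt z) +
      (DForm.pullback P.bundle.proj P.Ω : DForm E Z).valAt z :=
    congrArg (fun ψ : DForm E Z => ψ.valAt z) P.flux
  rw [DForm.valAt_iota, h1, contr_add, contr_wedge, P.isConnection.contr_gen, unit_wedge,
    ← DForm.valAt_iota, ← DForm.valAt_iota, P.bundle.iota_pullback_proj,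
    P.bundle.iota_pullback_proj]
  have h2 : (0 : DForm E Z).valAt z = 0 := rfl
  rw [h2, wedge_zero, add_zero, add_zero]

/-- Both are the pullback of F' from the base. This is how the inverse of dA' - 2πin on the dual
side becomes the inverse of ι_v H - 2πin on Z. -/
theorem pull_iota_H : P.pull P.H.iota = P.pull' P.A'.d := by
  rw [iota_H, pull_pullback_proj, P.curvature']

/-- The first fibre integral is contraction with v, by the weight of ψ. The exponentials drop out by
`wedge_hori`, leaving A' wedged with the pullback of a form on Z. That product is invariant under
the second circle, so the second integral is contraction with the dual generator, which removes A'.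
-/
theorem homotopy_eq (n : ℤ) {ψ : DForm E Z}
    (hψ : ∀ t : ℝ, DForm.flow t ψ = Complex.exp (DForm.eig (-n) * t) • ψ) :
    P.homotopy n ψ = DForm.wedge (DForm.inv P.H.iota (DForm.eig n)) ψ.iota := by
  have hτ : ∀ c, P.tau n ψ c = contr (P.vert c)
      (wedge (P.pull ψ c) (wexp (-wedge (P.pull P.A c) (P.pull' P.A' c)))) := by
    refine P.fibInt_eq_contr n fun t c => ?_
    have h1 : ((P.pull ψ).wedge (CForm.exp (-((P.pull P.A).wedge (P.pull' P.A'))))) (P.rotC t c) =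
        wedge (P.pull ψ (P.rotC t c))
          (wexp (-wedge (P.pull P.A (P.rotC t c)) (P.pull' P.A' (P.rotC t c)))) := rfl
    have h2 : P.pull (Complex.exp (DForm.eig (-n) * t) • ψ) c =
        Complex.exp (DForm.eig (-n) * t) • P.pull ψ c := rfl
    rw [h1, altPullback_wedge, altPullback_wexp, altPullback_neg, altPullback_wedge,
      altPullback_rotL_pull, altPullback_rotL_pull, altPullback_rotL_pull', hψ,
      P.isConnection.flow_eq, h2, smul_wedge]
    rfl
  have hη : ∀ c, P.pull' (P.etaHat n) c =
      wedge (P.pull' P.A' c) (P.pull (DForm.inv P.H.iota (DForm.eig n)) c) := fun c => by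
    have h1 : P.pull (DForm.inv P.H.iota (DForm.eig n)) c =
        invSub (P.pull P.H.iota c) (DForm.eig n) := altPullback_invSub _ _ _
    have h2 : P.pull' (P.etaHat n) c =
        wedge (P.pull' P.A' c) (altPullback (P.prL' c) (invSub (P.A'.d.valAt c.1.2) (DForm.eig n))) :=
      altPullback_wedge _ _ _
    rw [h1, h2, altPullback_invSub, pull_iota_H]
    rfl
  have ha' : ∀ c, sgn (P.pull' P.A' c) = -P.pull' P.A' c := fun c => by
    rw [pull'_apply, sgn_altPullback, P.isConnection'.sgn_eq, altPullback_neg]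
  have hβ : ((P.pull' (P.etaHat n)).wedge (P.tau n ψ)).wedge
      (CForm.exp ((P.pull P.A).wedge (P.pull' P.A'))) =
      fun c => wedge (P.pull' P.A' c)
        (P.pull (DForm.wedge (DForm.inv P.H.iota (DForm.eig n)) ψ.iota) c) := by
    funext c
    have h1 : (((P.pull' (P.etaHat n)).wedge (P.tau n ψ)).wedge
        (CForm.exp ((P.pull P.A).wedge (P.pull' P.A')))) c =
        wedge (wedge (P.pull' (P.etaHat n) c) (P.tau n ψ c))
          (wexp (wedge (P.pull P.A c) (P.pull' P.A' c))) := rfl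
    rw [h1, hη, hτ, wedge_hori ?_ (ha' c) ?_ (P.contr_vert_pull' _ c), contr_vert_pull, pull_wedge]
    · rw [pull_apply]
      have h2 := P.isConnection.zero_eq c.1.1
      ext u
      rw [altPullback_apply, h2]
      rfl
    · rw [pull_apply, contr_altPullback, prL_vert, P.isConnection.contr_gen, altPullback_unit]
  rw [homotopy, sigmaHat, hβ]
  refine P.fibInt'_eq (fun t c => ?_) fun c => ?_
  · rw [altPullback_wedge, altPullback_rotL'_pull, altPullback_rotL'_pull',
      P.isConnection'.flow_eq]
  · rw [contr_wedge, contr_vert'_pull, wedge_zero, add_zero, pull'_apply, contr_altPullback,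
      prL'_vert', P.isConnection'.contr_gen, altPullback_unit, unit_wedge]

/-! ### Bianchi identities and the dual flux -/

section Smooth

variable [FiniteDimensional ℝ EX] [IsManifold 𝓘(ℝ, EX) ∞ X]
  [FiniteDimensional ℝ E] [IsManifold 𝓘(ℝ, E) ∞ Z]
  [FiniteDimensional ℝ E'] [IsManifold 𝓘(ℝ, E') ∞ Z']

theorem invariantFlux : DForm.InvariantFlux P.H where
  action := P.bundle.smoothAction
  smooth := P.smooth_H
  closed := P.closed_H
  invariant _ := P.invariant_H _
  degree := P.degree_H

/-- The pullback of dF is d(dA) = 0, and forms on the base are detected on the total space. -/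
theorem curvature_closed (B : CircleBundle EX X E Z) {A : DForm E Z} (hA : A.Smooth)
    {F : DForm EX X} (hF : F.Smooth) (h : A.d = DForm.pullback B.proj F) : F.d = 0 := by
  refine B.eq_zero_of_pullback_eq_zero ?_
  rw [← hF.d_pullback B.smooth_proj, ← h, hA.d_d]

theorem d_F : P.F.d = 0 := curvature_closed P.bundle P.isConnection.smooth P.smooth_F P.curvature

theorem d_F' : P.F'.d = 0 :=
  curvature_closed P.bundle' P.isConnection'.smooth P.smooth_F' P.curvature'

theorem pullback_wedge {M N : Type*} [TopologicalSpace M] [ChartedSpace E M]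
    [TopologicalSpace N] [ChartedSpace E' N] (f : M → N) (α β : DForm E' N) :
    (DForm.pullback f (DForm.wedge α β) : DForm E M) =
      DForm.wedge (DForm.pullback f α) (DForm.pullback f β) :=
  funext fun _ => altPullback_wedge _ _ _

theorem pullback_add {M N : Type*} [TopologicalSpace M] [ChartedSpace E M]
    [TopologicalSpace N] [ChartedSpace E' N] (f : M → N) (α β : DForm E' N) :
    (DForm.pullback f (α + β) : DForm E M) = DForm.pullback f α + DForm.pullback f β := rfl

/-- The Bianchi identity for the basic part of the fluxes. -/
theorem wedge_F_add_d_Ω : DForm.wedge P.F P.F' + P.Ω.d = 0 := by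
  have hF' := P.smooth_F'.pullback (M := Z) P.bundle.smooth_proj
  have hΩ := P.smooth_Ω.pullback (M := Z) P.bundle.smooth_proj
  have h := P.closed_H
  have h0 : (DForm.pullback P.bundle.proj (0 : DForm EX X) : DForm E Z) = 0 := rfl
  rw [P.flux, (P.isConnection.smooth.wedge hF').d_add hΩ, P.isConnection.smooth.d_wedge hF',
    P.smooth_F'.d_pullback P.bundle.smooth_proj, P.smooth_Ω.d_pullback P.bundle.smooth_proj, d_F',
    h0, DForm.wedge_zero, add_zero, P.curvature, ← pullback_wedge] at h
  exact P.bundle.eq_zero_of_pullback_eq_zero h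

/-- The properties of H' are consequences of its formula. Closedness is the essential one: since dF
= 0 and F is even, dH' is the pullback of F ∧ F' + dΩ, the same base form whose vanishing expresses
dH = 0. -/
theorem invariantFlux' : DForm.InvariantFlux P.H' where
  action := P.bundle'.smoothAction
  smooth := by
    rw [P.flux']
    exact ((P.smooth_F.pullback P.bundle'.smooth_proj).wedge P.isConnection'.smooth).add
      (P.smooth_Ω.pullback P.bundle'.smooth_proj)
  closed := by
    have hF := P.smooth_F.pullback (M := Z') P.bundle'.smooth_proj
    have hΩ := P.smooth_Ω.pullback (M := Z') P.bundle'.smooth_proj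
    have h0 : (DForm.pullback P.bundle'.proj (0 : DForm EX X) : DForm E' Z') = 0 := rfl
    have hs : (DForm.pullback P.bundle'.proj P.F : DForm E' Z').sgn =
        DForm.pullback P.bundle'.proj P.F := by
      refine DForm.ext_valAt fun z => ?_
      have h1 : sgn (P.F.valAt (P.bundle'.proj z)) = P.F.valAt (P.bundle'.proj z) := by
        have h2 := sgn_of_degree (a := P.F.valAt (P.bundle'.proj z)) (p := 2) (P.degree_F _)
        rw [h2]
        ext k u
        have h3 : ((-1 : ℂ) ^ 2) = 1 := by norm_num
        rw [h3]
        exact one_mul _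
      rw [DForm.valAt_sgn, DForm.valAt_pullback, sgn_altPullback, h1]
    rw [P.flux', (hF.wedge P.isConnection'.smooth).d_add hΩ, hF.d_wedge P.isConnection'.smooth,
      P.smooth_F.d_pullback P.bundle'.smooth_proj, P.smooth_Ω.d_pullback P.bundle'.smooth_proj, d_F,
      h0, DForm.zero_wedge, zero_add, hs, P.curvature', ← pullback_wedge, ← pullback_add,
      wedge_F_add_d_Ω, h0]
  invariant t := by
    rw [P.flux', DForm.flow_add, DForm.flow_wedge, P.bundle'.flow_pullback_proj,
      P.bundle'.flow_pullback_proj, P.isConnection'.flow_eq]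
  degree := by
    rw [P.flux']
    intro z j hj
    have h1 : ∀ i, i ≠ 2 → (DForm.pullback P.bundle'.proj P.F : DForm E' Z').valAt z i = 0 :=
      fun i hi => by
        have h2 : P.F.valAt (P.bundle'.proj z) i = 0 := P.degree_F _ i hi
        ext u
        rw [DForm.valAt_pullback, altPullback_apply, h2]
        rfl
    have h3 : (DForm.pullback P.bundle'.proj P.Ω : DForm E' Z').valAt z j = 0 := by
      have h2 : P.Ω.valAt (P.bundle'.proj z) j = 0 := P.degree_Ω _ j hj
      ext u
      rw [DForm.valAt_pullback, altPullback_apply, h2]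
      rfl
    have h4 := wedge_hasDegree (V := E') (b := P.A'.valAt z) h1 (P.isConnection'.degree z) j hj
    exact (congrArg₂ (fun a b : E' [⋀^Fin j]→L[ℝ] ℂ => a + b) h4 h3).trans (add_zero 0)

end Smooth

end TDualPair

end TDuality

end

theorem corollary2p6
    {EX : Type*} [NormedAddCommGroup EX] [NormedSpace ℝ EX] [FiniteDimensional ℝ EX]
    {X : Type*} [TopologicalSpace X] [T2Space X] [SecondCountableTopology X]
    [ChartedSpace EX X] [IsManifold 𝓘(ℝ, EX) ∞ X]
    {E : Type*} [NormedAddCommGroup E] [NormedSpace ℝ E] [FiniteDimensional ℝ E]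
    {Z : Type*} [TopologicalSpace Z] [T2Space Z] [SecondCountableTopology Z]
    [ChartedSpace E Z] [IsManifold 𝓘(ℝ, E) ∞ Z] [MulAction Circle Z]
    {E' : Type*} [NormedAddCommGroup E'] [NormedSpace ℝ E'] [FiniteDimensional ℝ E']
    {Z' : Type*} [TopologicalSpace Z'] [T2Space Z'] [SecondCountableTopology Z']
    [ChartedSpace E' Z'] [IsManifold 𝓘(ℝ, E') ∞ Z'] [MulAction Circle Z']
    (P : TDuality.TDualPair EX X E Z E' Z') :
    (∀ n : ℤ, n ≠ 0 →
      TDuality.IsAcyclicOn (TDuality.DForm.twistedD P.H) (TDuality.weightForms E Z (-n)) ∧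
      TDuality.IsAcyclicOn (TDuality.DForm.twistedD P.H') (TDuality.weightForms E' Z' (-n)) ∧
      (∀ ψ ∈ TDuality.weightForms E Z (-n),
        P.homotopy n ψ ∈ TDuality.weightForms E Z (-n) ∧
        TDuality.DForm.twistedD P.H (P.homotopy n ψ) +
          P.homotopy n (TDuality.DForm.twistedD P.H ψ) = ψ)) ∧
    TDuality.CohomologyConcentratedIn (TDuality.DForm.twistedD P.H)
      (TDuality.invariantForms E Z) (TDuality.smoothForms E Z) ∧
    TDuality.CohomologyConcentratedIn (TDuality.DForm.twistedD P.H')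
      (TDuality.invariantForms E' Z') (TDuality.smoothForms E' Z') := by
  refine ⟨fun n hn => ⟨P.invariantFlux.isAcyclicOn hn, P.invariantFlux'.isAcyclicOn hn,
    fun ψ hψ => ?_⟩, P.invariantFlux.cohomologyConcentratedIn,
    P.invariantFlux'.cohomologyConcentratedIn⟩
  -- The formula for the composite requires the weight condition in integrated form, and it is used
  -- twice: for ψ and for its twisted differential, which has the same weight.
  have hflow := fun {φ : TDuality.DForm E Z} (h : φ ∈ TDuality.weightForms E Z (-n)) =>
    ((TDuality.DForm.mem_weightForms_iff P.bundle.smoothAction).1 h).2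
  rw [P.homotopy_eq n (hflow hψ), P.homotopy_eq n (hflow (P.invariantFlux.twistedD_mem hψ))]
  exact ⟨P.invariantFlux.homotopy_mem _ hψ, P.invariantFlux.weight_homotopy hn hψ⟩
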